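/- **Conventions.** Let $N\ge 0$ be an integer. For $q,a\in\mathbb C$ put $(a;q)_k=\prod_{l=0}^{k-1}(1-aq^l)$ and $\left[{N\atop n}\right]_q=\frac{(q;q)_N}{(q;q)_n(q;q)_{N-n}}$ for $0\le n\le N$. Let $q,c_0,c_1,c_2,c_3,c_4\in\mathbb C$ satisfy $$q^{2N+3}c_0c_1c_2c_3c_4=1 .$$ Half-integer powers are taken multiplicatively: we fix square roots $q^{1/2},c_0^{1/2},\dots,c_4^{1/2}$ with $(q^{1/2})^{2N+3}c_0^{1/2}c_1^{1/2}c_2^{1/2}c_3^{1/2}c_4^{1/2}=1$ (any such choice is allowed), and half-integer powers of monomials in $q,c_0,\dots,c_4$ are the corresponding monomials in these square roots. For integers $M\ge 0$ and $0\le n,x\le M$ (and parameters $b_1,b_2,b_3$ taken among the $c_0,\dots,c_4$) let $$\mathfrak p_n(x;b_1,b_2,b_3;M)=\Omega(n;b_1,b_2,b_3;M)\sum_{k=0}^{n}\frac{(q^{-n},\,b_2b_3q^{n+1},\,q^{-x},\,b_1b_2q^{x+1};q)_k}{(qb_2,\,b_1b_2b_3q^{M+2},\,q^{-M},\,q;q)_k}\,q^k,$$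 $$\Omega(n;b_1,b_2,b_3;M)=\left[{M\atop n}\right]_q\frac{(1-b_2b_3q^{2n+1})\,(qb_2;q)_n\,(b_1b_2b_3q^{M+2};q)_n\,(qb_1;q)_{M-n}}{(qb_2)^{n-M/2}\,(b_2b_3q^{n+1};q)_{M+1}\,(qb_3;q)_n},$$ where $(a_1,\dots,a_m;q)_k=\prod_i(a_i;q)_k$ and the factor $1-b_2b_3q^{2n+1}$ is cancelled against the equal factor of $(b_2b_3q^{n+1};q)_{M+1}$; put $\mathfrak p_n(x;b_1,b_2,b_3;M)=0$ if $n>M$ or $x>M$. Let $$\omega_n(c)=(-1)^n c^{n/2}q^{\binom{n+1}{2}} .$$ For nonnegative integers $i,j$ with $i+j\le N$ and nonnegative integers $x,y$, the Griffiths polynomials of $q$-Racah type are $$\mathcal G_{i,j}(x,y;c_1,c_2,c_3,c_4;N)=\sum_{a=0}^{\min(N-j,\,N-y)}\omega_a\Big(\frac{c_1c_2c_3}{c_4}\Big)\,\mathfrak p_i(a;c_1,c_2,c_3;N-j)\,\mathfrak p_j(y;c_3,c_0,c_4;N-a)\,\mathfrak p_a(x;c_4,c_2,c_1;N-y)$$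 (an empty sum, hence $0$, if $y>N$), where $c_0$ is determined by the constraint above; for the parameters $(c_1,c_0,c_4,c_3)$ the role of $c_0$ is played by $c_2$. The parameters $(c_0;c_1,c_2,c_3,c_4)$ are called *admissible* if - $q\ne0$, all $c_i\neq 0$, and $q,q^2,\dots,q^N\neq1$; - $c_1c_2,\ c_2c_3,\ c_0c_3,\ c_0c_4,\ c_2c_4,\ qc_1c_2c_3,\ qc_0c_3c_4,\ qc_1c_2c_4\notin\{q^{-2},q^{-3},\dots,q^{-2N}\}$; - $c_0,c_1,c_2,c_3,c_4\notin\{q^{-1},q^{-2},\dots,q^{-N}\}$. **Theorem.** Suppose that the parameters of both Griffiths polynomials below are admissible, that is, $(c_0;c_1,c_2,c_3,c_4)$ and $(c_2;c_1,c_0,c_4,c_3)$ are admissible (given the first, the second only adds that $c_0c_1\notin\{q^{-2},\dots,q^{-2N}\}$). Then for all nonnegative integers $i,j$ with $i+j\le N$ and all nonnegative integers $x,y$, $$\mathcal G_{i,j}(x,y;c_1,c_2,c_3,c_4;N)\,\omega_i\Big(\frac{c_2c_3c_4}{c_1}\Big)\,\omega_x\Big(\frac{c_4c_2c_1}{c_3}\Big)\,c_0^{N/2}=\mathcal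 G_{j,i}(y,x;c_1,c_0,c_4,c_3;N)\,\omega_j\Big(\frac{c_3c_0c_4}{c_1}\Big)\,\omega_y\Big(\frac{c_1c_0c_3}{c_4}\Big)\,c_2^{N/2}.$$ -/

import Mathlib

noncomputable section

namespace QGriffiths

/-!
The formulas below involve half-integer powers of `q` and of the parameters `c₀, …, c₄`.
They are evaluated through square roots `r` of `q` and `sᵢ` of `cᵢ`, used multiplicatively:
for example `(q c₂)^(n - N/2)` is `(r * s₂) ^ (2 * n - N)`, and `(c₁ c₂ c₃ / c₄)^(n/2)` is
`(s₁ * s₂ * s₃ / s₄) ^ n`. The functions therefore take the square roots as arguments.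
-/

/-- The `q`-Pochhammer symbol `(a; q)_k = ∏_{l < k} (1 - a q^l)`. -/
def qPoch (a q : ℂ) (k : ℕ) : ℂ := ∏ l ∈ Finset.range k, (1 - a * q ^ l)

/-- The `q`-binomial coefficient, for `n ≤ N`. -/
def qBinom (q : ℂ) (N n : ℕ) : ℂ := qPoch q q N / (qPoch q q n * qPoch q q (N - n))

/-- The terminating basic hypergeometric series `₄φ₃(q^{-n}, a₂, a₃, a₄; b₁, b₂, b₃; q; z)`. -/
def phi43 (q : ℂ) (n : ℕ) (a₂ a₃ a₄ b₁ b₂ b₃ z : ℂ) : ℂ :=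
  ∑ k ∈ Finset.range (n + 1),
    (qPoch (q ^ n)⁻¹ q k * qPoch a₂ q k * qPoch a₃ q k * qPoch a₄ q k) /
      (qPoch b₁ q k * qPoch b₂ q k * qPoch b₃ q k * qPoch q q k) * z ^ k

/-- The quotient `(u q^{n+1}; q)_{N+1} / (1 - u q^{2n+1})` for `n ≤ N`, where the denominator
has been cancelled against the equal factor of the Pochhammer symbol (so that
`u = q^{-1}` and `u = q^{-2N-1}`, which are only apparent poles, are allowed). -/
def reducedPoch (u q : ℂ) (N n : ℕ) : ℂ :=
  ∏ l ∈ (Finset.range (N + 1)).erase n, (1 - u * q ^ (n + 1 + l))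

theorem reducedPoch_mul (u q : ℂ) {N n : ℕ} (hn : n ≤ N) :
    (1 - u * q ^ (2 * n + 1)) * reducedPoch u q N n = qPoch (u * q ^ (n + 1)) q (N + 1) := by
  have h := Finset.mul_prod_erase (Finset.range (N + 1))
    (fun l => 1 - u * q ^ (n + 1 + l)) (Finset.mem_range.mpr (Nat.lt_succ_of_le hn))
  have e : n + 1 + n = 2 * n + 1 := by ring
  simp only [e] at h
  rw [reducedPoch, h, qPoch]
  refine Finset.prod_congr rfl fun l _ => ?_
  ring

/-- The normalization `Ω(n; c₁, c₂, c₃; N)` for `n ≤ N`, with `q = r²` and `cᵢ = sᵢ²`. -/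
def Omega (r s₁ s₂ s₃ : ℂ) (N n : ℕ) : ℂ :=
  let q := r ^ 2
  let c₁ := s₁ ^ 2
  let c₂ := s₂ ^ 2
  let c₃ := s₃ ^ 2
  qBinom q N n *
    (qPoch (q * c₂) q n * qPoch (c₁ * c₂ * c₃ * q ^ (N + 2)) q n * qPoch (q * c₁) q (N - n)) /
    ((r * s₂) ^ (2 * (n : ℤ) - (N : ℤ)) * reducedPoch (c₂ * c₃) q N n * qPoch (q * c₃) q n)

/-- Away from the apparent poles, `Omega` is given by the uncancelled formula. -/
theorem Omega_eq (r s₁ s₂ s₃ : ℂ) {N n : ℕ} (hn : n ≤ N)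
    (h : 1 - s₂ ^ 2 * s₃ ^ 2 * (r ^ 2) ^ (2 * n + 1) ≠ 0) :
    Omega r s₁ s₂ s₃ N n =
      qBinom (r ^ 2) N n *
        ((1 - s₂ ^ 2 * s₃ ^ 2 * (r ^ 2) ^ (2 * n + 1)) * qPoch (r ^ 2 * s₂ ^ 2) (r ^ 2) n *
          qPoch (s₁ ^ 2 * s₂ ^ 2 * s₃ ^ 2 * (r ^ 2) ^ (N + 2)) (r ^ 2) n *
          qPoch (r ^ 2 * s₁ ^ 2) (r ^ 2) (N - n)) /
        ((r * s₂) ^ (2 * (n : ℤ) - (N : ℤ)) *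
          qPoch (s₂ ^ 2 * s₃ ^ 2 * (r ^ 2) ^ (n + 1)) (r ^ 2) (N + 1) *
          qPoch (r ^ 2 * s₃ ^ 2) (r ^ 2) n) := by
  rw [← reducedPoch_mul _ _ hn]
  simp only [Omega]
  rw [← mul_div_mul_left _ _ h]
  congr 1 <;> ring

/-- The normalized `q`-Racah polynomial `𝔭_n(x; c₁, c₂, c₃; N)`, with the convention that it
vanishes for `n > N` or `x > N`; here `q = r²` and `cᵢ = sᵢ²`. -/
def qRacah (r s₁ s₂ s₃ : ℂ) (N n x : ℕ) : ℂ :=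
  let q := r ^ 2
  let c₁ := s₁ ^ 2
  let c₂ := s₂ ^ 2
  let c₃ := s₃ ^ 2
  if n ≤ N ∧ x ≤ N then
    Omega r s₁ s₂ s₃ N n *
      phi43 q n (c₂ * c₃ * q ^ (n + 1)) (q ^ x)⁻¹ (c₁ * c₂ * q ^ (x + 1))
        (q * c₂) (c₁ * c₂ * c₃ * q ^ (N + 2)) (q ^ N)⁻¹ q
  else 0

/-- `ω_n(c) = (-1)^n c^{n/2} q^{n(n+1)/2}`, with `q = r²` and `c = d²`. -/
def omega (r d : ℂ) (n : ℕ) : ℂ := (-1) ^ n * d ^ n * (r ^ 2) ^ ((n + 1).choose 2)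

/-- The Griffiths polynomial of `q`-Racah type `𝒢_{i,j}(x, y; c₁, c₂, c₃, c₄; N)`, with `q = r²`
and `cᵢ = sᵢ²`. The square root `s₀` of `c₀` is the one with `r^{2N+3} s₀ s₁ s₂ s₃ s₄ = 1`,
and the sum is over `0 ≤ a ≤ min (N - j) (N - y)`. -/
def griffiths (r s₁ s₂ s₃ s₄ : ℂ) (N i j x y : ℕ) : ℂ :=
  let s₀ := (r ^ (2 * N + 3) * s₁ * s₂ * s₃ * s₄)⁻¹
  ∑ a ∈ (Finset.range (N + 1)).filter (fun a => a + j ≤ N ∧ a + y ≤ N),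
    omega r (s₁ * s₂ * s₃ / s₄) a * qRacah r s₁ s₂ s₃ (N - j) i a *
      qRacah r s₃ s₀ s₄ (N - a) j y * qRacah r s₄ s₂ s₁ (N - y) a x

/-- The standing constraints on the parameters of `𝒢_{i,j}(x, y; c₁, c₂, c₃, c₄; N)`. -/
structure Admissible (q c₀ c₁ c₂ c₃ c₄ : ℂ) (N : ℕ) : Prop where
  q_ne_zero : q ≠ 0
  c_ne_zero : ∀ c ∈ ({c₀, c₁, c₂, c₃, c₄} : Set ℂ), c ≠ 0
  q_pow_ne_one : ∀ k : ℕ, 1 ≤ k → k ≤ N → q ^ k ≠ 1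
  product_ne : ∀ u ∈ ({c₁ * c₂, c₂ * c₃, c₀ * c₃, c₀ * c₄, c₂ * c₄, q * c₁ * c₂ * c₃,
      q * c₀ * c₃ * c₄, q * c₁ * c₂ * c₄} : Set ℂ),
    ∀ k : ℕ, 2 ≤ k → k ≤ 2 * N → u ≠ (q ^ k)⁻¹
  c_ne : ∀ c ∈ ({c₀, c₁, c₂, c₃, c₄} : Set ℂ), ∀ k : ℕ, 1 ≤ k → k ≤ N → c ≠ (q ^ k)⁻¹

end QGriffiths

end

noncomputable section

namespace QGriffiths

/-! The symmetry is proved by induction on N for generic parameters and then extended to all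
admissible ones by continuity.

Once the constants are stripped off, the polynomial becomes `normGriffiths`: a sum over a of
explicit weights times three balanced ₄φ₃ series. In this form duality of the q-Racah series
exchanges degrees and variables at the cost of c₃ ↔ c₄ (`normGriffiths_dual`). The symmetry to be
proved exchanges c₀ ↔ c₂, c₃ ↔ c₄, i ↔ j and x ↔ y.

The induction rests on two recurrences from size N + 1 to size N. One lowers j and multiplies c₀, c₄
by q (`normGriffiths_lower_j`); it holds term by term, by the backward shift in the middle series
and a shift of one lower parameter in the last. The other lowers i and multiplies c₂, c₃ by q
(`normGriffiths_lower_i`). There the backward shift acts on the first series, whose variable is the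
summation index, so terms a and a + 1 get mixed; a four-term contiguous relation for the last series
recombines them. The point is that the coefficients of the second recurrence are those of the first
after the exchange of parameters and variables (`stepCoeff₀₀_swap` and its companions), so the two
sides of the symmetry satisfy the same recurrence. Multiplying two parameters by q restores the
constraint when N drops by one, which lets the induction run.

This settles i + j > 0, and by duality x + y > 0. If all four indices vanish, the sum is a sum of
products of shifted factorials. Creative telescoping (`baseTerm_step`) gives a recurrence in N that
multiplies c₁, c₃ or c₁, c₄ by q and whose coefficients are symmetric in c₀ and c₂; hence
`normGriffiths_base_symm`.

The factor between the two normalizations (`griffiths_eq`) is itself invariant under the exchange: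
its Pochhammer part visibly, its monomial part by comparing exponents after s₁ is eliminated.
Finally, admissible parameters are put on a curve t ↦ (c₀t⁻³⁰, c₁t², c₂t⁴, c₃t⁸, c₄t¹⁶) inside the
constraint. Generic t are dense, and both sides are continuous at t = 1. -/

theorem qPoch_zero (a q : ℂ) : qPoch a q 0 = 1 := by simp [qPoch]

theorem qPoch_succ (a q : ℂ) (k : ℕ) : qPoch a q (k + 1) = qPoch a q k * (1 - a * q ^ k) := by
  simp [qPoch, Finset.prod_range_succ]

theorem qPoch_succ' (a q : ℂ) (k : ℕ) : qPoch a q (k + 1) = (1 - a) * qPoch (a * q) q k := by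
  simp only [qPoch, Finset.prod_range_succ', pow_zero, mul_one]
  rw [mul_comm]
  congr 1
  exact Finset.prod_congr rfl fun l _ => by ring

theorem qPoch_shift (a q : ℂ) (k : ℕ) :
    (1 - a) * qPoch (a * q) q k = qPoch a q k * (1 - a * q ^ k) := by
  rw [← qPoch_succ, ← qPoch_succ']

theorem qPoch_ne_zero {a q : ℂ} {k : ℕ} (h : ∀ l < k, 1 - a * q ^ l ≠ 0) : qPoch a q k ≠ 0 :=
  Finset.prod_ne_zero_iff.mpr fun l hl => h l (Finset.mem_range.mp hl)

theorem qPoch_eq_zero {a q : ℂ} {k l : ℕ} (hl : l < k) (h : 1 - a * q ^ l = 0) :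
    qPoch a q k = 0 :=
  Finset.prod_eq_zero (Finset.mem_range.mpr hl) h

/-! ### Contiguous relations for terminating ₄φ₃ series. -/

theorem phi43_swap_lower (q : ℂ) (n : ℕ) (a b c e f g z : ℂ) :
    phi43 q n a b c e f g z = phi43 q n a b c e g f z := by
  refine Finset.sum_congr rfl fun k _ => ?_
  ring

/-- Splitting a `₄φ₃` series by shifting one lower parameter against the pair `Y⁻¹, V q Y`. -/
theorem phi43_lower_shift {q : ℂ} {n : ℕ} {a Y V e f g : ℂ} (hY : Y ≠ 0)
    (hV : 1 - V * q * Y ^ 2 ≠ 0) (hg : ∀ k ≤ n, 1 - g * q ^ k ≠ 0) :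
    phi43 q n a Y⁻¹ (V * q * Y) e f g q =
      (1 - V * q * Y) * (1 - g * Y) / ((1 - g) * (1 - V * q * Y ^ 2)) *
        phi43 q n a Y⁻¹ (V * q * Y * q) e f (g * q) q +
      (1 - Y) * (V * q * Y - g) / ((1 - g) * (1 - V * q * Y ^ 2)) *
        phi43 q n a (Y⁻¹ * q) (V * q * Y) e f (g * q) q := by
  simp only [phi43, Finset.mul_sum, ← Finset.sum_add_distrib]
  refine Finset.sum_congr rfl fun k hk => ?_
  have hk : k ≤ n := Nat.lt_succ_iff.mp (Finset.mem_range.mp hk)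
  have g0 : 1 - g ≠ 0 := by simpa using hg 0 (Nat.zero_le _)
  have gk := hg k hk
  have hG : qPoch g q k ≠ 0 := qPoch_ne_zero fun l hl => hg l (by omega)
  have e1 := qPoch_shift (V * q * Y) q k
  have e2 := qPoch_shift Y⁻¹ q k
  have e3 : qPoch (g * q) q k = qPoch g q k * (1 - g * q ^ k) / (1 - g) := by
    rw [eq_div_iff g0, ← qPoch_shift]; ring
  have h1 : (1 - Y) = -Y * (1 - Y⁻¹) := by field_simp; ring
  rw [e3, h1]
  generalize qPoch (q ^ n)⁻¹ q k = A at *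
  generalize qPoch a q k = B at *
  generalize qPoch e q k = E at *
  generalize qPoch f q k = F at *
  generalize qPoch q q k = Q at *
  generalize qPoch Y⁻¹ q k = C at *
  generalize qPoch (V * q * Y) q k = D at *
  generalize qPoch (Y⁻¹ * q) q k = C' at *
  generalize qPoch (V * q * Y * q) q k = D' at *
  generalize qPoch g q k = G at *
  -- As polynomials in q^k, 1 - g q^k is a combination of 1 - V q Y q^k and 1 - Y⁻¹ q^k. By
  -- `qPoch_shift` these two factors raise V q Y and Y⁻¹ respectively, while 1 - g q^k raises g.
  have key : C * D = (1 - g * Y) / (1 - V * q * Y ^ 2) / (1 - g * q ^ k) *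
      (C * ((1 - V * q * Y) * D')) + -Y * (V * q * Y - g) / (1 - V * q * Y ^ 2) /
      (1 - g * q ^ k) * (((1 - Y⁻¹) * C') * D) := by
    rw [e1, e2]
    obtain ⟨d, hd⟩ : ∃ d, d = 1 - V * q * Y ^ 2 := ⟨_, rfl⟩
    rw [← hd] at hV ⊢
    field_simp
    rw [hd]
    ring
  calc A * B * C * D / (E * F * G * Q) * q ^ k
      = A * B * (C * D) / (E * F * G * Q) * q ^ k := by ring
    _ = _ := by
      rw [key, show E * F * (G * (1 - g * q ^ k) / (1 - g)) * Q =
        (E * F * G * Q) * ((1 - g * q ^ k) / (1 - g)) by ring, ← div_div, ← div_div]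
      field_simp

theorem qPoch_inv_pow_eq_zero {q : ℂ} (hq : q ≠ 0) (n : ℕ) : qPoch (q ^ n)⁻¹ q (n + 1) = 0 :=
  qPoch_eq_zero (Nat.lt_succ_self n) (by rw [inv_mul_cancel₀ (pow_ne_zero n hq), sub_self])

theorem qPoch_mul_q {a q : ℂ} (h : 1 - a ≠ 0) (k : ℕ) :
    qPoch (a * q) q k = qPoch a q k * (1 - a * q ^ k) / (1 - a) := by
  rw [eq_div_iff h, ← qPoch_shift]; ring

/-- The sum that governs combinations of the pairs `Y⁻¹, V q² Y` and `q Y⁻¹, V q Y`. -/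
theorem pair_combination {q Y V l₀ l₁ : ℂ} (hY : Y ≠ 0)
    (hV2 : 1 - V * q * Y ^ 2 ≠ 0) (k : ℕ) :
    (1 - V * q * Y) * (l₀ + l₁ * Y) / (1 - V * q * Y ^ 2) *
        (qPoch Y⁻¹ q k * qPoch (V * q * Y * q) q k) +
      (1 - Y) * (V * q * Y * l₀ + l₁) / (1 - V * q * Y ^ 2) *
        (qPoch (Y⁻¹ * q) q k * qPoch (V * q * Y) q k) =
      qPoch Y⁻¹ q k * qPoch (V * q * Y) q k * (l₀ + l₁ * q ^ k) := by
  have e1 := qPoch_shift (V * q * Y) q k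
  have e2 := qPoch_shift Y⁻¹ q k
  have h1 : (1 - Y) = -Y * (1 - Y⁻¹) := by field_simp; ring
  rw [h1]
  generalize qPoch Y⁻¹ q k = C at *
  generalize qPoch (V * q * Y) q k = D at *
  generalize qPoch (Y⁻¹ * q) q k = C' at *
  generalize qPoch (V * q * Y * q) q k = D' at *
  have key : (1 - V * q * Y) * (l₀ + l₁ * Y) / (1 - V * q * Y ^ 2) * (C * D') +
      -Y * (1 - Y⁻¹) * (V * q * Y * l₀ + l₁) / (1 - V * q * Y ^ 2) * (C' * D) =
      (l₀ + l₁ * Y) / (1 - V * q * Y ^ 2) * C * ((1 - V * q * Y) * D') +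
      -Y * (V * q * Y * l₀ + l₁) / (1 - V * q * Y ^ 2) * D * ((1 - Y⁻¹) * C') := by ring
  rw [key, e1, e2]
  obtain ⟨d, hd⟩ : ∃ d, d = 1 - V * q * Y ^ 2 := ⟨_, rfl⟩
  rw [← hd] at hV2 ⊢
  field_simp
  rw [hd]
  ring

/-- The backward shift relation for balanced terminating `₄φ₃` series. -/
theorem phi43_backward_shift {q : ℂ} {n : ℕ} {U Y V e f g : ℂ} (hq : q ≠ 0) (hY : Y ≠ 0)
    (hVY : V * q * Y ≠ 0) (hV : 1 - V * q * Y ^ 2 ≠ 0) (hbal : e * f * g = U * V * q ^ 3)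
    (he : ∀ k ≤ n, 1 - e * q ^ k ≠ 0) (hf : ∀ k ≤ n, 1 - f * q ^ k ≠ 0)
    (hg : ∀ k ≤ n, 1 - g * q ^ k ≠ 0) (hq1 : ∀ k ≤ n, 1 - q ^ (k + 1) ≠ 0) :
    phi43 q (n + 1) (U * q ^ (n + 2)) Y⁻¹ (V * q * Y) e f g q =
      (1 - e * Y) * (1 - f * Y) * (1 - g * Y) * (1 - V * q * Y) /
          (Y * (1 - V * q * Y ^ 2) * ((1 - e) * (1 - f) * (1 - g))) *
        phi43 q n (U * q ^ (n + 3)) Y⁻¹ (V * q * Y * q) (e * q) (f * q) (g * q) q +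
      (1 - Y) * (V * q * Y - e) * (V * q * Y - f) * (V * q * Y - g) /
          (V * q * Y * (1 - V * q * Y ^ 2) * ((1 - e) * (1 - f) * (1 - g))) *
        phi43 q n (U * q ^ (n + 3)) (Y⁻¹ * q) (V * q * Y) (e * q) (f * q) (g * q) q := by
  have e0 : 1 - e ≠ 0 := by simpa using he 0 (Nat.zero_le _)
  have f0 : 1 - f ≠ 0 := by simpa using hf 0 (Nat.zero_le _)
  have g0 : 1 - g ≠ 0 := by simpa using hg 0 (Nat.zero_le _)
  have hV0 : V ≠ 0 := fun h => hVY (by simp [h])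
  set φ : ℕ → ℂ := fun k => qPoch Y⁻¹ q k * qPoch (V * q * Y) q k with hφ
  set τ : ℕ → ℂ := fun k => qPoch (q ^ n)⁻¹ q k * qPoch (U * q ^ (n + 3)) q k with hτ
  -- The term of index k + 1 on the left is a (k + 1) - b k, and the term of index k on the right is
  -- a k - b k. The two sums therefore differ only by the ends a 0 = 1, which is the term of index 0
  -- on the left, and a (n + 1) = 0.
  set a : ℕ → ℂ := fun k => τ k * φ k /
    (qPoch e q k * qPoch f q k * qPoch g q k * qPoch q q k) with ha
  set b : ℕ → ℂ := fun k => τ k * φ (k + 1) * (1 - U * q ^ (k + 2)) /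
    (qPoch e q (k + 1) * qPoch f q (k + 1) * qPoch g q (k + 1) * qPoch q q k) with hb
  have hE : ∀ k ≤ n + 1, qPoch e q k ≠ 0 := fun k hk =>
    qPoch_ne_zero fun l hl => he l (by omega)
  have hF : ∀ k ≤ n + 1, qPoch f q k ≠ 0 := fun k hk =>
    qPoch_ne_zero fun l hl => hf l (by omega)
  have hG : ∀ k ≤ n + 1, qPoch g q k ≠ 0 := fun k hk =>
    qPoch_ne_zero fun l hl => hg l (by omega)
  have hQ : ∀ k ≤ n + 1, qPoch q q k ≠ 0 := fun k hk =>
    qPoch_ne_zero fun l hl => by rw [← pow_succ']; exact hq1 l (by omega)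
  have hpow : ∀ k, q ^ k ≠ 0 := fun k => pow_ne_zero k hq
  have hL : phi43 q (n + 1) (U * q ^ (n + 2)) Y⁻¹ (V * q * Y) e f g q =
      1 + ∑ k ∈ Finset.range (n + 1), (a (k + 1) - b k) := by
    rw [phi43, Finset.sum_range_succ', add_comm]
    congr 1
    · simp [qPoch_zero]
    · refine Finset.sum_congr rfl fun k hk => ?_
      have hk : k ≤ n := Nat.lt_succ_iff.mp (Finset.mem_range.mp hk)
      simp only [ha, hb, hφ, hτ]
      have r1 : qPoch (q ^ (n + 1))⁻¹ q (k + 1) =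
          (1 - (q ^ (n + 1))⁻¹) * qPoch (q ^ n)⁻¹ q k := by
        rw [qPoch_succ']; congr 2; rw [pow_succ]; field_simp
      have r2 : qPoch (U * q ^ (n + 2)) q (k + 1) =
          (1 - U * q ^ (n + 2)) * qPoch (U * q ^ (n + 3)) q k := by
        rw [qPoch_succ']; congr 2; ring
      rw [r1, r2, qPoch_succ (q ^ n)⁻¹, qPoch_succ (U * q ^ (n + 3)), qPoch_succ q q]
      have := hQ k (by omega)
      have hqk : 1 - q * q ^ k ≠ 0 := by rw [← pow_succ']; exact hq1 k hk
      have h1 := hE (k + 1) (by omega)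
      have h2 := hF (k + 1) (by omega)
      have h3 := hG (k + 1) (by omega)
      rw [mul_assoc _ (qPoch Y⁻¹ q (k + 1))]
      generalize qPoch Y⁻¹ q (k + 1) * qPoch (V * q * Y) q (k + 1) = Φ
      generalize qPoch e q (k + 1) = E at *
      generalize qPoch f q (k + 1) = F at *
      generalize qPoch g q (k + 1) = G at *
      generalize qPoch q q k = Q at *
      obtain ⟨d, hd⟩ : ∃ d, d = 1 - q * q ^ k := ⟨_, rfl⟩
      rw [← hd] at hqk ⊢
      have hn := hpow n
      simp only [pow_add, pow_one]
      generalize q ^ n = Z at *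
      field_simp
      rw [hd]
      ring
  have hR : ∀ k ≤ n, a k - b k =
      τ k * ((1 - e * Y) * (1 - f * Y) * (1 - g * Y) * (1 - V * q * Y) /
          (Y * (1 - V * q * Y ^ 2) * ((1 - e) * (1 - f) * (1 - g))) *
          (qPoch Y⁻¹ q k * qPoch (V * q * Y * q) q k) +
        (1 - Y) * (V * q * Y - e) * (V * q * Y - f) * (V * q * Y - g) /
          (V * q * Y * (1 - V * q * Y ^ 2) * ((1 - e) * (1 - f) * (1 - g))) *
          (qPoch (Y⁻¹ * q) q k * qPoch (V * q * Y) q k)) /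
      (qPoch (e * q) q k * qPoch (f * q) q k * qPoch (g * q) q k * qPoch q q k) * q ^ k := by
    intro k hk
    -- With z = q^k, the difference (1 - ez)(1 - fz)(1 - gz) - (1 - Y⁻¹z)(1 - VqYz)(1 - Uq²z) has no
    -- constant term, and `hbal` removes its cubic term. What remains is z times a linear form,
    -- proportional to l₀ + l₁z. The values of that form at z = Y and z = (VqY)⁻¹, where the second
    -- product vanishes, factor; they give c₀ and c₁ below.
    set l₀ : ℂ := (Y⁻¹ + V * q * Y + U * q ^ 2 - e - f - g) / ((1 - e) * (1 - f) * (1 - g))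
      with hl₀
    set l₁ : ℂ := (e * f + e * g + f * g - V * q - U * q ^ 2 * (Y⁻¹ + V * q * Y)) /
      ((1 - e) * (1 - f) * (1 - g)) with hl₁
    have c₀ : (1 - e * Y) * (1 - f * Y) * (1 - g * Y) * (1 - V * q * Y) /
        (Y * (1 - V * q * Y ^ 2) * ((1 - e) * (1 - f) * (1 - g))) =
        (1 - V * q * Y) * (l₀ + l₁ * Y) / (1 - V * q * Y ^ 2) := by
      have : l₀ + l₁ * Y = (1 - e * Y) * (1 - f * Y) * (1 - g * Y) /
          (Y * ((1 - e) * (1 - f) * (1 - g))) := by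
        rw [hl₀, hl₁, ← sub_eq_zero]
        field_simp
        linear_combination Y ^ 3 * hbal
      rw [this, mul_div_assoc', div_div]
      congr 1 <;> ring
    have c₁ : (1 - Y) * (V * q * Y - e) * (V * q * Y - f) * (V * q * Y - g) /
        (V * q * Y * (1 - V * q * Y ^ 2) * ((1 - e) * (1 - f) * (1 - g))) =
        (1 - Y) * (V * q * Y * l₀ + l₁) / (1 - V * q * Y ^ 2) := by
      have : V * q * Y * l₀ + l₁ = (V * q * Y - e) * (V * q * Y - f) * (V * q * Y - g) /
          (V * q * Y * ((1 - e) * (1 - f) * (1 - g))) := by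
        rw [hl₀, hl₁, ← sub_eq_zero]
        field_simp
        linear_combination hbal
      rw [this, mul_div_assoc', div_div]
      congr 1 <;> ring
    rw [c₀, c₁, pair_combination hY hV, qPoch_mul_q e0, qPoch_mul_q f0, qPoch_mul_q g0]
    have ek := he k hk
    have fk := hf k hk
    have gk := hg k hk
    have h1 := hE k (by omega)
    have h2 := hF k (by omega)
    have h3 := hG k (by omega)
    have h4 := hQ k (by omega)
    simp only [ha, hb, hφ, qPoch_succ]
    rw [hl₀, hl₁]
    generalize τ k = T
    generalize qPoch Y⁻¹ q k = Φ
    generalize qPoch (V * q * Y) q k = Ψ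
    generalize qPoch e q k = E at *
    generalize qPoch f q k = F at *
    generalize qPoch g q k = G at *
    generalize qPoch q q k = Q at *
    rw [pow_add]
    generalize q ^ k = z at *
    have key : (1 - e * z) * (1 - f * z) * (1 - g * z) -
        (1 - Y⁻¹ * z) * (1 - V * q * Y * z) * (1 - U * (z * q ^ 2)) =
        z * ((Y⁻¹ + V * q * Y + U * q ^ 2 - e - f - g) +
          (e * f + e * g + f * g - V * q - U * q ^ 2 * (Y⁻¹ + V * q * Y)) * z) := by
      have : Y⁻¹ * Y = 1 := inv_mul_cancel₀ hY
      linear_combination (-z ^ 3) * hbal + (V * q * z ^ 2 * (U * q ^ 2 * z - 1)) * this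
    obtain ⟨d, hd⟩ : ∃ d, d = 1 - e * z := ⟨_, rfl⟩
    obtain ⟨d', hd'⟩ : ∃ d, d = 1 - f * z := ⟨_, rfl⟩
    obtain ⟨d'', hd''⟩ : ∃ d, d = 1 - g * z := ⟨_, rfl⟩
    rw [← hd] at ek key ⊢
    rw [← hd'] at fk key ⊢
    rw [← hd''] at gk key ⊢
    calc _ = T * (Φ * Ψ) * (d * d' * d'' -
        (1 - Y⁻¹ * z) * (1 - V * q * Y * z) * (1 - U * (z * q ^ 2))) /
          (E * d * (F * d') * (G * d'') * Q) := by
          field_simp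
      _ = _ := by
          rw [key]
          field_simp
  have hsum : ∑ k ∈ Finset.range (n + 1), (a (k + 1) - b k) + 1 =
      ∑ k ∈ Finset.range (n + 1), (a k - b k) := by
    have h1 := Finset.sum_range_succ a (n + 1)
    rw [Finset.sum_range_succ'] at h1
    have h2 : a (n + 1) = 0 := by simp [ha, hτ, qPoch_inv_pow_eq_zero hq]
    have h3 : a 0 = 1 := by simp [ha, hτ, hφ, qPoch_zero]
    rw [h2, h3] at h1
    rw [Finset.sum_sub_distrib, Finset.sum_sub_distrib]
    linear_combination h1
  rw [hL, add_comm, hsum, Finset.sum_congr rfl fun k hk =>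
    hR k (Nat.lt_succ_iff.mp (Finset.mem_range.mp hk))]
  simp only [phi43, Finset.mul_sum, ← Finset.sum_add_distrib, hτ]
  refine Finset.sum_congr rfl fun k _ => ?_
  ring

theorem phi43_eq_sum_range_succ {q : ℂ} (hq : q ≠ 0) (n : ℕ) (a b c e f g z : ℂ) :
    phi43 q n a b c e f g z = ∑ k ∈ Finset.range (n + 2),
      (qPoch (q ^ n)⁻¹ q k * qPoch a q k * qPoch b q k * qPoch c q k) /
      (qPoch e q k * qPoch f q k * qPoch g q k * qPoch q q k) * z ^ k := by
  rw [Finset.sum_range_succ, qPoch_inv_pow_eq_zero hq]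
  simp [phi43]

/-- A four-term contiguous relation for balanced terminating `₄φ₃` series. -/
theorem phi43_four_term {q : ℂ} {n : ℕ} {U Y V e f g : ℂ} (hq : q ≠ 0) (hY : Y ≠ 0)
    (hVY : V * q * Y ≠ 0) (hV : 1 - V * q * Y ^ 2 ≠ 0) (hU : 1 - U * q ^ (2 * n + 2) ≠ 0)
    (hbal : e * f * g = U * V * q ^ 3)
    (he : ∀ k ≤ n, 1 - e * q ^ k ≠ 0) (hf : ∀ k < n, 1 - f * q ^ k ≠ 0)
    (hfn : 1 - f * q ^ n ≠ 0 ∨ qPoch Y⁻¹ q (n + 1) = 0)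
    (hg : ∀ k ≤ n, 1 - g * q ^ k ≠ 0) (hq1 : ∀ k ≤ n, 1 - q ^ (k + 1) ≠ 0) :
    (1 - e) * (1 - g) * (f - U * q ^ (n + 2)) / (1 - U * q ^ (2 * n + 2)) *
        phi43 q n (U * q ^ (n + 1)) Y⁻¹ (V * q * Y) e f g q +
      (1 - e) * (1 - g) * (U * q ^ (n + 2)) * (1 - f * q ^ n) / (1 - U * q ^ (2 * n + 2)) *
        phi43 q (n + 1) (U * q ^ (n + 2)) Y⁻¹ (V * q * Y) e f g q =
      f * (1 - V * q * Y) * (1 - e * Y) * (1 - g * Y) / (1 - V * q * Y ^ 2) *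
        phi43 q n (U * q ^ (n + 2)) Y⁻¹ (V * q * Y * q) (e * q) f (g * q) q +
      f * (1 - Y) * (V * q * Y - e) * (V * q * Y - g) / (V * q * Y * (1 - V * q * Y ^ 2)) *
        phi43 q n (U * q ^ (n + 2)) (Y⁻¹ * q) (V * q * Y) (e * q) f (g * q) q := by
  have e0 : 1 - e ≠ 0 := by simpa using he 0 (Nat.zero_le _)
  have g0 : 1 - g ≠ 0 := by simpa using hg 0 (Nat.zero_le _)
  have hV0 : V ≠ 0 := fun h => hVY (by simp [h])
  set φ : ℕ → ℂ := fun k => qPoch Y⁻¹ q k * qPoch (V * q * Y) q k with hφ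
  set τ : ℕ → ℂ := fun k => qPoch (q ^ n)⁻¹ q k * qPoch (U * q ^ (n + 2)) q k with hτ
  -- The telescoping of `phi43_backward_shift` again. Now the two series on the left together
  -- contribute a (k + 1) - b k, and A + B supplies the starting value a 0.
  set a : ℕ → ℂ := fun k => (1 - e) * (1 - g) * f * (τ k * φ k * q ^ k) /
    (qPoch e q k * qPoch f q k * qPoch g q k * qPoch q q k) with ha
  set b : ℕ → ℂ := fun k => (1 - e) * (1 - g) * (U * q ^ 2) * (τ k * φ (k + 1) * q ^ k) /
    (qPoch e q (k + 1) * qPoch f q k * qPoch g q (k + 1) * qPoch q q k) with hb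
  have hE : ∀ k ≤ n + 1, qPoch e q k ≠ 0 := fun k hk =>
    qPoch_ne_zero fun l hl => he l (by omega)
  have hF : ∀ k ≤ n, qPoch f q k ≠ 0 := fun k hk =>
    qPoch_ne_zero fun l hl => hf l (by omega)
  have hG : ∀ k ≤ n + 1, qPoch g q k ≠ 0 := fun k hk =>
    qPoch_ne_zero fun l hl => hg l (by omega)
  have hQ : ∀ k ≤ n + 1, qPoch q q k ≠ 0 := fun k hk =>
    qPoch_ne_zero fun l hl => by rw [← pow_succ']; exact hq1 l (by omega)
  have hpow : ∀ k, q ^ k ≠ 0 := fun k => pow_ne_zero k hq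
  set A := (1 - e) * (1 - g) * (f - U * q ^ (n + 2)) / (1 - U * q ^ (2 * n + 2)) with hA
  set B := (1 - e) * (1 - g) * (U * q ^ (n + 2)) * (1 - f * q ^ n) / (1 - U * q ^ (2 * n + 2))
    with hB
  have hAB : A + B = (1 - e) * (1 - g) * f := by
    rw [hA, hB, ← add_div, div_eq_iff hU]
    ring
  have hL : A * phi43 q n (U * q ^ (n + 1)) Y⁻¹ (V * q * Y) e f g q +
      B * phi43 q (n + 1) (U * q ^ (n + 2)) Y⁻¹ (V * q * Y) e f g q =
      (1 - e) * (1 - g) * f + ∑ k ∈ Finset.range (n + 1), (a (k + 1) - b k) := by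
    rw [phi43_eq_sum_range_succ hq, phi43, Finset.mul_sum, Finset.mul_sum,
      ← Finset.sum_add_distrib, Finset.sum_range_succ', add_comm]
    congr 1
    · simp [qPoch_zero, hAB]
    · refine Finset.sum_congr rfl fun k hk => ?_
      have hk : k ≤ n := Nat.lt_succ_iff.mp (Finset.mem_range.mp hk)
      -- A zero of 1 - f q^k can only occur at k = n. Then every term in question carries the factor
      -- (Y⁻¹; q)_{n+1}, which is zero by `hfn`.
      by_cases hfk : 1 - f * q ^ k = 0
      · obtain rfl : k = n := by
          by_contra h
          exact hf k (by omega) hfk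
        have hφ0 : qPoch Y⁻¹ q (k + 1) = 0 := hfn.resolve_left (not_not.mpr hfk)
        simp [ha, hb, hφ, hφ0]
      simp only [ha, hb, hφ, hτ]
      have r1 : qPoch (q ^ (n + 1))⁻¹ q (k + 1) =
          (1 - (q ^ (n + 1))⁻¹) * qPoch (q ^ n)⁻¹ q k := by
        rw [qPoch_succ']; congr 2; rw [pow_succ]; field_simp
      have r2 : qPoch (U * q ^ (n + 1)) q (k + 1) =
          (1 - U * q ^ (n + 1)) * qPoch (U * q ^ (n + 2)) q k := by
        rw [qPoch_succ']; congr 2; ring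
      rw [r1, r2, qPoch_succ (q ^ n)⁻¹, qPoch_succ (U * q ^ (n + 2)), qPoch_succ q q,
        qPoch_succ f q]
      have h0 := hQ k (by omega)
      have hqk : 1 - q * q ^ k ≠ 0 := by rw [← pow_succ']; exact hq1 k hk
      have h1 := hE (k + 1) (by omega)
      have h2 := hF k hk
      have h3 := hG (k + 1) (by omega)
      have hn := hpow n
      rw [hA, hB]
      simp only [mul_assoc _ (qPoch Y⁻¹ q (k + 1))]
      generalize qPoch Y⁻¹ q (k + 1) * qPoch (V * q * Y) q (k + 1) = Φ
      generalize qPoch (q ^ n)⁻¹ q k = C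
      generalize qPoch (U * q ^ (n + 2)) q k = D
      generalize qPoch e q (k + 1) = E at *
      generalize qPoch f q k = F at *
      generalize qPoch g q (k + 1) = G at *
      generalize qPoch q q k = Q at *
      simp only [pow_add, pow_one, pow_mul'] at hU ⊢
      generalize q ^ n = Z at *
      generalize q ^ k = z at *
      obtain ⟨d, hd⟩ : ∃ d, d = 1 - q * z := ⟨_, rfl⟩
      obtain ⟨d', hd'⟩ : ∃ d, d = 1 - f * z := ⟨_, rfl⟩
      obtain ⟨d'', hd''⟩ : ∃ d, d = 1 - U * (Z ^ 2 * q ^ 2) := ⟨_, rfl⟩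
      rw [← hd] at hqk ⊢
      rw [← hd'] at hfk ⊢
      rw [← hd''] at hU ⊢
      field_simp
      rw [hd, hd', hd'']
      ring
  have hR : ∀ k ≤ n, a k - b k =
      τ k * (f * (1 - V * q * Y) * (1 - e * Y) * (1 - g * Y) / (1 - V * q * Y ^ 2) *
          (qPoch Y⁻¹ q k * qPoch (V * q * Y * q) q k) +
        f * (1 - Y) * (V * q * Y - e) * (V * q * Y - g) / (V * q * Y * (1 - V * q * Y ^ 2)) *
          (qPoch (Y⁻¹ * q) q k * qPoch (V * q * Y) q k)) /
      (qPoch (e * q) q k * qPoch f q k * qPoch (g * q) q k * qPoch q q k) * q ^ k := by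
    intro k hk
    -- Here the linear form is f(1 - ez)(1 - gz) - Uq²(1 - Y⁻¹z)(1 - VqYz) with z = q^k. Its
    -- quadratic term cancels by `hbal`.
    set l₀ : ℂ := f - U * q ^ 2 with hl₀
    set l₁ : ℂ := -f * (e + g) + U * q ^ 2 * (Y⁻¹ + V * q * Y) with hl₁
    have c₀ : f * (1 - V * q * Y) * (1 - e * Y) * (1 - g * Y) / (1 - V * q * Y ^ 2) =
        (1 - V * q * Y) * (l₀ + l₁ * Y) / (1 - V * q * Y ^ 2) := by
      have : l₀ + l₁ * Y = f * (1 - e * Y) * (1 - g * Y) := by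
        rw [hl₀, hl₁, ← sub_eq_zero]
        field_simp
        linear_combination (-Y ^ 2) * hbal
      rw [this]
      ring
    have c₁ : f * (1 - Y) * (V * q * Y - e) * (V * q * Y - g) /
        (V * q * Y * (1 - V * q * Y ^ 2)) =
        (1 - Y) * (V * q * Y * l₀ + l₁) / (1 - V * q * Y ^ 2) := by
      have : V * q * Y * l₀ + l₁ = f * (V * q * Y - e) * (V * q * Y - g) / (V * q * Y) := by
        rw [hl₀, hl₁, ← sub_eq_zero]
        field_simp
        linear_combination -hbal
      rw [this, mul_div_assoc', div_div]
      congr 1; ring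
    rw [c₀, c₁, pair_combination hY hV, qPoch_mul_q e0, qPoch_mul_q g0]
    have ek := he k hk
    have gk := hg k hk
    have h1 := hE k (by omega)
    have h2 := hF k hk
    have h3 := hG k (by omega)
    have h4 := hQ k (by omega)
    simp only [ha, hb, hφ, qPoch_succ]
    rw [hl₀, hl₁]
    generalize τ k = T
    generalize qPoch Y⁻¹ q k = Φ
    generalize qPoch (V * q * Y) q k = Ψ
    generalize qPoch e q k = E at *
    generalize qPoch f q k = F at *
    generalize qPoch g q k = G at *
    generalize qPoch q q k = Q at *
    generalize q ^ k = z at *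
    have key : f * ((1 - e * z) * (1 - g * z)) -
        U * q ^ 2 * ((1 - Y⁻¹ * z) * (1 - V * q * Y * z)) =
        f - U * q ^ 2 + (-f * (e + g) + U * q ^ 2 * (Y⁻¹ + V * q * Y)) * z := by
      have : Y⁻¹ * Y = 1 := inv_mul_cancel₀ hY
      linear_combination z ^ 2 * hbal - U * V * q ^ 3 * z ^ 2 * this
    rw [← key]
    obtain ⟨d, hd⟩ : ∃ d, d = 1 - e * z := ⟨_, rfl⟩
    obtain ⟨d'', hd''⟩ : ∃ d, d = 1 - g * z := ⟨_, rfl⟩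
    rw [← hd] at ek ⊢
    rw [← hd''] at gk ⊢
    field_simp
  have hsum : ∑ k ∈ Finset.range (n + 1), (a (k + 1) - b k) + (1 - e) * (1 - g) * f =
      ∑ k ∈ Finset.range (n + 1), (a k - b k) := by
    have h1 := Finset.sum_range_succ a (n + 1)
    rw [Finset.sum_range_succ'] at h1
    have h2 : a (n + 1) = 0 := by simp [ha, hτ, qPoch_inv_pow_eq_zero hq]
    have h3 : a 0 = (1 - e) * (1 - g) * f := by simp [ha, hτ, hφ, qPoch_zero]
    rw [h2, h3] at h1
    rw [Finset.sum_sub_distrib, Finset.sum_sub_distrib]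
    linear_combination h1
  rw [hL, add_comm, hsum, Finset.sum_congr rfl fun k hk =>
    hR k (Nat.lt_succ_iff.mp (Finset.mem_range.mp hk))]
  simp only [phi43, Finset.mul_sum, ← Finset.sum_add_distrib, hτ]
  refine Finset.sum_congr rfl fun k _ => ?_
  ring

/-! ### The q-Racah series: duality and contiguous relations. -/

section

/-- No integral power of `q` equals `c⁻¹`. -/
def Free (q c : ℂ) : Prop := ∀ k : ℤ, c * q ^ k ≠ 1

theorem Free.ne {q c : ℂ} (h : Free q c) (k : ℕ) : 1 - c * q ^ k ≠ 0 := by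
  have := h k
  rw [zpow_natCast] at this
  exact sub_ne_zero.mpr (Ne.symm this)

theorem Free.mul_zpow {q c : ℂ} (hq : q ≠ 0) (h : Free q c) (m : ℤ) : Free q (c * q ^ m) := by
  intro k
  rw [mul_assoc, ← zpow_add₀ hq]
  exact h _

theorem Free.mul_pow {q c : ℂ} (hq : q ≠ 0) (h : Free q c) (m : ℕ) : Free q (c * q ^ m) := by
  simpa using h.mul_zpow hq m

theorem Free.inv {q c : ℂ} (h : Free q c) : Free q c⁻¹ := by
  intro k hk
  apply h (-k)
  rw [zpow_neg, ← inv_inv (c * (q ^ k)⁻¹), mul_inv, inv_inv, hk, inv_one]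

/-- The `₄φ₃` series in the `q`-Racah polynomials. -/
def racahPhi (q b₁ b₂ b₃ : ℂ) (M n x : ℕ) : ℂ :=
  phi43 q n (b₂ * b₃ * q ^ (n + 1)) (q ^ x)⁻¹ (b₁ * b₂ * q ^ (x + 1))
    (q * b₂) (b₁ * b₂ * b₃ * q ^ (M + 2)) (q ^ M)⁻¹ q

theorem racahPhi_zero (q b₁ b₂ b₃ : ℂ) (M x : ℕ) : racahPhi q b₁ b₂ b₃ M 0 x = 1 := by
  simp [racahPhi, phi43, qPoch_zero]

theorem qPoch_inv_pow_eq_zero_of_lt {q : ℂ} (hq : q ≠ 0) {n k : ℕ} (h : n < k) :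
    qPoch (q ^ n)⁻¹ q k = 0 :=
  qPoch_eq_zero h (by rw [inv_mul_cancel₀ (pow_ne_zero n hq), sub_self])

theorem racahPhi_eq_sum {q : ℂ} (hq : q ≠ 0) (b₁ b₂ b₃ : ℂ) (M : ℕ) {n x K : ℕ} (h : n ≤ K) :
    racahPhi q b₁ b₂ b₃ M n x = ∑ k ∈ Finset.range (K + 1),
      (qPoch (q ^ n)⁻¹ q k * qPoch (b₂ * b₃ * q ^ (n + 1)) q k * qPoch (q ^ x)⁻¹ q k *
        qPoch (b₁ * b₂ * q ^ (x + 1)) q k) /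
      (qPoch (q * b₂) q k * qPoch (b₁ * b₂ * b₃ * q ^ (M + 2)) q k * qPoch (q ^ M)⁻¹ q k *
        qPoch q q k) * q ^ k := by
  refine Finset.sum_subset (Finset.range_mono (by omega)) fun k _ hk => ?_
  rw [qPoch_inv_pow_eq_zero_of_lt hq (by simpa using hk)]
  simp

/-- Duality of the `q`-Racah series. -/
theorem racahPhi_dual {q : ℂ} (hq : q ≠ 0) (b₁ b₂ b₃ : ℂ) (M n x : ℕ) :
    racahPhi q b₁ b₂ b₃ M n x = racahPhi q b₃ b₂ b₁ M x n := by
  -- Both series may be summed up to max n x, since the added terms vanish. The summand is then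
  -- visibly unchanged when (n, b₃) and (x, b₁) are exchanged.
  rw [racahPhi_eq_sum hq _ _ _ _ (le_max_left n x), racahPhi_eq_sum hq _ _ _ _ (le_max_right n x)]
  refine Finset.sum_congr rfl fun k _ => ?_
  rw [mul_comm b₃ b₂, mul_comm b₂ b₁, show b₂ * b₃ * b₁ = b₁ * b₂ * b₃ by ring]
  ring

section contiguous

variable {q b₁ b₂ b₃ : ℂ} {M n x : ℕ}

theorem one_sub_inv_pow_mul_ne {N M k : ℕ} (hq : q ≠ 0)
    (hq1 : ∀ k, 1 ≤ k → k ≤ N → 1 - q ^ k ≠ 0) (hM : M ≤ N) (hk : k < M) :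
    1 - (q ^ M)⁻¹ * q ^ k ≠ 0 := by
  obtain ⟨d, rfl⟩ := Nat.exists_eq_add_of_lt hk
  have h := hq1 (d + 1) (by omega) (by omega)
  intro h0
  apply h
  have hk := pow_ne_zero k hq
  have hd := pow_ne_zero (d + 1) hq
  rw [show k + d + 1 = k + (d + 1) by ring, pow_add] at h0
  field_simp at h0
  linear_combination -h0

/-- `phi43_lower_shift` at the lower parameter q^{-(M+1)}. Passing from (b₁, M + 1) to (b₁q, M)
leaves b₁b₂b₃q^{M+3} fixed, so only q^{-(M+1)} moves among the lower parameters. -/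
theorem racahPhi_shift_size (hq : q ≠ 0) (hq1 : ∀ k, 1 ≤ k → k ≤ M + 1 → 1 - q ^ k ≠ 0)
    (h12 : Free q (b₁ * b₂)) (hn : n ≤ M) :
    racahPhi q b₁ b₂ b₃ (M + 1) n x =
      (1 - b₁ * b₂ * q ^ (x + 1)) * (1 - (q ^ (M + 1))⁻¹ * q ^ x) /
          ((1 - (q ^ (M + 1))⁻¹) * (1 - b₁ * b₂ * q ^ (2 * x + 1))) *
        racahPhi q (b₁ * q) b₂ b₃ M n x +
      (1 - q ^ x) * (b₁ * b₂ * q ^ (x + 1) - (q ^ (M + 1))⁻¹) /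
          ((1 - (q ^ (M + 1))⁻¹) * (1 - b₁ * b₂ * q ^ (2 * x + 1))) *
        racahPhi q (b₁ * q) b₂ b₃ M n (x - 1) := by
  have hx := pow_ne_zero x hq
  have e1 : b₁ * b₂ * q ^ (x + 1) = b₁ * b₂ * q * q ^ x := by ring
  have e2 : b₁ * b₂ * q ^ (2 * x + 1) = b₁ * b₂ * q * (q ^ x) ^ 2 := by ring
  have h := phi43_lower_shift (q := q) (n := n) (a := b₂ * b₃ * q ^ (n + 1)) (Y := q ^ x)
    (V := b₁ * b₂) (e := q * b₂) (f := b₁ * b₂ * b₃ * q ^ (M + 3)) (g := (q ^ (M + 1))⁻¹) hx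
    (by rw [← e2]; exact h12.ne _)
    (fun k hk => one_sub_inv_pow_mul_ne hq hq1 le_rfl (by omega))
  simp only [racahPhi]
  rw [e1, e2, h]
  have e3 : b₁ * q * b₂ * b₃ * q ^ (M + 2) = b₁ * b₂ * b₃ * q ^ (M + 3) := by ring
  have e4 : (q ^ (M + 1))⁻¹ * q = (q ^ M)⁻¹ := by rw [pow_succ]; field_simp
  congr 1
  · rw [e3, e4]; congr 2; ring
  -- At x = 0 the truncated x - 1 is harmless, because its coefficient contains 1 - q^x. The same
  -- remark covers the later uses of x - 1 and y - 1.
  · rcases x with _ | x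
    · simp
    · rw [e3, e4, Nat.add_sub_cancel]
      congr 2
      · rw [pow_succ]; field_simp
      · ring

/-- The same splitting at the lower parameter b₁b₂b₃q^{M+2}: b₁ is raised at constant size M.
Together with `racahPhi_shift_size` it serves the two ways a size such as N - y can react when N
drops by one. -/
theorem racahPhi_shift_weight (hq : q ≠ 0) (h12 : Free q (b₁ * b₂))
    (h123 : Free q (b₁ * b₂ * b₃)) :
    racahPhi q b₁ b₂ b₃ M n x =
      (1 - b₁ * b₂ * q ^ (x + 1)) * (1 - b₁ * b₂ * b₃ * q ^ (M + 2) * q ^ x) /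
          ((1 - b₁ * b₂ * b₃ * q ^ (M + 2)) * (1 - b₁ * b₂ * q ^ (2 * x + 1))) *
        racahPhi q (b₁ * q) b₂ b₃ M n x +
      (1 - q ^ x) * (b₁ * b₂ * q ^ (x + 1) - b₁ * b₂ * b₃ * q ^ (M + 2)) /
          ((1 - b₁ * b₂ * b₃ * q ^ (M + 2)) * (1 - b₁ * b₂ * q ^ (2 * x + 1))) *
        racahPhi q (b₁ * q) b₂ b₃ M n (x - 1) := by
  have hx := pow_ne_zero x hq
  have e1 : b₁ * b₂ * q ^ (x + 1) = b₁ * b₂ * q * q ^ x := by ring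
  have e2 : b₁ * b₂ * q ^ (2 * x + 1) = b₁ * b₂ * q * (q ^ x) ^ 2 := by ring
  have h := phi43_lower_shift (q := q) (n := n) (a := b₂ * b₃ * q ^ (n + 1)) (Y := q ^ x)
    (V := b₁ * b₂) (e := q * b₂) (f := (q ^ M)⁻¹) (g := b₁ * b₂ * b₃ * q ^ (M + 2)) hx
    (by rw [← e2]; exact h12.ne _)
    (fun k hk => (h123.mul_pow hq _).ne k)
  simp only [racahPhi]
  rw [e1, e2, phi43_swap_lower, h]
  have e3 : b₁ * q * b₂ * b₃ * q ^ (M + 2) = b₁ * b₂ * b₃ * q ^ (M + 2) * q := by ring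
  congr 1
  · rw [e3, phi43_swap_lower]; congr 2; ring
  · rcases x with _ | x
    · simp
    · rw [e3, phi43_swap_lower, Nat.add_sub_cancel]
      congr 2
      · rw [pow_succ]; field_simp
      · ring

/-- All three lower parameters are raised at once, so degree and size drop together while b₂ and b₃
acquire a factor q. This is the relation that lowers i or j. -/
theorem racahPhi_backward (hq : q ≠ 0) (hq1 : ∀ k, 1 ≤ k → k ≤ M + 1 → 1 - q ^ k ≠ 0)
    (hb : b₁ * b₂ ≠ 0) (h12 : Free q (b₁ * b₂)) (h2 : Free q b₂)
    (h123 : Free q (b₁ * b₂ * b₃)) (hn : n ≤ M) :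
    racahPhi q b₁ b₂ b₃ (M + 1) (n + 1) x =
      (1 - q * b₂ * q ^ x) * (1 - b₁ * b₂ * b₃ * q ^ (M + 3) * q ^ x) *
          (1 - (q ^ (M + 1))⁻¹ * q ^ x) * (1 - b₁ * b₂ * q ^ (x + 1)) /
          (q ^ x * (1 - b₁ * b₂ * q ^ (2 * x + 1)) * ((1 - q * b₂) *
            (1 - b₁ * b₂ * b₃ * q ^ (M + 3)) * (1 - (q ^ (M + 1))⁻¹))) *
        racahPhi q b₁ (b₂ * q) (b₃ * q) M n x +
      (1 - q ^ x) * (b₁ * b₂ * q ^ (x + 1) - q * b₂) *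
          (b₁ * b₂ * q ^ (x + 1) - b₁ * b₂ * b₃ * q ^ (M + 3)) *
          (b₁ * b₂ * q ^ (x + 1) - (q ^ (M + 1))⁻¹) /
          (b₁ * b₂ * q ^ (x + 1) * (1 - b₁ * b₂ * q ^ (2 * x + 1)) * ((1 - q * b₂) *
            (1 - b₁ * b₂ * b₃ * q ^ (M + 3)) * (1 - (q ^ (M + 1))⁻¹))) *
        racahPhi q b₁ (b₂ * q) (b₃ * q) M n (x - 1) := by
  have hx := pow_ne_zero x hq
  have hM := pow_ne_zero M hq
  have e1 : b₁ * b₂ * q ^ (x + 1) = b₁ * b₂ * q * q ^ x := by ring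
  have e2 : b₁ * b₂ * q ^ (2 * x + 1) = b₁ * b₂ * q * (q ^ x) ^ 2 := by ring
  have h := phi43_backward_shift (q := q) (n := n) (U := b₂ * b₃) (Y := q ^ x)
    (V := b₁ * b₂) (e := q * b₂) (f := b₁ * b₂ * b₃ * q ^ (M + 3)) (g := (q ^ (M + 1))⁻¹) hq hx
    (mul_ne_zero (mul_ne_zero hb hq) hx) (by rw [← e2]; exact h12.ne _)
    (by simp only [pow_add]; field_simp)
    (fun k hk => by rw [mul_comm q]; simpa using (h2.mul_pow hq 1).ne k)
    (fun k hk => (h123.mul_pow hq _).ne k)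
    (fun k hk => one_sub_inv_pow_mul_ne hq hq1 le_rfl (by omega))
    (fun k hk => hq1 _ (by omega) (by omega))
  simp only [racahPhi]
  rw [e1, e2, h]
  have e3 : b₁ * (b₂ * q) * (b₃ * q) * q ^ (M + 2) = b₁ * b₂ * b₃ * q ^ (M + 3) * q := by ring
  have e4 : (q ^ (M + 1))⁻¹ * q = (q ^ M)⁻¹ := by rw [pow_succ]; field_simp
  have e5 : b₂ * q * (b₃ * q) * q ^ (n + 1) = b₂ * b₃ * q ^ (n + 3) := by ring
  have e6 : q * b₂ * q = q * (b₂ * q) := by ring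
  congr 1
  · rw [e3, e4, e5, e6]; congr 2; ring
  · rcases x with _ | x
    · simp
    · rw [e3, e4, e5, e6, Nat.add_sub_cancel]
      congr 2
      · rw [pow_succ]; field_simp
      · ring

/-- `phi43_four_term` with b₁b₂b₃q^{M+3} as the lower parameter that stays put, so that the size
drops and b₂ is raised. It turns a combination of two neighbouring degrees into one of two
neighbouring variables. -/
theorem racahPhi_four_term_size (hq : q ≠ 0) (hq1 : ∀ k, 1 ≤ k → k ≤ M + 1 → 1 - q ^ k ≠ 0)
    (hb : b₁ * b₂ ≠ 0) (h12 : Free q (b₁ * b₂)) (h23 : Free q (b₂ * b₃)) (h2 : Free q b₂)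
    (h123 : Free q (b₁ * b₂ * b₃)) (hn : n ≤ M) :
    (1 - q * b₂) * (1 - (q ^ (M + 1))⁻¹) * (b₁ * b₂ * b₃ * q ^ (M + 3) - b₂ * b₃ * q ^ (n + 2)) /
          (1 - b₂ * b₃ * q ^ (2 * n + 2)) * racahPhi q b₁ b₂ b₃ (M + 1) n x +
      (1 - q * b₂) * (1 - (q ^ (M + 1))⁻¹) * (b₂ * b₃ * q ^ (n + 2)) *
          (1 - b₁ * b₂ * b₃ * q ^ (M + 3) * q ^ n) / (1 - b₂ * b₃ * q ^ (2 * n + 2)) *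
        racahPhi q b₁ b₂ b₃ (M + 1) (n + 1) x =
      b₁ * b₂ * b₃ * q ^ (M + 3) * (1 - b₁ * b₂ * q ^ (x + 1)) * (1 - q * b₂ * q ^ x) *
          (1 - (q ^ (M + 1))⁻¹ * q ^ x) / (1 - b₁ * b₂ * q ^ (2 * x + 1)) *
        racahPhi q b₁ (b₂ * q) b₃ M n x +
      b₁ * b₂ * b₃ * q ^ (M + 3) * (1 - q ^ x) * (b₁ * b₂ * q ^ (x + 1) - q * b₂) *
          (b₁ * b₂ * q ^ (x + 1) - (q ^ (M + 1))⁻¹) /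
          (b₁ * b₂ * q ^ (x + 1) * (1 - b₁ * b₂ * q ^ (2 * x + 1))) *
        racahPhi q b₁ (b₂ * q) b₃ M n (x - 1) := by
  have hx := pow_ne_zero x hq
  have hM := pow_ne_zero M hq
  have e1 : b₁ * b₂ * q ^ (x + 1) = b₁ * b₂ * q * q ^ x := by ring
  have e2 : b₁ * b₂ * q ^ (2 * x + 1) = b₁ * b₂ * q * (q ^ x) ^ 2 := by ring
  have h := phi43_four_term (q := q) (n := n) (U := b₂ * b₃) (Y := q ^ x)
    (V := b₁ * b₂) (e := q * b₂) (f := b₁ * b₂ * b₃ * q ^ (M + 3)) (g := (q ^ (M + 1))⁻¹) hq hx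
    (mul_ne_zero (mul_ne_zero hb hq) hx) (by rw [← e2]; exact h12.ne _) (h23.ne _)
    (by simp only [pow_add]; field_simp)
    (fun k hk => by rw [mul_comm q]; simpa using (h2.mul_pow hq 1).ne k)
    (fun k hk => (h123.mul_pow hq _).ne k)
    (Or.inl ((h123.mul_pow hq _).ne n))
    (fun k hk => one_sub_inv_pow_mul_ne hq hq1 le_rfl (by omega))
    (fun k hk => hq1 _ (by omega) (by omega))
  simp only [racahPhi]
  rw [e1, e2, h]
  have e3 : b₁ * (b₂ * q) * b₃ * q ^ (M + 2) = b₁ * b₂ * b₃ * q ^ (M + 3) := by ring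
  have e4 : (q ^ (M + 1))⁻¹ * q = (q ^ M)⁻¹ := by rw [pow_succ]; field_simp
  have e5 : b₂ * q * b₃ * q ^ (n + 1) = b₂ * b₃ * q ^ (n + 2) := by ring
  have e6 : q * b₂ * q = q * (b₂ * q) := by ring
  congr 1
  · rw [e3, e4, e5, e6]; congr 2; ring
  · rcases x with _ | x
    · simp
    · rw [e3, e4, e5, e6, Nat.add_sub_cancel]
      congr 2
      · rw [pow_succ]; field_simp
      · ring

/-- The companion at constant size, where q^{-M} is the lower parameter that stays put. The case n =
M is needed at the edge of the summation range, where the coefficient of degree n + 1 is zero. -/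
theorem racahPhi_four_term_weight (hq : q ≠ 0)
    (hq1 : ∀ k, 1 ≤ k → k ≤ n + 1 → 1 - q ^ k ≠ 0) (hq2 : ∀ k, 1 ≤ k → k ≤ M → 1 - q ^ k ≠ 0)
    (hb : b₁ * b₂ ≠ 0) (h12 : Free q (b₁ * b₂)) (h23 : Free q (b₂ * b₃)) (h2 : Free q b₂)
    (h123 : Free q (b₁ * b₂ * b₃)) (hn : n ≤ M) (hxM : x ≤ M) :
    (1 - q * b₂) * (1 - b₁ * b₂ * b₃ * q ^ (M + 2)) * ((q ^ M)⁻¹ - b₂ * b₃ * q ^ (n + 2)) /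
          (1 - b₂ * b₃ * q ^ (2 * n + 2)) * racahPhi q b₁ b₂ b₃ M n x +
      (1 - q * b₂) * (1 - b₁ * b₂ * b₃ * q ^ (M + 2)) * (b₂ * b₃ * q ^ (n + 2)) *
          (1 - (q ^ M)⁻¹ * q ^ n) / (1 - b₂ * b₃ * q ^ (2 * n + 2)) *
        racahPhi q b₁ b₂ b₃ M (n + 1) x =
      (q ^ M)⁻¹ * (1 - b₁ * b₂ * q ^ (x + 1)) * (1 - q * b₂ * q ^ x) *
          (1 - b₁ * b₂ * b₃ * q ^ (M + 2) * q ^ x) / (1 - b₁ * b₂ * q ^ (2 * x + 1)) *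
        racahPhi q b₁ (b₂ * q) b₃ M n x +
      (q ^ M)⁻¹ * (1 - q ^ x) * (b₁ * b₂ * q ^ (x + 1) - q * b₂) *
          (b₁ * b₂ * q ^ (x + 1) - b₁ * b₂ * b₃ * q ^ (M + 2)) /
          (b₁ * b₂ * q ^ (x + 1) * (1 - b₁ * b₂ * q ^ (2 * x + 1))) *
        racahPhi q b₁ (b₂ * q) b₃ M n (x - 1) := by
  have hx := pow_ne_zero x hq
  have hM := pow_ne_zero M hq
  have e1 : b₁ * b₂ * q ^ (x + 1) = b₁ * b₂ * q * q ^ x := by ring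
  have e2 : b₁ * b₂ * q ^ (2 * x + 1) = b₁ * b₂ * q * (q ^ x) ^ 2 := by ring
  have h := phi43_four_term (q := q) (n := n) (U := b₂ * b₃) (Y := q ^ x)
    (V := b₁ * b₂) (e := q * b₂) (f := (q ^ M)⁻¹) (g := b₁ * b₂ * b₃ * q ^ (M + 2)) hq hx
    (mul_ne_zero (mul_ne_zero hb hq) hx) (by rw [← e2]; exact h12.ne _) (h23.ne _)
    (by simp only [pow_add]; field_simp)
    (fun k hk => by rw [mul_comm q]; simpa using (h2.mul_pow hq 1).ne k)
    (fun k hk => one_sub_inv_pow_mul_ne hq hq2 le_rfl (by omega))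
    -- For n = M the factor 1 - q^{-M}q^n vanishes, but then x ≤ M makes (q^{-x}; q)_{M+1} zero.
    (by
      rcases hn.lt_or_eq with hn | rfl
      · exact Or.inl (one_sub_inv_pow_mul_ne hq hq2 le_rfl hn)
      · exact Or.inr (qPoch_inv_pow_eq_zero_of_lt hq (by omega)))
    (fun k hk => (h123.mul_pow hq _).ne k)
    (fun k hk => hq1 _ (by omega) (by omega))
  simp only [racahPhi]
  simp only [phi43_swap_lower _ _ _ _ _ _ _ (q ^ M)⁻¹]
  rw [e1, e2, h]
  have e3 : b₁ * (b₂ * q) * b₃ * q ^ (M + 2) = b₁ * b₂ * b₃ * q ^ (M + 2) * q := by ring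
  have e5 : b₂ * q * b₃ * q ^ (n + 1) = b₂ * b₃ * q ^ (n + 2) := by ring
  have e6 : q * b₂ * q = q * (b₂ * q) := by ring
  congr 1
  · rw [e3, e5, e6]; congr 2; ring
  · rcases x with _ | x
    · simp
    · rw [e3, e5, e6, Nat.add_sub_cancel]
      congr 2
      · rw [pow_succ]; field_simp
      · ring

end contiguous

end

/-! ### Normalized Griffiths polynomials; generic parameters and their shifts. -/

section

/-- The part of the weight that does not depend on the degrees and variables, with `v = c₁ c₂`. -/
def baseWeight (q c₁ c₂ : ℂ) (N a : ℕ) : ℂ :=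
  qPoch q q (N - a) * qPoch (c₁ * c₂ * q) q (N + a + 1) * qPoch (c₁ * c₂ * q) q a *
    (1 - c₁ * c₂ * q ^ (2 * a + 1)) * qPoch (q * c₂) q a /
    (qPoch q q a * qPoch (q * c₁) q a * (q * c₂) ^ a)

/-- The part of the weight attached to `c₃` or `c₄`. -/
def sideWeight (q v c : ℂ) (a u : ℕ) : ℂ :=
  qPoch q q (a + u) * qPoch (q * c) q u * qPoch (v * c * q ^ (a + u + 2)) q a /
    (qPoch q q u * qPoch (v * q) q (2 * a + u + 1))

/-- The normalizing factor `(-c)^j q^{N j - j (j - 1) / 2}`. -/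
def sideFactor (q c : ℂ) (N j : ℕ) : ℂ := (-c) ^ j * q ^ (N * j) * (q ^ (j.choose 2))⁻¹

/-- The summand of the normalized Griffiths polynomial. -/
def summand (q c₀ c₁ c₂ c₃ c₄ : ℂ) (N i j x y a : ℕ) : ℂ :=
  baseWeight q c₁ c₂ N a * sideWeight q (c₁ * c₂) c₃ a (N - j - a) *
    sideWeight q (c₁ * c₂) c₄ a (N - y - a) * racahPhi q c₁ c₂ c₃ (N - j) i a *
    racahPhi q c₃ c₀ c₄ (N - a) j y * racahPhi q c₄ c₂ c₁ (N - y) a x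

/-- The Griffiths polynomial in the normalization that makes its symmetries manifest. -/
def normGriffiths (q c₀ c₁ c₂ c₃ c₄ : ℂ) (N i j x y : ℕ) : ℂ :=
  sideFactor q c₃ N j * sideFactor q c₄ N y *
    ∑ a ∈ Finset.range (N + 1),
      if a + j ≤ N ∧ a + y ≤ N then summand q c₀ c₁ c₂ c₃ c₄ N i j x y a else 0

/-- Generic parameters. -/
structure Generic (q c₀ c₁ c₂ c₃ c₄ : ℂ) (N : ℕ) : Prop where
  q_ne_zero : q ≠ 0
  q_pow : ∀ k, 1 ≤ k → k ≤ N → 1 - q ^ k ≠ 0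
  ne₀ : c₀ ≠ 0
  ne₁ : c₁ ≠ 0
  ne₂ : c₂ ≠ 0
  ne₃ : c₃ ≠ 0
  ne₄ : c₄ ≠ 0
  constraint : q ^ (2 * N + 3) * c₀ * c₁ * c₂ * c₃ * c₄ = 1
  free₀ : Free q c₀
  free₁ : Free q c₁
  free₂ : Free q c₂
  free₃ : Free q c₃
  free₄ : Free q c₄
  free₁₂ : Free q (c₁ * c₂)
  free₂₃ : Free q (c₂ * c₃)
  free₀₃ : Free q (c₀ * c₃)
  free₀₄ : Free q (c₀ * c₄)
  free₂₄ : Free q (c₂ * c₄)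
  free₀₁ : Free q (c₀ * c₁)
  free₃₄ : Free q (c₃ / c₄)

theorem Free.mul_q {q c : ℂ} (hq : q ≠ 0) (h : Free q c) : Free q (c * q) := by
  simpa using h.mul_pow hq 1

theorem Free.congr {q c d : ℂ} (h : Free q c) (e : c = d) : Free q d := e ▸ h

section

variable {q c₀ c₁ c₂ c₃ c₄ : ℂ} {N : ℕ}

theorem Generic.swap (h : Generic q c₀ c₁ c₂ c₃ c₄ N) : Generic q c₂ c₁ c₀ c₄ c₃ N where
  q_ne_zero := h.q_ne_zero
  q_pow := h.q_pow
  ne₀ := h.ne₂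
  ne₁ := h.ne₁
  ne₂ := h.ne₀
  ne₃ := h.ne₄
  ne₄ := h.ne₃
  constraint := by rw [← h.constraint]; ring
  free₀ := h.free₂
  free₁ := h.free₁
  free₂ := h.free₀
  free₃ := h.free₄
  free₄ := h.free₃
  free₁₂ := h.free₀₁.congr (mul_comm _ _)
  free₂₃ := h.free₀₄
  free₀₃ := h.free₂₄
  free₀₄ := h.free₂₃
  free₂₄ := h.free₀₃
  free₀₁ := h.free₁₂.congr (mul_comm _ _)
  free₃₄ := h.free₃₄.inv.congr (inv_div _ _)

theorem Generic.dual (h : Generic q c₀ c₁ c₂ c₃ c₄ N) : Generic q c₀ c₁ c₂ c₄ c₃ N where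
  q_ne_zero := h.q_ne_zero
  q_pow := h.q_pow
  ne₀ := h.ne₀
  ne₁ := h.ne₁
  ne₂ := h.ne₂
  ne₃ := h.ne₄
  ne₄ := h.ne₃
  constraint := by rw [← h.constraint]; ring
  free₀ := h.free₀
  free₁ := h.free₁
  free₂ := h.free₂
  free₃ := h.free₄
  free₄ := h.free₃
  free₁₂ := h.free₁₂
  free₂₃ := h.free₂₄
  free₀₃ := h.free₀₄
  free₀₄ := h.free₀₃
  free₂₄ := h.free₂₃
  free₀₁ := h.free₀₁
  free₃₄ := h.free₃₄.inv.congr (inv_div _ _)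

/-- When N + 1 is replaced by N the constraint loses q², which two parameters multiplied by q give
back. All other conditions concern integral powers of q and are insensitive to the shift. -/
theorem Generic.shift₀₄ (h : Generic q c₀ c₁ c₂ c₃ c₄ (N + 1)) :
    Generic q (c₀ * q) c₁ c₂ c₃ (c₄ * q) N where
  q_ne_zero := h.q_ne_zero
  q_pow := fun k h1 h2 => h.q_pow k h1 (by omega)
  ne₀ := mul_ne_zero h.ne₀ h.q_ne_zero
  ne₁ := h.ne₁
  ne₂ := h.ne₂
  ne₃ := h.ne₃
  ne₄ := mul_ne_zero h.ne₄ h.q_ne_zero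
  constraint := by rw [← h.constraint]; ring
  free₀ := h.free₀.mul_q h.q_ne_zero
  free₁ := h.free₁
  free₂ := h.free₂
  free₃ := h.free₃
  free₄ := h.free₄.mul_q h.q_ne_zero
  free₁₂ := h.free₁₂
  free₂₃ := h.free₂₃
  free₀₃ := (h.free₀₃.mul_q h.q_ne_zero).congr (by ring)
  free₀₄ := (h.free₀₄.mul_pow h.q_ne_zero 2).congr (by ring)
  free₂₄ := (h.free₂₄.mul_q h.q_ne_zero).congr (by ring)
  free₀₁ := (h.free₀₁.mul_q h.q_ne_zero).congr (by ring)
  free₃₄ := (h.free₃₄.mul_zpow h.q_ne_zero (-1)).congr (by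
    rw [zpow_neg_one, div_mul_eq_div_div, div_eq_mul_inv (c₃ / c₄)])

theorem Generic.shift₁₃ (h : Generic q c₀ c₁ c₂ c₃ c₄ (N + 1)) :
    Generic q c₀ (c₁ * q) c₂ (c₃ * q) c₄ N where
  q_ne_zero := h.q_ne_zero
  q_pow := fun k h1 h2 => h.q_pow k h1 (by omega)
  ne₀ := h.ne₀
  ne₁ := mul_ne_zero h.ne₁ h.q_ne_zero
  ne₂ := h.ne₂
  ne₃ := mul_ne_zero h.ne₃ h.q_ne_zero
  ne₄ := h.ne₄
  constraint := by rw [← h.constraint]; ring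
  free₀ := h.free₀
  free₁ := h.free₁.mul_q h.q_ne_zero
  free₂ := h.free₂
  free₃ := h.free₃.mul_q h.q_ne_zero
  free₄ := h.free₄
  free₁₂ := (h.free₁₂.mul_q h.q_ne_zero).congr (by ring)
  free₂₃ := (h.free₂₃.mul_q h.q_ne_zero).congr (by ring)
  free₀₃ := (h.free₀₃.mul_q h.q_ne_zero).congr (by ring)
  free₀₄ := h.free₀₄
  free₂₄ := h.free₂₄
  free₀₁ := (h.free₀₁.mul_q h.q_ne_zero).congr (by ring)
  free₃₄ := (h.free₃₄.mul_q h.q_ne_zero).congr (by ring)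

theorem Generic.shift₂₃ (h : Generic q c₀ c₁ c₂ c₃ c₄ (N + 1)) :
    Generic q c₀ c₁ (c₂ * q) (c₃ * q) c₄ N :=
  h.swap.shift₀₄.swap

theorem Generic.shift₁₄ (h : Generic q c₀ c₁ c₂ c₃ c₄ (N + 1)) :
    Generic q c₀ (c₁ * q) c₂ c₃ (c₄ * q) N :=
  h.dual.shift₁₃.dual

/-- By the constraint every triple product occurring in a series is the inverse of a pair product up
to a power of q. Hence genericity needs conditions on pairs only, and factors in c₀ can cancel
against weights in c₁c₂. -/
theorem Generic.mul₁₂₃ (h : Generic q c₀ c₁ c₂ c₃ c₄ N) :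
    c₁ * c₂ * c₃ = (c₀ * c₄ * q ^ (2 * N + 3))⁻¹ :=
  eq_inv_of_mul_eq_one_left (by rw [← h.constraint]; ring)

theorem Generic.free₁₂₃ (h : Generic q c₀ c₁ c₂ c₃ c₄ N) : Free q (c₁ * c₂ * c₃) :=
  (h.free₀₄.mul_pow h.q_ne_zero (2 * N + 3)).inv.congr h.mul₁₂₃.symm

theorem Generic.free₁₂₄ (h : Generic q c₀ c₁ c₂ c₃ c₄ N) : Free q (c₁ * c₂ * c₄) :=
  h.dual.free₁₂₃

theorem Generic.mul₀₃₄ (h : Generic q c₀ c₁ c₂ c₃ c₄ N) :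
    c₃ * c₀ * c₄ = (c₁ * c₂ * q ^ (2 * N + 3))⁻¹ :=
  eq_inv_of_mul_eq_one_left (by rw [← h.constraint]; ring)

theorem Generic.free₀₃₄ (h : Generic q c₀ c₁ c₂ c₃ c₄ N) : Free q (c₃ * c₀ * c₄) :=
  (h.free₁₂.mul_pow h.q_ne_zero (2 * N + 3)).inv.congr h.mul₀₃₄.symm

/-- Duality between degrees and variables. -/
theorem normGriffiths_dual (hq : q ≠ 0) (i j x y : ℕ) :
    normGriffiths q c₀ c₁ c₂ c₃ c₄ N i j x y = normGriffiths q c₀ c₁ c₂ c₄ c₃ N x y i j := by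
  simp only [normGriffiths]
  congr 1
  · ring
  · refine Finset.sum_congr rfl fun a _ => ?_
    refine if_congr and_comm ?_ rfl
    simp only [summand]
    rw [racahPhi_dual hq c₁ c₂ c₃, racahPhi_dual hq c₃ c₀ c₄, racahPhi_dual hq c₄ c₂ c₁]
    ring

theorem sideFactor_succ_succ (hq : q ≠ 0) (c : ℂ) (N j : ℕ) :
    sideFactor q c (N + 1) (j + 1) = -c * q ^ (N + 1) * sideFactor q c N j := by
  have h1 := pow_ne_zero (j.choose 2) hq
  have h2 := pow_ne_zero j hq
  simp only [sideFactor, Nat.choose_succ_succ' j 1, Nat.choose_one_right, pow_add, mul_inv]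
  field_simp
  ring

theorem sideFactor_shift (c : ℂ) (N y : ℕ) :
    sideFactor q c (N + 1) y = sideFactor q (c * q) N y := by
  simp only [sideFactor]
  rw [← neg_mul, mul_pow, add_mul, pow_add, one_mul]
  ring

theorem sideFactor_shift_succ (hq : q ≠ 0) (c : ℂ) (N y : ℕ) :
    sideFactor q c (N + 1) (y + 1) = -c * q ^ (N + 1) * (q ^ y)⁻¹ * sideFactor q (c * q) N y := by
  have h2 := pow_ne_zero y hq
  rw [sideFactor_succ_succ hq]
  simp only [sideFactor]
  rw [← neg_mul, mul_pow]
  field_simp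

end

end

/-! ### Behaviour of the weights under shifts, and the recurrence that lowers j. -/

section

variable {q v c : ℂ}

theorem baseWeight_succ (q c₁ c₂ : ℂ) (a d : ℕ) :
    baseWeight q c₁ c₂ (a + d + 1) a =
      (1 - q ^ (d + 1)) * (1 - c₁ * c₂ * q ^ (2 * a + d + 2)) * baseWeight q c₁ c₂ (a + d) a := by
  simp only [baseWeight]
  rw [show a + d + 1 - a = d + 1 by omega, show a + d - a = d by omega,
    show a + d + 1 + a + 1 = (a + d + a + 1) + 1 by ring, qPoch_succ q q, qPoch_succ _ _ (_ + 1)]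
  ring

/-- For the weight attached to c₄ the last argument is N - y - a. It drops when N drops and y is
kept; it stays, as in `sideWeight_shift`, when N and y drop together. -/
theorem sideWeight_shift_succ (a w : ℕ) :
    sideWeight q v c a (w + 1) = (1 - q ^ (a + w + 1)) * (1 - q * c) /
      ((1 - q ^ (w + 1)) * (1 - v * q ^ (2 * a + w + 2))) * sideWeight q v (c * q) a w := by
  simp only [sideWeight]
  rw [← add_assoc a w 1, ← add_assoc (2 * a) w 1, qPoch_succ q q (a + w), qPoch_succ q q w,
    qPoch_succ (v * q) q (2 * a + w + 1), qPoch_succ' (q * c),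
    show v * c * q ^ (a + w + 1 + 2) = v * (c * q) * q ^ (a + w + 2) by ring,
    show q * c * q = q * (c * q) by ring, show q * q ^ (a + w) = q ^ (a + w + 1) by ring,
    show q * q ^ w = q ^ (w + 1) by ring,
    show v * q * q ^ (2 * a + w + 1) = v * q ^ (2 * a + w + 2) by ring]
  simp only [div_eq_mul_inv, mul_inv]
  ring

theorem sideWeight_shift (hc : Free q c) (hvc : Free q (v * c)) (a w : ℕ) :
    sideWeight q v c a w = (1 - q * c) * (1 - v * c * q ^ (a + w + 2)) /
      ((1 - c * q ^ (w + 1)) * (1 - v * c * q ^ (2 * a + w + 2))) *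
        sideWeight q v (c * q) a w := by
  have h1 := qPoch_shift (q * c) q w
  have h2 := qPoch_shift (v * c * q ^ (a + w + 2)) q a
  have n1 := hc.ne (w + 1)
  have n2 := hvc.ne (2 * a + w + 2)
  simp only [sideWeight]
  rw [show q * (c * q) = q * c * q by ring,
    show v * (c * q) * q ^ (a + w + 2) = v * c * q ^ (a + w + 2) * q by ring]
  rw [show q * c * q ^ w = c * q ^ (w + 1) by ring] at h1
  rw [show v * c * q ^ (a + w + 2) * q ^ a = v * c * q ^ (2 * a + w + 2) by ring] at h2
  generalize 1 - c * q ^ (w + 1) = d₁ at *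
  generalize 1 - v * c * q ^ (2 * a + w + 2) = d₂ at *
  generalize qPoch (v * c * q ^ (a + w + 2)) q a = P at *
  generalize qPoch (v * c * q ^ (a + w + 2) * q) q a = P' at *
  generalize qPoch (q * c) q w = Q at *
  generalize qPoch (q * c * q) q w = Q' at *
  rw [← div_eq_iff n1] at h1
  rw [← div_eq_iff n2] at h2
  rw [← h1, ← h2]
  simp only [div_eq_mul_inv, mul_inv]
  ring

end

/-- The common factor of the coefficients in the recurrence that lowers `j`. -/
def stepPre (q c₀ c₂ c₃ c₄ : ℂ) (x y : ℕ) : ℂ :=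
  (1 - q * c₄) / ((1 - q * c₀) * (1 - c₃ * c₀ * q ^ (2 * y + 1)) * (1 - c₄ * c₂ * q ^ (2 * x + 1)))

/-- The first index tells whether y is lowered, the second whether x is. None of the four
coefficients involves the degrees or the summation index a, so identities between summands add up to
a recurrence. The factor q^{N+1} - q^{x+y} here kills the term that leaves the triangle x + y ≤ N.
-/
def stepCoeff₀₀ (q c₀ c₂ c₃ c₄ : ℂ) (N x y : ℕ) : ℂ :=
  c₃ * q ^ (N + 1) * (1 - q * c₀ * q ^ y) * (1 - c₃ * c₀ * q ^ (y + 1)) *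
    (1 - c₄ * c₂ * q ^ (x + 1)) * (q ^ (N + 1) - q ^ (x + y)) * stepPre q c₀ c₂ c₃ c₄ x y

def stepCoeff₀₁ (q c₀ c₂ c₃ c₄ : ℂ) (N x y : ℕ) : ℂ :=
  c₃ * q ^ (N + 1) * (1 - q * c₀ * q ^ y) * (1 - c₃ * c₀ * q ^ (y + 1)) *
    (1 - q ^ x) * (c₄ * c₂ * q ^ (x + 1) * q ^ (N + 1) - q ^ y) * stepPre q c₀ c₂ c₃ c₄ x y

def stepCoeff₁₀ (q c₀ c₂ c₃ c₄ : ℂ) (N x y : ℕ) : ℂ :=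
  -q ^ (N + 1) * (1 - q ^ y) * (1 - c₃ * q ^ y) * (1 - c₄ * c₂ * q ^ (x + 1)) *
    (c₃ * c₀ * q ^ (N + 2) - q ^ x * (q ^ y)⁻¹) * stepPre q c₀ c₂ c₃ c₄ x y

def stepCoeff₁₁ (q c₀ c₂ c₃ c₄ : ℂ) (N x y : ℕ) : ℂ :=
  -q ^ (N + 1) * (1 - q ^ y) * (1 - c₃ * q ^ y) * (1 - q ^ x) *
    (c₃ * c₀ * (c₄ * c₂) * q ^ (N + 3) * q ^ x - (q ^ y)⁻¹) * stepPre q c₀ c₂ c₃ c₄ x y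

variable {q c₀ c₁ c₂ c₃ c₄ : ℂ} {N : ℕ}

theorem one_sub_inv {u : ℂ} (hu : u ≠ 0) : 1 - u⁻¹ = -u⁻¹ * (1 - u) := by
  field_simp; ring

theorem one_sub_inv_mul {u t : ℂ} (hu : u ≠ 0) : 1 - u⁻¹ * t = -u⁻¹ * (t - u) := by
  field_simp; ring

/-- The summand identity behind the recurrence that lowers `j`, terms keeping `y`. -/
theorem step_term_same (h : Generic q c₀ c₁ c₂ c₃ c₄ (N + 1)) {a y w x : ℕ} (L : ℂ)
    (hN : N = a + y + w) :
    -c₃ * q ^ (N + 1) * ((1 - q ^ (y + w + 1)) * (1 - c₁ * c₂ * q ^ (2 * a + (y + w) + 2))) *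
      ((1 - q ^ (a + w + 1)) * (1 - q * c₄) /
        ((1 - q ^ (w + 1)) * (1 - c₁ * c₂ * q ^ (2 * a + w + 2)))) *
      ((1 - q * c₀ * q ^ y) * (1 - c₃ * c₀ * c₄ * q ^ (y + w + 3) * q ^ y) *
          (1 - (q ^ (y + w + 1))⁻¹ * q ^ y) * (1 - c₃ * c₀ * q ^ (y + 1)) /
          (q ^ y * (1 - c₃ * c₀ * q ^ (2 * y + 1)) * ((1 - q * c₀) *
            (1 - c₃ * c₀ * c₄ * q ^ (y + w + 3)) * (1 - (q ^ (y + w + 1))⁻¹)))) *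
      ((q ^ (a + w + 1))⁻¹ * L / ((1 - (q ^ (a + w + 1))⁻¹) * (1 - c₄ * c₂ * q ^ (2 * x + 1)))) =
      c₃ * q ^ (N + 1) * (1 - q * c₀ * q ^ y) * (1 - c₃ * c₀ * q ^ (y + 1)) * (q ^ y * L) *
        stepPre q c₀ c₂ c₃ c₄ x y := by
  have hq := h.q_ne_zero
  have hp : ∀ k, q ^ k ≠ 0 := fun k => pow_ne_zero k hq
  have c12 : c₁ * c₂ ≠ 0 := mul_ne_zero h.ne₁ h.ne₂
  -- The constraint identifies the triple product of the middle series with an inverse of c₁c₂ times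
  -- a power of q, so the factors it produces cancel against those coming from the weights.
  have hF : c₃ * c₀ * c₄ * q ^ (y + w + 3) = (c₁ * c₂ * q ^ (2 * a + (y + w) + 2))⁻¹ := by
    rw [h.mul₀₃₄, show q ^ (2 * (N + 1) + 3) = q ^ (2 * a + (y + w) + 2) * q ^ (y + w + 3) by
      rw [← pow_add]; congr 1; omega]
    have := hp (2 * a + (y + w) + 2)
    have := hp (y + w + 3)
    field_simp
  have hF0 : c₁ * c₂ * q ^ (2 * a + (y + w) + 2) ≠ 0 := mul_ne_zero c12 (hp _)
  have e1 : q ^ y - c₁ * c₂ * q ^ (2 * a + (y + w) + 2) =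
      q ^ y * (1 - c₁ * c₂ * q ^ (2 * a + w + 2)) := by ring
  have e2 : q ^ y - q ^ (y + w + 1) = q ^ y * (1 - q ^ (w + 1)) := by ring
  have n1 : 1 - q ^ (w + 1) ≠ 0 := h.q_pow _ (by omega) (by omega)
  have n2 : 1 - q ^ (y + w + 1) ≠ 0 := h.q_pow _ (by omega) (by omega)
  have n3 : 1 - q ^ (a + w + 1) ≠ 0 := h.q_pow _ (by omega) (by omega)
  have n4 := h.free₁₂.ne (2 * a + w + 2)
  have n5 := h.free₁₂.ne (2 * a + (y + w) + 2)
  rw [stepPre, hF, one_sub_inv hF0, one_sub_inv (hp (y + w + 1)),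
    one_sub_inv (hp (a + w + 1)), one_sub_inv_mul hF0, one_sub_inv_mul (hp _),
    e1, e2]
  have := hp y
  have := hp (y + w + 1)
  have := hp (a + w + 1)
  generalize 1 - q ^ (w + 1) = d₁ at *
  generalize 1 - q ^ (y + w + 1) = d₂ at *
  generalize 1 - q ^ (a + w + 1) = d₃ at *
  generalize 1 - c₁ * c₂ * q ^ (2 * a + w + 2) = d₄ at *
  generalize 1 - c₁ * c₂ * q ^ (2 * a + (y + w) + 2) = d₅ at *
  generalize c₁ * c₂ * q ^ (2 * a + (y + w) + 2) = F at *
  generalize 1 - c₃ * c₀ * q ^ (2 * y + 1) = d₆ at *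
  generalize 1 - c₄ * c₂ * q ^ (2 * x + 1) = d₇ at *
  generalize 1 - q * c₀ = d₈ at *
  generalize q ^ (y + w + 1) = t₁ at *
  generalize q ^ (a + w + 1) = t₂ at *
  field_simp

set_option maxHeartbeats 1000000 in
/-- The summand identity behind the recurrence that lowers `j`, terms lowering `y`. -/
theorem step_term_down (h : Generic q c₀ c₁ c₂ c₃ c₄ (N + 1)) {a y w x : ℕ} (L : ℂ)
    (hN : N = a + y + w) :
    -c₃ * q ^ (N + 1) * (-c₄ * q ^ (N + 1) * (q ^ y)⁻¹) *
      ((1 - q ^ (y + w + 1)) * (1 - c₁ * c₂ * q ^ (2 * a + (y + w) + 2))) *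
      ((1 - q * c₄) * (1 - c₁ * c₂ * c₄ * q ^ (a + w + 2)) /
        ((1 - c₄ * q ^ (w + 1)) * (1 - c₁ * c₂ * c₄ * q ^ (2 * a + w + 2)))) *
      ((1 - q ^ (y + 1)) * (c₃ * c₀ * q ^ (y + 1 + 1) - q * c₀) *
          (c₃ * c₀ * q ^ (y + 1 + 1) - c₃ * c₀ * c₄ * q ^ (y + w + 3)) *
          (c₃ * c₀ * q ^ (y + 1 + 1) - (q ^ (y + w + 1))⁻¹) /
          (c₃ * c₀ * q ^ (y + 1 + 1) * (1 - c₃ * c₀ * q ^ (2 * (y + 1) + 1)) * ((1 - q * c₀) *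
            (1 - c₃ * c₀ * c₄ * q ^ (y + w + 3)) * (1 - (q ^ (y + w + 1))⁻¹)))) *
      (L / ((1 - c₁ * c₂ * c₄ * q ^ (a + w + 2)) * (1 - c₄ * c₂ * q ^ (2 * x + 1)))) =
      -q ^ (N + 1) * (1 - q ^ (y + 1)) * (1 - c₃ * q ^ (y + 1)) * (c₃ * c₀ * q ^ (N + 2) * L) *
        stepPre q c₀ c₂ c₃ c₄ x (y + 1) := by
  have hq := h.q_ne_zero
  have hp : ∀ k, q ^ k ≠ 0 := fun k => pow_ne_zero k hq
  have c12 : c₁ * c₂ ≠ 0 := mul_ne_zero h.ne₁ h.ne₂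
  have hF : c₃ * c₀ * c₄ * q ^ (y + w + 3) = (c₁ * c₂ * q ^ (2 * a + (y + w) + 2))⁻¹ := by
    rw [h.mul₀₃₄, show q ^ (2 * (N + 1) + 3) = q ^ (2 * a + (y + w) + 2) * q ^ (y + w + 3) by
      rw [← pow_add]; congr 1; omega]
    have := hp (2 * a + (y + w) + 2)
    have := hp (y + w + 3)
    field_simp
  have hF0 : c₁ * c₂ * q ^ (2 * a + (y + w) + 2) ≠ 0 := mul_ne_zero c12 (hp _)
  have e1 : c₃ * c₀ * q ^ (y + 1 + 1) - q * c₀ = -(q * c₀) * (1 - c₃ * q ^ (y + 1)) := by ring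
  have e2 : c₃ * c₀ * q ^ (y + 1 + 1) - c₃ * c₀ * c₄ * q ^ (y + w + 3) =
      c₃ * c₀ * q ^ (y + 1 + 1) * (1 - c₄ * q ^ (w + 1)) := by ring
  have e3 : c₃ * c₀ * q ^ (y + 1 + 1) - (q ^ (y + w + 1))⁻¹ =
      c₃ * c₀ * q ^ (y + 1 + 1) * (1 - c₁ * c₂ * c₄ * q ^ (2 * a + w + 2)) := by
    have : (q ^ (y + w + 1))⁻¹ =
        c₃ * c₀ * q ^ (y + 1 + 1) * (c₁ * c₂ * c₄ * q ^ (2 * a + w + 2)) := by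
      rw [inv_eq_iff_eq_inv]
      refine eq_inv_of_mul_eq_one_left ?_
      rw [← h.constraint, hN]
      ring
    rw [this]; ring
  -- This collects the monomial factors of both sides; they agree by one use of the constraint at
  -- size N + 1.
  have hfac : -q ^ (N + 1) * (c₃ * c₀ * q ^ (N + 2)) = -c₃ * q ^ (N + 1) *
      (-c₄ * q ^ (N + 1) * (q ^ y)⁻¹) * (-(q * c₀) * (c₃ * c₀ * q ^ (y + 1 + 1))) *
      (c₁ * c₂ * q ^ (2 * a + (y + w) + 2)) * q ^ (y + w + 1) := by
    have hy := hp y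
    have e : q ^ y * (q ^ y)⁻¹ = 1 := mul_inv_cancel₀ hy
    have hc := h.constraint
    rw [hN] at hc ⊢
    linear_combination (c₃ * c₀ * q ^ (2 * (a + y + w) + 3)) * hc +
      c₃ ^ 2 * c₀ ^ 2 * c₁ * c₂ * c₄ * q ^ (4 * (a + y + w) + 8) * e
  have n1 := h.free₄.ne (w + 1)
  have n2 : 1 - q ^ (y + w + 1) ≠ 0 := h.q_pow _ (by omega) (by omega)
  have n3 := h.free₁₂₄.ne (a + w + 2)
  have n4 := h.free₁₂₄.ne (2 * a + w + 2)
  have n5 := h.free₁₂.ne (2 * a + (y + w) + 2)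
  rw [stepPre, hF, one_sub_inv hF0, one_sub_inv (hp (y + w + 1)), e1, ← hF, e2, hF, e3]
  have := hp y
  have := hp (y + w + 1)
  have := mul_ne_zero (mul_ne_zero h.ne₃ h.ne₀) (hp (y + 1 + 1))
  generalize 1 - q ^ (y + w + 1) = d₂ at *
  generalize 1 - c₄ * q ^ (w + 1) = d₁ at *
  generalize 1 - c₁ * c₂ * c₄ * q ^ (a + w + 2) = d₃ at *
  generalize 1 - c₁ * c₂ * c₄ * q ^ (2 * a + w + 2) = d₄ at *
  generalize 1 - c₁ * c₂ * q ^ (2 * a + (y + w) + 2) = d₅ at *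
  generalize c₁ * c₂ * q ^ (2 * a + (y + w) + 2) = F at *
  generalize 1 - c₃ * c₀ * q ^ (2 * (y + 1) + 1) = d₆ at *
  generalize 1 - c₄ * c₂ * q ^ (2 * x + 1) = d₇ at *
  generalize 1 - q * c₀ = d₈ at *
  generalize q ^ (y + w + 1) = t₁ at *
  generalize c₃ * c₀ * q ^ (y + 1 + 1) = t₃ at *
  have : -q ^ (N + 1) * (1 - q ^ (y + 1)) * (1 - c₃ * q ^ (y + 1)) *
      (c₃ * c₀ * q ^ (N + 2) * L) = (-q ^ (N + 1) * (c₃ * c₀ * q ^ (N + 2))) *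
      (1 - q ^ (y + 1)) * (1 - c₃ * q ^ (y + 1)) * L := by ring
  rw [this, hfac]
  field_simp

section

variable {q c₀ c₁ c₂ c₃ c₄ : ℂ} {N : ℕ}

theorem normGriffiths_eq_sum (q c₀ c₁ c₂ c₃ c₄ : ℂ) (N i j x y : ℕ) {K : ℕ} (hK : N + 1 ≤ K) :
    normGriffiths q c₀ c₁ c₂ c₃ c₄ N i j x y = ∑ a ∈ Finset.range K,
      if a + j ≤ N ∧ a + y ≤ N then
        sideFactor q c₃ N j * sideFactor q c₄ N y * summand q c₀ c₁ c₂ c₃ c₄ N i j x y a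
      else 0 := by
  rw [normGriffiths, Finset.mul_sum]
  simp only [mul_ite, mul_zero]
  refine Finset.sum_subset (Finset.range_mono hK) fun a _ ha => if_neg ?_
  simp only [Finset.mem_range] at ha
  omega

theorem product_rearrange {R : Type*} [CommRing R] (k h₃ h₄ A W W₃ B W₄ P D P' E₀ E₁ F₀ F₁ : R) :
    k * h₃ * h₄ * (A * W * W₃ * (B * W₄) * P * (D * P') * (E₀ * F₀ + E₁ * F₁)) =
      k * A * B * D * E₀ * (h₃ * h₄ * (W * W₃ * W₄ * P * P' * F₀)) +
        k * A * B * D * E₁ * (h₃ * h₄ * (W * W₃ * W₄ * P * P' * F₁)) := by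
  ring

theorem product_rearrange' {R : Type*} [CommRing R]
    (k h₃ k' h₄ A W W₃ B W₄ P D P' E₀ E₁ F₀ F₁ : R) :
    k * h₃ * (k' * h₄) * (A * W * W₃ * (B * W₄) * P * (D * P') * (E₀ * F₀ + E₁ * F₁)) =
      k * k' * A * B * D * E₀ * (h₃ * h₄ * (W * W₃ * W₄ * P * P' * F₀)) +
        k * k' * A * B * D * E₁ * (h₃ * h₄ * (W * W₃ * W₄ * P * P' * F₁)) := by
  ring

/-- With y kept, the last series has to go from size N + 1 - y to N - y while c₄ becomes c₄q, which
is `racahPhi_shift_size`. The first series has size N - j on both sides and does not change. -/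
theorem summand_lower_j_same (h : Generic q c₀ c₁ c₂ c₃ c₄ (N + 1)) {i j x y a w : ℕ}
    (hj : a + j ≤ N) (hN : N = a + y + w) :
    sideFactor q c₃ (N + 1) (j + 1) * sideFactor q c₄ (N + 1) y *
      (baseWeight q c₁ c₂ (N + 1) a * sideWeight q (c₁ * c₂) c₃ a (N + 1 - (j + 1) - a) *
        sideWeight q (c₁ * c₂) c₄ a (N + 1 - y - a) *
        racahPhi q c₁ c₂ c₃ (N + 1 - (j + 1)) i a *
        ((1 - q * c₀ * q ^ y) * (1 - c₃ * c₀ * c₄ * q ^ (y + w + 3) * q ^ y) *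
          (1 - (q ^ (y + w + 1))⁻¹ * q ^ y) * (1 - c₃ * c₀ * q ^ (y + 1)) /
          (q ^ y * (1 - c₃ * c₀ * q ^ (2 * y + 1)) * ((1 - q * c₀) *
            (1 - c₃ * c₀ * c₄ * q ^ (y + w + 3)) * (1 - (q ^ (y + w + 1))⁻¹))) *
          racahPhi q c₃ (c₀ * q) (c₄ * q) (N - a) j y) *
        racahPhi q c₄ c₂ c₁ (N + 1 - y) a x) =
      stepCoeff₀₀ q c₀ c₂ c₃ c₄ N x y * (sideFactor q c₃ N j * sideFactor q (c₄ * q) N y *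
        summand q (c₀ * q) c₁ c₂ c₃ (c₄ * q) N i j x y a) +
      stepCoeff₀₁ q c₀ c₂ c₃ c₄ N x y * (sideFactor q c₃ N j * sideFactor q (c₄ * q) N y *
        summand q (c₀ * q) c₁ c₂ c₃ (c₄ * q) N i j (x - 1) y a) := by
  have hq := h.q_ne_zero
  have hp : ∀ k, q ^ k ≠ 0 := fun k => pow_ne_zero k hq
  have s1 : N + 1 - (j + 1) = N - j := by omega
  have s2 : N + 1 - y - a = w + 1 := by omega
  have s3 : N + 1 - y = a + w + 1 := by omega
  have s4 : N - y - a = w := by omega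
  have s5 : N - y = a + w := by omega
  have hΦ := racahPhi_shift_size (b₁ := c₄) (b₂ := c₂) (b₃ := c₁) (M := a + w) (n := a) (x := x)
    hq (fun k h1 h2 => h.q_pow k h1 (by omega)) (h.free₂₄.congr (mul_comm _ _)) (by omega)
  have t₀ := step_term_same h (x := x)
    ((1 - c₄ * c₂ * q ^ (x + 1)) * (q ^ (a + w + 1) - q ^ x)) hN
  have t₁ := step_term_same h (x := x)
    ((1 - q ^ x) * (c₄ * c₂ * q ^ (x + 1) * q ^ (a + w + 1) - 1)) hN
  have l₀ : (1 - c₄ * c₂ * q ^ (x + 1)) * (1 - (q ^ (a + w + 1))⁻¹ * q ^ x) =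
      (q ^ (a + w + 1))⁻¹ * ((1 - c₄ * c₂ * q ^ (x + 1)) * (q ^ (a + w + 1) - q ^ x)) := by
    have := hp (a + w + 1); field_simp
  have l₁ : (1 - q ^ x) * (c₄ * c₂ * q ^ (x + 1) - (q ^ (a + w + 1))⁻¹) =
      (q ^ (a + w + 1))⁻¹ * ((1 - q ^ x) * (c₄ * c₂ * q ^ (x + 1) * q ^ (a + w + 1) - 1)) := by
    have := hp (a + w + 1); field_simp
  have k₀ : stepCoeff₀₀ q c₀ c₂ c₃ c₄ N x y = c₃ * q ^ (N + 1) * (1 - q * c₀ * q ^ y) *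
      (1 - c₃ * c₀ * q ^ (y + 1)) *
      (q ^ y * ((1 - c₄ * c₂ * q ^ (x + 1)) * (q ^ (a + w + 1) - q ^ x))) *
        stepPre q c₀ c₂ c₃ c₄ x y := by
    rw [stepCoeff₀₀, hN]; ring
  have k₁ : stepCoeff₀₁ q c₀ c₂ c₃ c₄ N x y = c₃ * q ^ (N + 1) * (1 - q * c₀ * q ^ y) *
      (1 - c₃ * c₀ * q ^ (y + 1)) *
      (q ^ y * ((1 - q ^ x) * (c₄ * c₂ * q ^ (x + 1) * q ^ (a + w + 1) - 1))) *
        stepPre q c₀ c₂ c₃ c₄ x y := by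
    rw [stepCoeff₀₁, hN]; ring
  have b := baseWeight_succ q c₁ c₂ a (y + w)
  rw [show a + (y + w) = N by omega] at b
  rw [k₀, k₁, ← t₀, ← t₁]
  simp only [summand]
  rw [s1, s2, s3, s4, s5, hΦ, sideFactor_succ_succ hq, sideFactor_shift, b,
    sideWeight_shift_succ, l₀, l₁]
  exact product_rearrange _ _ _ _ _ _ _ _ _ _ _ _ _ _ _

/-- Here y drops along with N, so the last series keeps its size and only c₄ is raised: this is
`racahPhi_shift_weight`. -/
theorem summand_lower_j_down (h : Generic q c₀ c₁ c₂ c₃ c₄ (N + 1)) {i j x y a w : ℕ}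
    (hj : a + j ≤ N) (hN : N = a + y + w) :
    sideFactor q c₃ (N + 1) (j + 1) * sideFactor q c₄ (N + 1) (y + 1) *
      (baseWeight q c₁ c₂ (N + 1) a * sideWeight q (c₁ * c₂) c₃ a (N + 1 - (j + 1) - a) *
        sideWeight q (c₁ * c₂) c₄ a (N + 1 - (y + 1) - a) *
        racahPhi q c₁ c₂ c₃ (N + 1 - (j + 1)) i a *
        ((1 - q ^ (y + 1)) * (c₃ * c₀ * q ^ (y + 1 + 1) - q * c₀) *
          (c₃ * c₀ * q ^ (y + 1 + 1) - c₃ * c₀ * c₄ * q ^ (y + w + 3)) *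
          (c₃ * c₀ * q ^ (y + 1 + 1) - (q ^ (y + w + 1))⁻¹) /
          (c₃ * c₀ * q ^ (y + 1 + 1) * (1 - c₃ * c₀ * q ^ (2 * (y + 1) + 1)) * ((1 - q * c₀) *
            (1 - c₃ * c₀ * c₄ * q ^ (y + w + 3)) * (1 - (q ^ (y + w + 1))⁻¹))) *
          racahPhi q c₃ (c₀ * q) (c₄ * q) (N - a) j y) *
        racahPhi q c₄ c₂ c₁ (N + 1 - (y + 1)) a x) =
      stepCoeff₁₀ q c₀ c₂ c₃ c₄ N x (y + 1) * (sideFactor q c₃ N j * sideFactor q (c₄ * q) N y *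
        summand q (c₀ * q) c₁ c₂ c₃ (c₄ * q) N i j x y a) +
      stepCoeff₁₁ q c₀ c₂ c₃ c₄ N x (y + 1) * (sideFactor q c₃ N j * sideFactor q (c₄ * q) N y *
        summand q (c₀ * q) c₁ c₂ c₃ (c₄ * q) N i j (x - 1) y a) := by
  have hq := h.q_ne_zero
  have hp : ∀ k, q ^ k ≠ 0 := fun k => pow_ne_zero k hq
  have s1 : N + 1 - (j + 1) = N - j := by omega
  have s2 : N + 1 - (y + 1) = N - y := by omega
  have s4 : N - y - a = w := by omega
  have s5 : N - y = a + w := by omega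
  have c421 : c₄ * c₂ * c₁ = c₁ * c₂ * c₄ := by ring
  have hΦ := racahPhi_shift_weight (b₁ := c₄) (b₂ := c₂) (b₃ := c₁) (M := a + w) (n := a) (x := x)
    hq (h.free₂₄.congr (mul_comm _ _)) (h.free₁₂₄.congr (by ring))
  rw [c421] at hΦ
  have t₀ := step_term_down h (x := x)
    ((1 - c₄ * c₂ * q ^ (x + 1)) * (1 - c₁ * c₂ * c₄ * q ^ (a + w + 2) * q ^ x)) hN
  have t₁ := step_term_down h (x := x)
    ((1 - q ^ x) * (c₄ * c₂ * q ^ (x + 1) - c₁ * c₂ * c₄ * q ^ (a + w + 2))) hN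
  have hE : c₃ * c₀ * q ^ (N + 2) * (c₁ * c₂ * c₄ * q ^ (a + w + 2)) = (q ^ (y + 1))⁻¹ := by
    refine eq_inv_of_mul_eq_one_left ?_
    rw [← h.constraint, hN]
    ring
  have k₀ : stepCoeff₁₀ q c₀ c₂ c₃ c₄ N x (y + 1) = -q ^ (N + 1) * (1 - q ^ (y + 1)) *
      (1 - c₃ * q ^ (y + 1)) * (c₃ * c₀ * q ^ (N + 2) *
        ((1 - c₄ * c₂ * q ^ (x + 1)) * (1 - c₁ * c₂ * c₄ * q ^ (a + w + 2) * q ^ x))) *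
        stepPre q c₀ c₂ c₃ c₄ x (y + 1) := by
    rw [stepCoeff₁₀, ← hE]; ring
  have k₁ : stepCoeff₁₁ q c₀ c₂ c₃ c₄ N x (y + 1) = -q ^ (N + 1) * (1 - q ^ (y + 1)) *
      (1 - c₃ * q ^ (y + 1)) * (c₃ * c₀ * q ^ (N + 2) *
        ((1 - q ^ x) * (c₄ * c₂ * q ^ (x + 1) - c₁ * c₂ * c₄ * q ^ (a + w + 2)))) *
        stepPre q c₀ c₂ c₃ c₄ x (y + 1) := by
    rw [stepCoeff₁₁, ← hE]; ring
  have b := baseWeight_succ q c₁ c₂ a (y + w)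
  rw [show a + (y + w) = N by omega] at b
  rw [k₀, k₁, ← t₀, ← t₁]
  simp only [summand]
  rw [s1, s2, s4, s5, hΦ, sideFactor_succ_succ hq, sideFactor_shift_succ hq, b,
    sideWeight_shift h.free₄ h.free₁₂₄]
  exact product_rearrange' _ _ _ _ _ _ _ _ _ _ _ _ _ _ _ _

/-- The recurrence that lowers `j`. -/
theorem normGriffiths_lower_j (h : Generic q c₀ c₁ c₂ c₃ c₄ (N + 1)) {i j x y : ℕ}
    (hy : y ≤ N + 1) :
    normGriffiths q c₀ c₁ c₂ c₃ c₄ (N + 1) i (j + 1) x y =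
      stepCoeff₀₀ q c₀ c₂ c₃ c₄ N x y *
          normGriffiths q (c₀ * q) c₁ c₂ c₃ (c₄ * q) N i j x y +
        stepCoeff₀₁ q c₀ c₂ c₃ c₄ N x y *
          normGriffiths q (c₀ * q) c₁ c₂ c₃ (c₄ * q) N i j (x - 1) y +
        (stepCoeff₁₀ q c₀ c₂ c₃ c₄ N x y *
          normGriffiths q (c₀ * q) c₁ c₂ c₃ (c₄ * q) N i j x (y - 1) +
        stepCoeff₁₁ q c₀ c₂ c₃ c₄ N x y *
          normGriffiths q (c₀ * q) c₁ c₂ c₃ (c₄ * q) N i j (x - 1) (y - 1)) := by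
  have hq := h.q_ne_zero
  have hp : ∀ k, q ^ k ≠ 0 := fun k => pow_ne_zero k hq
  simp only [normGriffiths_eq_sum (K := N + 2) _ _ _ _ _ _ (N + 1) _ _ _ _ le_rfl,
    normGriffiths_eq_sum (K := N + 2) _ _ _ _ _ _ N _ _ _ _ (Nat.le_succ _)]
  simp only [Finset.mul_sum, ← Finset.sum_add_distrib]
  refine Finset.sum_congr rfl fun a _ => ?_
  by_cases haj : a + j ≤ N
  swap
  · rw [if_neg (by omega), if_neg (by omega), if_neg (by omega), if_neg (by omega),
      if_neg (by omega)]
    ring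
  by_cases hay : a + y ≤ N + 1
  swap
  · rw [if_neg (by omega), if_neg (by omega), if_neg (by omega), if_neg (by omega),
      if_neg (by omega)]
    ring
  rw [if_pos ⟨by omega, hay⟩]
  -- The backward shift in the middle series lowers j and splits each summand into a part that keeps
  -- y and a part that lowers it.
  have hΦ := racahPhi_backward (b₁ := c₃) (b₂ := c₀) (b₃ := c₄) (M := N - a) (n := j) (x := y)
    hq (fun k h1 h2 => h.q_pow k h1 (by omega)) (mul_ne_zero h.ne₃ h.ne₀)
    (h.free₀₃.congr (mul_comm _ _)) h.free₀ h.free₀₃₄ (by omega)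
  rw [show N - a + 1 = N + 1 - a by omega, show N - a + 3 = N + 1 - a + 2 by omega] at hΦ
  rw [summand, hΦ, mul_add, add_mul, mul_add]
  congr 1
  · rcases hay.lt_or_eq with hay' | hay'
    · obtain ⟨w, hw⟩ := Nat.exists_eq_add_of_le (Nat.lt_succ_iff.mp hay')
      rw [if_pos ⟨haj, by omega⟩, if_pos ⟨haj, by omega⟩, ← summand_lower_j_same h haj hw,
        show N + 1 - a = y + w + 1 by omega, show y + w + 1 + 2 = y + w + 3 by ring]
    -- On the edge a + y = N + 1 there is no term of size N; correspondingly the factor 1 -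
    -- q^{-(N+1-a)}q^y of the backward shift is zero.
    · rw [if_neg (by omega), if_neg (by omega), show N + 1 - a = y by omega,
        inv_mul_cancel₀ (hp y)]
      ring
  · rcases y with _ | y
    · simp [stepCoeff₁₀, stepCoeff₁₁]
    · obtain ⟨w, hw⟩ := Nat.exists_eq_add_of_le (show a + y ≤ N by omega)
      rw [Nat.add_sub_cancel, if_pos ⟨haj, by omega⟩, if_pos ⟨haj, by omega⟩,
        ← summand_lower_j_down h haj hw,
        show N + 1 - a = y + w + 1 by omega, show y + w + 1 + 2 = y + w + 3 by ring]

end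

/-! ### The recurrence that lowers i. -/

section

theorem qPoch_eq_shift {a q : ℂ} {k : ℕ} (h : 1 - a * q ^ k ≠ 0) :
    qPoch a q k = (1 - a) / (1 - a * q ^ k) * qPoch (a * q) q k := by
  rw [div_mul_eq_mul_div, qPoch_shift, mul_div_cancel_right₀ _ h]

section

variable {q c₁ c₂ v c : ℂ}

theorem baseWeight_shift (hq : q ≠ 0) (hv : Free q (c₁ * c₂)) (h2 : Free q c₂)
    (a d : ℕ) :
    baseWeight q c₁ c₂ (a + d + 1) a =
      (1 - q ^ (d + 1)) * (1 - c₁ * c₂ * q) * ((1 - c₁ * c₂ * q) / (1 - c₁ * c₂ * q ^ (a + 1))) *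
        ((1 - c₁ * c₂ * q ^ (2 * a + 1)) / (1 - c₁ * c₂ * q ^ (2 * a + 2))) *
        ((1 - q * c₂) / (1 - q * c₂ * q ^ a)) * q ^ a *
        baseWeight q c₁ (c₂ * q) (a + d) a := by
  have e1 : c₁ * c₂ * q * q ^ a = c₁ * c₂ * q ^ (a + 1) := by ring
  have n1 : 1 - c₁ * c₂ * q * q ^ a ≠ 0 := e1 ▸ hv.ne (a + 1)
  have n2 : 1 - q * c₂ * q ^ a ≠ 0 := by
    rw [show q * c₂ * q ^ a = c₂ * q ^ (a + 1) by ring]; exact h2.ne _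
  have n3 := hv.ne (2 * a + 2)
  have n4 := pow_ne_zero a hq
  simp only [baseWeight]
  rw [show a + d + 1 - a = d + 1 by omega, show a + d - a = d by omega,
    show a + d + 1 + a + 1 = (a + d + a + 1) + 1 by ring, qPoch_succ q q,
    qPoch_succ' (c₁ * c₂ * q) q (a + d + a + 1), qPoch_eq_shift n1, qPoch_eq_shift n2, e1,
    show c₁ * (c₂ * q) * q = c₁ * c₂ * q * q by ring, show q * (c₂ * q) = q * c₂ * q by ring,
    show c₁ * (c₂ * q) * q ^ (2 * a + 1) = c₁ * c₂ * q ^ (2 * a + 2) by ring, mul_pow (q * c₂) q a,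
    show q * q ^ d = q ^ (d + 1) by ring]
  generalize 1 - c₁ * c₂ * q ^ (2 * a + 2) = d₁ at *
  generalize qPoch q q a = P₁
  generalize qPoch (q * c₁) q a = P₂
  generalize (q * c₂) ^ a = P₃
  generalize q ^ a = P₄ at *
  simp only [div_eq_mul_inv, mul_inv]
  generalize P₁⁻¹ = P₁', P₂⁻¹ = P₂', P₃⁻¹ = P₃'
  generalize (1 - c₁ * c₂ * q ^ (a + 1))⁻¹ = d₂, (1 - q * c₂ * q ^ a)⁻¹ = d₃
  generalize 1 - c₁ * c₂ * q ^ (2 * a + 1) = d₄, 1 - q ^ (d + 1) = d₅, 1 - c₁ * c₂ * q = d₆,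
    1 - q * c₂ = d₇
  generalize qPoch q q d = P₅, qPoch (c₁ * c₂ * q * q) q (a + d + a + 1) = P₆,
    qPoch (c₁ * c₂ * q * q) q a = P₇, qPoch (q * c₂ * q) q a = P₈
  -- The only cancellations needed are d₁d₁⁻¹ = 1 and P₄P₄⁻¹ = 1. Once they are inserted, all
  -- inverses may be treated as independent letters and a polynomial identity is left.
  have key : ∀ X : ℂ, X = X * (d₁ * d₁⁻¹) * (P₄ * P₄⁻¹) := fun X => by
    rw [mul_inv_cancel₀ n3, mul_inv_cancel₀ n4, mul_one, mul_one]
  refine (key _).trans ?_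
  generalize d₁⁻¹ = d₁', P₄⁻¹ = P₄'
  ring

theorem baseWeight_succ_shift (hq : q ≠ 0) (hv : Free q (c₁ * c₂)) (a d : ℕ) :
    baseWeight q c₁ c₂ (a + d + 1) (a + 1) =
      (1 - c₁ * c₂ * q) * (1 - c₁ * c₂ * q ^ (2 * a + d + 3)) * (1 - c₁ * c₂ * q) *
        ((1 - c₁ * c₂ * q ^ (2 * a + 3)) / (1 - c₁ * c₂ * q ^ (2 * a + 2))) *
        (1 - q * c₂) * q ^ a / ((1 - q ^ (a + 1)) * (1 - c₁ * q ^ (a + 1)) * (q * c₂)) *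
        baseWeight q c₁ (c₂ * q) (a + d) a := by
  have n3 := hv.ne (2 * a + 2)
  have n4 := pow_ne_zero a hq
  simp only [baseWeight]
  rw [show a + d + 1 - (a + 1) = d by omega, show a + d - a = d by omega,
    show a + d + 1 + (a + 1) + 1 = (a + d + a + 1) + 1 + 1 by ring,
    qPoch_succ (c₁ * c₂ * q) q (a + d + a + 1 + 1),
    qPoch_succ' (c₁ * c₂ * q) q (a + d + a + 1), qPoch_succ' (c₁ * c₂ * q) q a,
    qPoch_succ' (q * c₂) q a, qPoch_succ q q, qPoch_succ (q * c₁),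
    show c₁ * c₂ * q * q ^ (a + d + a + 1 + 1) = c₁ * c₂ * q ^ (2 * a + d + 3) by ring,
    show c₁ * (c₂ * q) * q = c₁ * c₂ * q * q by ring, show q * (c₂ * q) = q * c₂ * q by ring,
    show c₁ * (c₂ * q) * q ^ (2 * a + 1) = c₁ * c₂ * q ^ (2 * a + 2) by ring, mul_pow (q * c₂) q a,
    show c₁ * c₂ * q ^ (2 * (a + 1) + 1) = c₁ * c₂ * q ^ (2 * a + 3) by ring,
    show q * c₁ * q ^ a = c₁ * q ^ (a + 1) by ring, pow_succ (q * c₂),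
    show q * q ^ a = q ^ (a + 1) by ring]
  generalize 1 - c₁ * c₂ * q ^ (2 * a + 2) = d₁ at *
  generalize 1 - q ^ (a + 1) = d₂
  generalize qPoch q q a = P₁
  generalize qPoch (q * c₁) q a = P₂
  generalize (q * c₂) ^ a = P₃
  generalize q ^ a = P₄ at *
  simp only [div_eq_mul_inv, mul_inv]
  generalize P₁⁻¹ = P₁', P₂⁻¹ = P₂', P₃⁻¹ = P₃', d₂⁻¹ = d₃, q⁻¹ = q', c₂⁻¹ = c'
  generalize (1 - c₁ * q ^ (a + 1))⁻¹ = d₄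
  generalize 1 - c₁ * c₂ * q ^ (2 * a + 3) = d₅, 1 - c₁ * c₂ * q ^ (2 * a + d + 3) = d₆,
    1 - c₁ * c₂ * q = d₇, 1 - q * c₂ = d₈
  generalize qPoch q q d = P₅, qPoch (c₁ * c₂ * q * q) q (a + d + a + 1) = P₆,
    qPoch (c₁ * c₂ * q * q) q a = P₇, qPoch (q * c₂ * q) q a = P₈
  have key : ∀ X : ℂ, X = X * (d₁ * d₁⁻¹) * (P₄ * P₄⁻¹) := fun X => by
    rw [mul_inv_cancel₀ n3, mul_inv_cancel₀ n4, mul_one, mul_one]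
  refine (key _).trans ?_
  generalize d₁⁻¹ = d₁', P₄⁻¹ = P₄'
  ring

/-- In these names `shift₂` means that v and c are both multiplied by q, `shift₁` that only v is,
and `raise` that the left side stands at a + 1. The subscript 2 serves the weight of c₃, the
subscript 1 that of c₄. -/
theorem sideWeight_succ_shift₂ (hq : q ≠ 0) (hvc : Free q (v * c)) (a u : ℕ) :
    sideWeight q v c a (u + 1) = (1 - q ^ (a + u + 1)) * (1 - q * c) *
      (1 - v * c * q ^ (a + u + 3)) /
      ((1 - q ^ (u + 1)) * (1 - v * q) * (1 - v * c * q ^ (a + u + 3) * q ^ a)) *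
        sideWeight q (v * q) (c * q) a u := by
  have n := (hvc.mul_pow hq (a + u + 3)).ne a
  simp only [sideWeight]
  rw [← add_assoc a u 1, ← add_assoc (2 * a) u 1, qPoch_succ q q (a + u), qPoch_succ q q u,
    qPoch_succ' (v * q), qPoch_succ' (q * c),
    show v * c * q ^ (a + u + 1 + 2) = v * c * q ^ (a + u + 3) by ring,
    qPoch_eq_shift n,
    show v * q * (c * q) * q ^ (a + u + 2) = v * c * q ^ (a + u + 3) * q by ring,
    show q * c * q = q * (c * q) by ring, show q * q ^ (a + u) = q ^ (a + u + 1) by ring,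
    show q * q ^ u = q ^ (u + 1) by ring]
  simp only [div_eq_mul_inv, mul_inv]
  ring

theorem sideWeight_raise_shift₂ (hc : Free q c) (a u : ℕ) :
    sideWeight q v c (a + 1) u = (1 - q ^ (a + u + 1)) * (1 - q * c) *
      (1 - v * c * q ^ (a + u + 3)) /
      ((1 - c * q ^ (u + 1)) * (1 - v * q) * (1 - v * q ^ (2 * a + u + 3))) *
        sideWeight q (v * q) (c * q) a u := by
  have n : 1 - q * c * q ^ u ≠ 0 := by
    rw [show q * c * q ^ u = c * q ^ (u + 1) by ring]; exact hc.ne _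
  simp only [sideWeight]
  rw [show a + 1 + u = a + u + 1 by ring, show 2 * (a + 1) + u + 1 = (2 * a + u + 1) + 1 + 1 by ring,
    qPoch_succ q q (a + u), qPoch_succ (v * q), qPoch_succ' (v * q), qPoch_eq_shift n,
    show v * c * q ^ (a + u + 1 + 2) = v * c * q ^ (a + u + 3) by ring, qPoch_succ',
    show v * q * (c * q) * q ^ (a + u + 2) = v * c * q ^ (a + u + 3) * q by ring,
    show q * c * q ^ u = c * q ^ (u + 1) by ring,
    show q * c * q = q * (c * q) by ring, show q * q ^ (a + u) = q ^ (a + u + 1) by ring,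
    show v * q * q ^ (2 * a + u + 1 + 1) = v * q ^ (2 * a + u + 3) by ring]
  simp only [div_eq_mul_inv, mul_inv]
  ring

theorem sideWeight_succ_shift₁ (a w : ℕ) :
    sideWeight q v c a (w + 1) = (1 - q ^ (a + w + 1)) * (1 - c * q ^ (w + 1)) /
      ((1 - q ^ (w + 1)) * (1 - v * q)) * sideWeight q (v * q) c a w := by
  simp only [sideWeight]
  rw [← add_assoc a w 1, ← add_assoc (2 * a) w 1, qPoch_succ q q (a + w), qPoch_succ q q w,
    qPoch_succ' (v * q), qPoch_succ (q * c),
    show v * c * q ^ (a + w + 1 + 2) = v * q * c * q ^ (a + w + 2) by ring,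
    show q * c * q ^ w = c * q ^ (w + 1) by ring, show q * q ^ (a + w) = q ^ (a + w + 1) by ring,
    show q * q ^ w = q ^ (w + 1) by ring]
  simp only [div_eq_mul_inv, mul_inv]
  ring

theorem sideWeight_raise_shift₁ (a w : ℕ) :
    sideWeight q v c (a + 1) w = (1 - q ^ (a + w + 1)) * (1 - v * c * q ^ (2 * a + w + 3)) /
      ((1 - v * q) * (1 - v * q ^ (2 * a + w + 3))) * sideWeight q (v * q) c a w := by
  simp only [sideWeight]
  rw [show a + 1 + w = a + w + 1 by ring, show 2 * (a + 1) + w + 1 = (2 * a + w + 1) + 1 + 1 by ring,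
    qPoch_succ q q (a + w), qPoch_succ (v * q), qPoch_succ' (v * q),
    show v * c * q ^ (a + w + 1 + 2) = v * q * c * q ^ (a + w + 2) by ring, qPoch_succ,
    show v * q * c * q ^ (a + w + 2) * q ^ a = v * c * q ^ (2 * a + w + 3) by ring,
    show q * q ^ (a + w) = q ^ (a + w + 1) by ring,
    show v * q * q ^ (2 * a + w + 1 + 1) = v * q ^ (2 * a + w + 3) by ring]
  simp only [div_eq_mul_inv, mul_inv]
  ring

theorem sideWeight_shift₁ (hv : Free q v) (hvc : Free q (v * c)) (a w : ℕ) :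
    sideWeight q v c a w = (1 - v * c * q ^ (a + w + 2)) * (1 - v * q ^ (2 * a + w + 2)) /
      ((1 - v * c * q ^ (2 * a + w + 2)) * (1 - v * q)) * sideWeight q (v * q) c a w := by
  have e1 : v * c * q ^ (a + w + 2) * q ^ a = v * c * q ^ (2 * a + w + 2) := by ring
  have e2 : v * q * q ^ (2 * a + w + 1) = v * q ^ (2 * a + w + 2) := by ring
  have n1 : 1 - v * c * q ^ (a + w + 2) * q ^ a ≠ 0 := e1 ▸ hvc.ne _
  have n2 : 1 - v * q * q ^ (2 * a + w + 1) ≠ 0 := e2 ▸ hv.ne _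
  simp only [sideWeight]
  rw [qPoch_eq_shift n1, qPoch_eq_shift n2, e1, e2,
    show v * c * q ^ (a + w + 2) * q = v * q * c * q ^ (a + w + 2) by ring]
  simp only [div_eq_mul_inv, mul_inv, inv_inv]
  ring

theorem sideWeight_raise_shift_succ (hc : Free q c) (a w : ℕ)
    (hw : 1 - q ^ (w + 1) ≠ 0) :
    sideWeight q v c (a + 1) w = (1 - v * c * q ^ (a + w + 3)) * (1 - q ^ (w + 1)) /
      ((1 - v * q) * (1 - c * q ^ (w + 1))) * sideWeight q (v * q) c a (w + 1) := by
  have n := hc.ne (w + 1)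
  simp only [sideWeight]
  rw [show a + 1 + w = a + w + 1 by ring, show 2 * (a + 1) + w + 1 = (2 * a + w + 2) + 1 by ring,
    qPoch_succ' (v * q), qPoch_succ' (v * c * q ^ (a + w + 1 + 2)), ← add_assoc a w 1,
    ← add_assoc (2 * a) w 1,
    qPoch_succ q q w, qPoch_succ (q * c) q w,
    show v * c * q ^ (a + w + 1 + 2) * q = v * q * c * q ^ (a + w + 1 + 2) by ring,
    show v * c * q ^ (a + w + 1 + 2) = v * c * q ^ (a + w + 3) by ring,
    show q * c * q ^ w = c * q ^ (w + 1) by ring, show q * q ^ w = q ^ (w + 1) by ring]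
  generalize 1 - q ^ (w + 1) = d₁ at *
  generalize 1 - c * q ^ (w + 1) = d₂ at *
  simp only [div_eq_mul_inv, mul_inv]
  generalize (1 - v * q)⁻¹ = d₃, (qPoch q q w)⁻¹ = d₄, (qPoch (v * q * q) q (2 * a + w + 2))⁻¹ = d₅
  field_simp

end

end

section

variable {q c₀ c₁ c₂ c₃ c₄ : ℂ} {N : ℕ}

/-- The backward shift of the first series contributes at a and at a + 1. This lemma and
`weight_backward_down` express both contributions through the same shifted weights at a, so that
they can be added. -/
theorem weight_backward_same (h : Generic q c₀ c₁ c₂ c₃ c₄ (N + 1)) {a d u : ℕ}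
    (hu : a + u ≤ N) :
    baseWeight q c₁ c₂ (a + d + 1) a * sideWeight q (c₁ * c₂) c₃ a (u + 1) *
      ((1 - q * c₂ * q ^ a) * (1 - c₁ * c₂ * c₃ * q ^ (a + u + 3) * q ^ a) *
          (1 - (q ^ (a + u + 1))⁻¹ * q ^ a) * (1 - c₁ * c₂ * q ^ (a + 1)) /
          (q ^ a * (1 - c₁ * c₂ * q ^ (2 * a + 1)) * ((1 - q * c₂) *
            (1 - c₁ * c₂ * c₃ * q ^ (a + u + 3)) * (1 - (q ^ (a + u + 1))⁻¹)))) =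
      q ^ a * (1 - q ^ (d + 1)) * (1 - c₁ * c₂ * q) * (1 - q * c₃) /
          (1 - c₁ * c₂ * q ^ (2 * a + 2)) *
        (baseWeight q c₁ (c₂ * q) (a + d) a * sideWeight q (c₁ * c₂ * q) (c₃ * q) a u) := by
  have hq := h.q_ne_zero
  have hp : ∀ k, q ^ k ≠ 0 := fun k => pow_ne_zero k hq
  have n1 : 1 - q * c₂ * q ^ a ≠ 0 := by
    rw [show q * c₂ * q ^ a = c₂ * q ^ (a + 1) by ring]; exact h.free₂.ne _
  have n2 := (h.free₁₂₃.mul_pow hq (a + u + 3)).ne a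
  have n3 := h.free₁₂₃.ne (a + u + 3)
  have n4 := h.free₁₂.ne (a + 1)
  have n5 := h.free₁₂.ne (2 * a + 1)
  have n6 : 1 - c₁ * c₂ * q ≠ 0 := by simpa using h.free₁₂.ne 1
  have n7 : 1 - q * c₂ ≠ 0 := by simpa [mul_comm] using h.free₂.ne 1
  have n8 : 1 - q ^ (a + u + 1) ≠ 0 := h.q_pow _ (by omega) (by omega)
  have n9 : 1 - q ^ (u + 1) ≠ 0 := h.q_pow _ (by omega) (by omega)
  have m1 := hp a
  have m2 := hp (a + u + 1)
  rw [baseWeight_shift hq h.free₁₂ h.free₂, sideWeight_succ_shift₂ hq h.free₁₂₃,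
    one_sub_inv m2, one_sub_inv_mul m2,
    show q ^ a - q ^ (a + u + 1) = q ^ a * (1 - q ^ (u + 1)) by ring]
  generalize 1 - q * c₂ * q ^ a = d₁ at *
  generalize 1 - c₁ * c₂ * c₃ * q ^ (a + u + 3) * q ^ a = d₂ at *
  generalize 1 - c₁ * c₂ * c₃ * q ^ (a + u + 3) = d₃ at *
  generalize 1 - c₁ * c₂ * q ^ (a + 1) = d₄ at *
  generalize 1 - c₁ * c₂ * q ^ (2 * a + 1) = d₅ at *
  generalize 1 - c₁ * c₂ * q = d₆ at *
  generalize 1 - q * c₂ = d₇ at *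
  generalize 1 - q ^ (a + u + 1) = d₈ at *
  generalize 1 - q ^ (u + 1) = d₉ at *
  generalize q ^ (a + u + 1) = t₁ at *
  generalize q ^ a = t at *
  generalize 1 - q ^ (d + 1) = e₁, 1 - q * c₃ = e₂, 1 - c₁ * c₂ * q ^ (2 * a + 2) = e₃
  field_simp

theorem weight_backward_down (h : Generic q c₀ c₁ c₂ c₃ c₄ (N + 1)) {a d u : ℕ}
    (hu : a + u ≤ N) :
    baseWeight q c₁ c₂ (a + d + 1) (a + 1) * sideWeight q (c₁ * c₂) c₃ (a + 1) u *
      ((1 - q ^ (a + 1)) * (c₁ * c₂ * q ^ (a + 1 + 1) - q * c₂) *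
          (c₁ * c₂ * q ^ (a + 1 + 1) - c₁ * c₂ * c₃ * q ^ (a + u + 3)) *
          (c₁ * c₂ * q ^ (a + 1 + 1) - (q ^ (a + u + 1))⁻¹) /
          (c₁ * c₂ * q ^ (a + 1 + 1) * (1 - c₁ * c₂ * q ^ (2 * (a + 1) + 1)) * ((1 - q * c₂) *
            (1 - c₁ * c₂ * c₃ * q ^ (a + u + 3)) * (1 - (q ^ (a + u + 1))⁻¹)))) =
      -(q ^ a * (1 - c₁ * c₂ * q ^ (2 * a + d + 3)) * (1 - c₁ * c₂ * q) * (1 - q * c₃) /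
          (1 - c₁ * c₂ * q ^ (2 * a + 2))) *
        (baseWeight q c₁ (c₂ * q) (a + d) a * sideWeight q (c₁ * c₂ * q) (c₃ * q) a u) := by
  have hq := h.q_ne_zero
  have hp : ∀ k, q ^ k ≠ 0 := fun k => pow_ne_zero k hq
  have n1 := h.free₁.ne (a + 1)
  have n2 := h.free₃.ne (u + 1)
  have n3 := h.free₁₂₃.ne (a + u + 3)
  have n4 := h.free₁₂.ne (2 * a + u + 3)
  have n5 := h.free₁₂.ne (2 * a + 3)
  have n6 : 1 - c₁ * c₂ * q ≠ 0 := by simpa using h.free₁₂.ne 1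
  have n7 : 1 - q * c₂ ≠ 0 := by simpa [mul_comm] using h.free₂.ne 1
  have n8 : 1 - q ^ (a + u + 1) ≠ 0 := h.q_pow _ (by omega) (by omega)
  have n9 : 1 - q ^ (a + 1) ≠ 0 := h.q_pow _ (by omega) (by omega)
  have m1 := mul_ne_zero (mul_ne_zero h.ne₁ h.ne₂) (hp (a + 1 + 1))
  have m2 := hp (a + u + 1)
  have m3 := mul_ne_zero hq h.ne₂
  have e3 : c₁ * c₂ * q ^ (a + 1 + 1) - (q ^ (a + u + 1))⁻¹ =
      -(q ^ (a + u + 1))⁻¹ * (1 - c₁ * c₂ * q ^ (2 * a + u + 3)) := by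
    have : c₁ * c₂ * q ^ (2 * a + u + 3) = c₁ * c₂ * q ^ (a + 1 + 1) * q ^ (a + u + 1) := by ring
    rw [this]
    field_simp
    ring
  rw [baseWeight_succ_shift hq h.free₁₂, sideWeight_raise_shift₂ h.free₃, e3,
    one_sub_inv m2, show 2 * (a + 1) + 1 = 2 * a + 3 by ring,
    show c₁ * c₂ * q ^ (a + 1 + 1) - q * c₂ = -(q * c₂) * (1 - c₁ * q ^ (a + 1)) by ring,
    show c₁ * c₂ * q ^ (a + 1 + 1) - c₁ * c₂ * c₃ * q ^ (a + u + 3) =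
      c₁ * c₂ * q ^ (a + 1 + 1) * (1 - c₃ * q ^ (u + 1)) by ring]
  generalize 1 - c₁ * q ^ (a + 1) = d₁ at *
  generalize 1 - c₃ * q ^ (u + 1) = d₂ at *
  generalize 1 - c₁ * c₂ * c₃ * q ^ (a + u + 3) = d₃ at *
  generalize 1 - c₁ * c₂ * q ^ (2 * a + u + 3) = d₄ at *
  generalize 1 - c₁ * c₂ * q ^ (2 * a + 3) = d₅ at *
  generalize 1 - c₁ * c₂ * q = d₆ at *
  generalize 1 - q * c₂ = d₇ at *
  generalize 1 - q ^ (a + u + 1) = d₈ at *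
  generalize 1 - q ^ (a + 1) = d₉ at *
  generalize q ^ (a + u + 1) = t₁ at *
  generalize c₁ * c₂ * q ^ (a + 1 + 1) = t₂ at *
  generalize q * c₂ = t₃ at *
  generalize q ^ a = t at *
  generalize 1 - c₁ * c₂ * q ^ (2 * a + d + 3) = e₁, 1 - q * c₃ = e₂,
    1 - c₁ * c₂ * q ^ (2 * a + 2) = e₃
  field_simp

end

section

variable {q c₀ c₁ c₂ c₃ c₄ : ℂ} {N : ℕ}

/-- The scalars left at a (here) and at a + 1 (`raise_same₁`) are one common multiple of the two
left-hand coefficients of `racahPhi_four_term_size`, and the multiplier does not depend on a.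
`raise_down₀` and `raise_down₁` play this role for `racahPhi_four_term_weight`. -/
theorem raise_same₀ (h : Generic q c₀ c₁ c₂ c₃ c₄ (N + 1)) {a y w : ℕ} (hN : N = a + y + w) :
    q ^ a * (1 - q ^ (y + w + 1)) * (1 - c₁ * c₂ * q) * (1 - q * c₃) /
        (1 - c₁ * c₂ * q ^ (2 * a + 2)) *
      ((1 - q ^ (a + w + 1)) * (1 - c₄ * q ^ (w + 1)) /
        ((1 - q ^ (w + 1)) * (1 - c₁ * c₂ * q))) *
      ((1 - c₃ * c₀ * q ^ (y + 1)) * (1 - (q ^ (y + w + 1))⁻¹ * q ^ y) /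
          ((1 - (q ^ (y + w + 1))⁻¹) * (1 - c₃ * c₀ * q ^ (2 * y + 1)))) =
    (1 - q * c₃) * (1 - c₃ * c₀ * q ^ (y + 1)) * q ^ (N + 1) /
        (c₁ * c₂ * q ^ 2 * (1 - q * c₂) * (1 - c₃ * c₀ * q ^ (2 * y + 1))) *
      ((1 - q * c₂) * (1 - (q ^ (a + w + 1))⁻¹) *
        (c₄ * c₂ * c₁ * q ^ (a + w + 3) - c₂ * c₁ * q ^ (a + 2)) /
          (1 - c₂ * c₁ * q ^ (2 * a + 2))) := by
  have hq := h.q_ne_zero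
  have hp : ∀ k, q ^ k ≠ 0 := fun k => pow_ne_zero k hq
  have n1 : 1 - q ^ (y + w + 1) ≠ 0 := h.q_pow _ (by omega) (by omega)
  have n2 : 1 - q ^ (w + 1) ≠ 0 := h.q_pow _ (by omega) (by omega)
  have n3 : 1 - c₁ * c₂ * q ≠ 0 := by simpa using h.free₁₂.ne 1
  have n4 : 1 - q * c₂ ≠ 0 := by simpa [mul_comm] using h.free₂.ne 1
  have c12 : c₁ * c₂ ≠ 0 := mul_ne_zero h.ne₁ h.ne₂
  have m1 := hp (y + w + 1)
  have m2 := hp (a + w + 1)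
  rw [mul_comm c₂ c₁, one_sub_inv m1, one_sub_inv_mul m1, one_sub_inv m2,
    show q ^ y - q ^ (y + w + 1) = q ^ y * (1 - q ^ (w + 1)) by ring,
    show c₄ * c₂ * c₁ * q ^ (a + w + 3) - c₁ * c₂ * q ^ (a + 2) =
      -(c₁ * c₂ * q ^ 2) * q ^ a * (1 - c₄ * q ^ (w + 1)) by ring,
    show q ^ (N + 1) = q ^ y * q ^ (a + w + 1) by rw [hN]; ring]
  have m3 := hp a
  have m4 := hp y
  have m5 := hp 2
  generalize 1 - q ^ (y + w + 1) = d₁ at *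
  generalize 1 - q ^ (w + 1) = d₂ at *
  generalize 1 - c₁ * c₂ * q = d₃ at *
  generalize 1 - q * c₂ = d₄ at *
  generalize q ^ (y + w + 1) = t₁ at *
  generalize q ^ (a + w + 1) = t₂ at *
  generalize q ^ a = t₃ at *
  generalize q ^ y = t₄ at *
  generalize c₁ * c₂ = v at *
  generalize q ^ 2 = q' at *
  generalize 1 - t₂ = e₁, 1 - q * c₃ = e₂, 1 - v * q ^ (2 * a + 2) = e₃,
    1 - c₄ * q ^ (w + 1) = e₄, 1 - c₃ * c₀ * q ^ (2 * y + 1) = e₅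
  field_simp

theorem raise_same₁ (h : Generic q c₀ c₁ c₂ c₃ c₄ (N + 1)) {a y w : ℕ} (hN : N = a + y + w) :
    -(q ^ a * (1 - c₁ * c₂ * q ^ (2 * a + (y + w) + 3)) * (1 - c₁ * c₂ * q) * (1 - q * c₃) /
          (1 - c₁ * c₂ * q ^ (2 * a + 2))) *
      ((1 - q ^ (a + w + 1)) * (1 - c₁ * c₂ * c₄ * q ^ (2 * a + w + 3)) /
        ((1 - c₁ * c₂ * q) * (1 - c₁ * c₂ * q ^ (2 * a + w + 3)))) *
      ((1 - c₃ * c₀ * q ^ (y + 1)) * (1 - c₃ * c₀ * c₄ * q ^ (y + w + 2) * q ^ y) /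
          ((1 - c₃ * c₀ * c₄ * q ^ (y + w + 2)) * (1 - c₃ * c₀ * q ^ (2 * y + 1)))) =
    (1 - q * c₃) * (1 - c₃ * c₀ * q ^ (y + 1)) * q ^ (N + 1) /
        (c₁ * c₂ * q ^ 2 * (1 - q * c₂) * (1 - c₃ * c₀ * q ^ (2 * y + 1))) *
      ((1 - q * c₂) * (1 - (q ^ (a + w + 1))⁻¹) * (c₂ * c₁ * q ^ (a + 2)) *
        (1 - c₄ * c₂ * c₁ * q ^ (a + w + 3) * q ^ a) /
          (1 - c₂ * c₁ * q ^ (2 * a + 2))) := by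
  have hq := h.q_ne_zero
  have hp : ∀ k, q ^ k ≠ 0 := fun k => pow_ne_zero k hq
  have c12 : c₁ * c₂ ≠ 0 := mul_ne_zero h.ne₁ h.ne₂
  have hF : c₃ * c₀ * c₄ * q ^ (y + w + 2) = (c₁ * c₂ * q ^ (2 * a + (y + w) + 3))⁻¹ := by
    refine eq_inv_of_mul_eq_one_left ?_
    rw [← h.constraint, hN]
    ring
  have hF0 : c₁ * c₂ * q ^ (2 * a + (y + w) + 3) ≠ 0 := mul_ne_zero c12 (hp _)
  have n1 := h.free₁₂.ne (2 * a + (y + w) + 3)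
  have n2 := h.free₁₂.ne (2 * a + w + 3)
  have n3 : 1 - c₁ * c₂ * q ≠ 0 := by simpa using h.free₁₂.ne 1
  have n4 : 1 - q * c₂ ≠ 0 := by simpa [mul_comm] using h.free₂.ne 1
  have m2 := hp (a + w + 1)
  rw [mul_comm c₂ c₁, hF, one_sub_inv hF0, one_sub_inv_mul hF0, one_sub_inv m2,
    show q ^ y - c₁ * c₂ * q ^ (2 * a + (y + w) + 3) =
      q ^ y * (1 - c₁ * c₂ * q ^ (2 * a + w + 3)) by ring,
    show c₄ * c₂ * c₁ * q ^ (a + w + 3) * q ^ a = c₁ * c₂ * c₄ * q ^ (2 * a + w + 3) by ring,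
    show c₁ * c₂ * q ^ (a + 2) = c₁ * c₂ * q ^ 2 * q ^ a by ring,
    show q ^ (N + 1) = q ^ y * q ^ (a + w + 1) by rw [hN]; ring]
  have m3 := hp a
  have m4 := hp y
  have m5 := hp 2
  generalize 1 - c₁ * c₂ * q ^ (2 * a + (y + w) + 3) = d₁ at *
  generalize 1 - c₁ * c₂ * q ^ (2 * a + w + 3) = d₂ at *
  generalize 1 - c₁ * c₂ * q = d₃ at *
  generalize 1 - q * c₂ = d₄ at *
  generalize c₁ * c₂ * q ^ (2 * a + (y + w) + 3) = t₁ at *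
  generalize q ^ (a + w + 1) = t₂ at *
  generalize q ^ a = t₃ at *
  generalize q ^ y = t₄ at *
  generalize 1 - c₁ * c₂ * c₄ * q ^ (2 * a + w + 3) = e₄
  generalize c₁ * c₂ = v at *
  generalize q ^ 2 = q' at *
  generalize 1 - t₂ = e₁, 1 - q * c₃ = e₂, 1 - v * q ^ (2 * a + 2) = e₃,
    1 - c₃ * c₀ * q ^ (2 * y + 1) = e₅
  field_simp

theorem raise_down₀ (h : Generic q c₀ c₁ c₂ c₃ c₄ (N + 1)) {a y w : ℕ} (hN : N = a + y + w) :
    q ^ a * (1 - q ^ (y + w + 1)) * (1 - c₁ * c₂ * q) * (1 - q * c₃) /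
        (1 - c₁ * c₂ * q ^ (2 * a + 2)) *
      ((1 - c₁ * c₂ * c₄ * q ^ (a + w + 2)) * (1 - c₁ * c₂ * q ^ (2 * a + w + 2)) /
        ((1 - c₁ * c₂ * c₄ * q ^ (2 * a + w + 2)) * (1 - c₁ * c₂ * q))) *
      ((1 - q ^ (y + 1)) * (c₃ * c₀ * q ^ (y + 1 + 1) - (q ^ (y + w + 1))⁻¹) /
          ((1 - (q ^ (y + w + 1))⁻¹) * (1 - c₃ * c₀ * q ^ (2 * (y + 1) + 1)))) =
    -((1 - q * c₃) * (1 - q ^ (y + 1)) /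
        (c₁ * c₂ * c₄ * q ^ 2 * (1 - q * c₂) * (1 - c₃ * c₀ * q ^ (2 * (y + 1) + 1)))) *
      ((1 - q * c₂) * (1 - c₄ * c₂ * c₁ * q ^ (a + w + 2)) *
        ((q ^ (a + w))⁻¹ - c₂ * c₁ * q ^ (a + 2)) / (1 - c₂ * c₁ * q ^ (2 * a + 2))) := by
  have hq := h.q_ne_zero
  have hp : ∀ k, q ^ k ≠ 0 := fun k => pow_ne_zero k hq
  have c124 : c₁ * c₂ * c₄ ≠ 0 := mul_ne_zero (mul_ne_zero h.ne₁ h.ne₂) h.ne₄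
  have n1 : 1 - q ^ (y + w + 1) ≠ 0 := h.q_pow _ (by omega) (by omega)
  have n2 := h.free₁₂₄.ne (2 * a + w + 2)
  have n3 : 1 - c₁ * c₂ * q ≠ 0 := by simpa using h.free₁₂.ne 1
  have n4 : 1 - q * c₂ ≠ 0 := by simpa [mul_comm] using h.free₂.ne 1
  have m1 := hp (y + w + 1)
  have m2 := hp (a + w)
  have m3 := hp a
  have m5 := hp 2
  have e1 : c₃ * c₀ * q ^ (y + 1 + 1) - (q ^ (y + w + 1))⁻¹ =
      (q ^ (y + w + 1))⁻¹ * ((c₁ * c₂ * c₄ * q ^ 2 * (q ^ a * q ^ (a + w)))⁻¹ *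
        (1 - c₁ * c₂ * c₄ * q ^ (2 * a + w + 2))) := by
    have e : c₁ * c₂ * c₄ * q ^ (2 * a + w + 2) =
      c₁ * c₂ * c₄ * q ^ 2 * (q ^ a * q ^ (a + w)) := by ring
    have hE : c₁ * c₂ * c₄ * q ^ 2 * (q ^ a * q ^ (a + w)) ≠ 0 := e ▸ mul_ne_zero c124 (hp _)
    have : c₃ * c₀ * q ^ (y + 1 + 1) =
        (q ^ (y + w + 1))⁻¹ * (c₁ * c₂ * c₄ * q ^ 2 * (q ^ a * q ^ (a + w)))⁻¹ := by
      rw [← mul_inv]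
      refine eq_inv_of_mul_eq_one_left ?_
      rw [← h.constraint, hN]
      ring
    rw [this, e, mul_sub, inv_mul_cancel₀ hE]
    ring
  have e2 : (q ^ (a + w))⁻¹ - c₁ * c₂ * q ^ (a + 2) =
      (q ^ (a + w))⁻¹ * (1 - c₁ * c₂ * q ^ (2 * a + w + 2)) := by
    rw [show c₁ * c₂ * q ^ (2 * a + w + 2) = c₁ * c₂ * q ^ (a + 2) * q ^ (a + w) by ring]
    field_simp
  rw [mul_comm c₂ c₁, one_sub_inv m1, e1, e2,
    show c₄ * c₂ * c₁ * q ^ (a + w + 2) = c₁ * c₂ * c₄ * q ^ (a + w + 2) by ring]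
  generalize 1 - q ^ (y + w + 1) = d₁ at *
  generalize 1 - c₁ * c₂ * c₄ * q ^ (2 * a + w + 2) = d₂ at *
  generalize 1 - c₁ * c₂ * q = d₃ at *
  generalize 1 - q * c₂ = d₄ at *
  generalize 1 - c₁ * c₂ * c₄ * q ^ (a + w + 2) = e₆
  generalize c₁ * c₂ * c₄ = v' at *
  generalize q ^ (y + w + 1) = t₁ at *
  generalize q ^ (a + w) = t₂ at *
  generalize q ^ a = t₃ at *
  generalize q ^ 2 = q' at *
  generalize 1 - q ^ (y + 1) = e₁, 1 - q * c₃ = e₂, 1 - c₁ * c₂ * q ^ (2 * a + 2) = e₃,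
    1 - c₁ * c₂ * q ^ (2 * a + w + 2) = e₄, 1 - c₃ * c₀ * q ^ (2 * (y + 1) + 1) = e₅
  field_simp

theorem raise_down₁ (h : Generic q c₀ c₁ c₂ c₃ c₄ (N + 1)) {a y w : ℕ}
    (hN : N = a + y + (w + 1)) :
    -(q ^ a * (1 - c₁ * c₂ * q ^ (2 * a + (y + (w + 1)) + 3)) * (1 - c₁ * c₂ * q) *
        (1 - q * c₃) / (1 - c₁ * c₂ * q ^ (2 * a + 2))) *
      ((1 - c₁ * c₂ * c₄ * q ^ (a + w + 3)) * (1 - q ^ (w + 1)) /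
        ((1 - c₁ * c₂ * q) * (1 - c₄ * q ^ (w + 1)))) *
      ((1 - q ^ (y + 1)) * (c₃ * c₀ * q ^ (y + 1 + 1) - c₃ * c₀ * c₄ * q ^ (y + (w + 1) + 2)) /
          ((1 - c₃ * c₀ * c₄ * q ^ (y + (w + 1) + 2)) * (1 - c₃ * c₀ * q ^ (2 * (y + 1) + 1)))) =
    -((1 - q * c₃) * (1 - q ^ (y + 1)) /
        (c₁ * c₂ * c₄ * q ^ 2 * (1 - q * c₂) * (1 - c₃ * c₀ * q ^ (2 * (y + 1) + 1)))) *
      ((1 - q * c₂) * (1 - c₄ * c₂ * c₁ * q ^ (a + (w + 1) + 2)) * (c₂ * c₁ * q ^ (a + 2)) *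
        (1 - (q ^ (a + (w + 1)))⁻¹ * q ^ a) / (1 - c₂ * c₁ * q ^ (2 * a + 2))) := by
  have hq := h.q_ne_zero
  have hp : ∀ k, q ^ k ≠ 0 := fun k => pow_ne_zero k hq
  have c12 : c₁ * c₂ ≠ 0 := mul_ne_zero h.ne₁ h.ne₂
  have hF : c₃ * c₀ * c₄ * q ^ (y + (w + 1) + 2) =
      (c₁ * c₂ * q ^ (2 * a + (y + (w + 1)) + 3))⁻¹ := by
    refine eq_inv_of_mul_eq_one_left ?_
    rw [← h.constraint, hN]
    ring
  have hF0 : c₁ * c₂ * q ^ (2 * a + (y + (w + 1)) + 3) ≠ 0 := mul_ne_zero c12 (hp _)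
  have e0 : c₃ * c₀ * q ^ (y + 1 + 1) = (c₁ * c₂ * q ^ (2 * a + (y + (w + 1)) + 3))⁻¹ *
      (c₄ * q ^ (w + 1))⁻¹ := by
    rw [← mul_inv]
    refine eq_inv_of_mul_eq_one_left ?_
    rw [← h.constraint, hN]
    ring
  have m1 := hp (w + 1)
  have m2 := hp (a + (w + 1))
  have m4 := h.ne₄
  have e1 : c₃ * c₀ * q ^ (y + 1 + 1) - c₃ * c₀ * c₄ * q ^ (y + (w + 1) + 2) =
      (c₁ * c₂ * q ^ (2 * a + (y + (w + 1)) + 3))⁻¹ * ((c₄ * q ^ (w + 1))⁻¹ *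
        (1 - c₄ * q ^ (w + 1))) := by
    rw [hF, e0]
    field_simp
  have e2 : (q ^ (a + (w + 1)))⁻¹ * q ^ a = (q ^ (w + 1))⁻¹ := by
    have := hp a
    rw [pow_add q a]; field_simp
  have n1 := h.free₁₂.ne (2 * a + (y + (w + 1)) + 3)
  have n2 := h.free₄.ne (w + 1)
  have n3 : 1 - c₁ * c₂ * q ≠ 0 := by simpa using h.free₁₂.ne 1
  have n4 : 1 - q * c₂ ≠ 0 := by simpa [mul_comm] using h.free₂.ne 1
  have m5 := hp 2
  rw [mul_comm c₂ c₁, e1, hF, one_sub_inv hF0, e2, one_sub_inv m1,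
    show c₄ * c₂ * c₁ * q ^ (a + (w + 1) + 2) = c₁ * c₂ * c₄ * q ^ (a + w + 3) by ring,
    show c₁ * c₂ * q ^ (a + 2) = c₁ * c₂ * q ^ 2 * q ^ a by ring]
  generalize 1 - c₁ * c₂ * q ^ (2 * a + (y + (w + 1)) + 3) = d₁ at *
  generalize c₁ * c₂ * q ^ (2 * a + (y + (w + 1)) + 3) = t₁ at *
  generalize 1 - c₄ * q ^ (w + 1) = d₂ at *
  generalize 1 - c₁ * c₂ * q = d₃ at *
  generalize 1 - q * c₂ = d₄ at *
  generalize 1 - c₁ * c₂ * c₄ * q ^ (a + w + 3) = e₆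
  generalize c₁ * c₂ = v at *
  generalize q ^ (w + 1) = t₂ at *
  generalize q ^ a = t₃ at *
  generalize q ^ 2 = q' at *
  generalize 1 - q ^ (y + 1) = e₁, 1 - q * c₃ = e₂, 1 - v * q ^ (2 * a + 2) = e₃,
    1 - c₃ * c₀ * q ^ (2 * (y + 1) + 1) = e₅, 1 - t₂ = e₄
  field_simp

end

section

variable {q c₀ c₁ c₂ c₃ c₄ : ℂ} {N : ℕ}

/-- The factor in the recurrence that lowers `i`, terms keeping `y`. -/
def raiseSame (q c₀ c₁ c₂ c₃ : ℂ) (N y : ℕ) : ℂ :=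
  (1 - q * c₃) * (1 - c₃ * c₀ * q ^ (y + 1)) * q ^ (N + 1) /
    (c₁ * c₂ * q ^ 2 * (1 - q * c₂) * (1 - c₃ * c₀ * q ^ (2 * y + 1)))

/-- The factor in the recurrence that lowers `i`, terms lowering `y`. -/
def raiseDown (q c₀ c₁ c₂ c₃ c₄ : ℂ) (y : ℕ) : ℂ :=
  -((1 - q * c₃) * (1 - q ^ (y + 1)) /
    (c₁ * c₂ * c₄ * q ^ 2 * (1 - q * c₂) * (1 - c₃ * c₀ * q ^ (2 * (y + 1) + 1))))

/-- The right-hand coefficients of the four-term relation, times the common multiplier and the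
factor coming from `sideFactor`, are the coefficients of the other recurrence after c₀ ↔ c₂, c₃ ↔ c₄
and x ↔ y. The four lemmas of this kind are why both sides of the symmetry obey one recurrence. -/
theorem stepCoeff₀₀_swap (h : Generic q c₀ c₁ c₂ c₃ c₄ (N + 1)) {a y w : ℕ}
    (hN : N = a + y + w) (x : ℕ) :
    stepCoeff₀₀ q c₂ c₀ c₄ c₃ N y x = q ^ y * raiseSame q c₀ c₁ c₂ c₃ N y *
      (c₄ * c₂ * c₁ * q ^ (a + w + 3) * (1 - c₄ * c₂ * q ^ (x + 1)) * (1 - q * c₂ * q ^ x) *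
          (1 - (q ^ (a + w + 1))⁻¹ * q ^ x) / (1 - c₄ * c₂ * q ^ (2 * x + 1))) := by
  have hp : ∀ k, q ^ k ≠ 0 := fun k => pow_ne_zero k h.q_ne_zero
  have c12 : c₁ * c₂ ≠ 0 := mul_ne_zero h.ne₁ h.ne₂
  have m1 := hp (a + w + 1)
  have m2 := hp 2
  rw [stepCoeff₀₀, stepPre, raiseSame, one_sub_inv_mul m1,
    show q ^ (N + 1) - q ^ (y + x) = -(q ^ y * (q ^ x - q ^ (a + w + 1))) by rw [hN]; ring,
    show c₄ * c₂ * c₁ * q ^ (a + w + 3) = c₁ * c₂ * q ^ 2 * c₄ * q ^ (a + w + 1) by ring]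
  generalize q ^ x - q ^ (a + w + 1) = e₁
  generalize q ^ (a + w + 1) = t₁ at *
  generalize c₁ * c₂ = v at *
  generalize q ^ 2 = q' at *
  simp only [div_eq_mul_inv, mul_inv]
  generalize (1 - q * c₂)⁻¹ = d₁, (1 - c₄ * c₂ * q ^ (2 * x + 1))⁻¹ = d₂,
    (1 - c₃ * c₀ * q ^ (2 * y + 1))⁻¹ = d₃
  generalize 1 - q * c₂ * q ^ x = e₂, 1 - c₄ * c₂ * q ^ (x + 1) = e₃,
    1 - c₃ * c₀ * q ^ (y + 1) = e₄, 1 - q * c₃ = e₅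
  have key : ∀ X : ℂ, X = X * (v * v⁻¹) * (q' * q'⁻¹) * (t₁ * t₁⁻¹) := fun X => by
    rw [mul_inv_cancel₀ c12, mul_inv_cancel₀ m2, mul_inv_cancel₀ m1, mul_one, mul_one, mul_one]
  refine (key _).trans ?_
  generalize v⁻¹ = v', q'⁻¹ = q'', t₁⁻¹ = t₁'
  ring

theorem stepCoeff₁₀_swap (h : Generic q c₀ c₁ c₂ c₃ c₄ (N + 1)) {a y w : ℕ}
    (hN : N = a + y + w) (x : ℕ) :
    stepCoeff₁₀ q c₂ c₀ c₄ c₃ N y x = q ^ y * raiseSame q c₀ c₁ c₂ c₃ N y *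
      (c₄ * c₂ * c₁ * q ^ (a + w + 3) * (1 - q ^ x) * (c₄ * c₂ * q ^ (x + 1) - q * c₂) *
          (c₄ * c₂ * q ^ (x + 1) - (q ^ (a + w + 1))⁻¹) /
          (c₄ * c₂ * q ^ (x + 1) * (1 - c₄ * c₂ * q ^ (2 * x + 1)))) := by
  have hp : ∀ k, q ^ k ≠ 0 := fun k => pow_ne_zero k h.q_ne_zero
  have c12 : c₁ * c₂ ≠ 0 := mul_ne_zero h.ne₁ h.ne₂
  have m1 := hp (a + w + 1)
  have m2 := hp 2
  have m3 := hp x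
  have hq := h.q_ne_zero
  have m4 := h.ne₂
  have m5 := h.ne₄
  have e : c₄ * c₂ * q ^ (x + 1) - (q ^ (a + w + 1))⁻¹ =
      (q ^ (a + w + 1))⁻¹ * (c₄ * c₂ * q ^ (x + 1) * q ^ (a + w + 1) - 1) := by
    field_simp
  have e' : c₄ * c₂ * q ^ (N + 2) - q ^ y * (q ^ x)⁻¹ =
      q ^ y * (q ^ x)⁻¹ * (c₄ * c₂ * q ^ (x + 1) * q ^ (a + w + 1) - 1) := by
    rw [hN]; field_simp; ring
  rw [stepCoeff₁₀, stepPre, raiseSame, e, e',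
    show c₄ * c₂ * q ^ (x + 1) - q * c₂ = -(q * c₂) * (1 - c₄ * q ^ x) by ring,
    show c₄ * c₂ * c₁ * q ^ (a + w + 3) = c₁ * c₂ * q ^ 2 * c₄ * q ^ (a + w + 1) by ring,
    show c₄ * c₂ * q ^ (x + 1) * (1 - c₄ * c₂ * q ^ (2 * x + 1)) =
      c₄ * (q * c₂) * q ^ x * (1 - c₄ * c₂ * q ^ (2 * x + 1)) by ring]
  have m6 : q * c₂ ≠ 0 := mul_ne_zero hq m4
  generalize c₄ * c₂ * q ^ (x + 1) * q ^ (a + w + 1) - 1 = e₁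
  generalize q ^ (a + w + 1) = t₁ at *
  generalize c₁ * c₂ = v at *
  generalize q ^ 2 = q' at *
  simp only [div_eq_mul_inv, mul_inv]
  generalize (1 - q * c₂)⁻¹ = d₁, (1 - c₄ * c₂ * q ^ (2 * x + 1))⁻¹ = d₂,
    (1 - c₃ * c₀ * q ^ (2 * y + 1))⁻¹ = d₃
  generalize 1 - c₄ * q ^ x = e₂, 1 - q ^ x = e₃,
    1 - c₃ * c₀ * q ^ (y + 1) = e₄, 1 - q * c₃ = e₅
  generalize q ^ x = t₂ at *
  field_simp

theorem stepCoeff₀₁_swap (h : Generic q c₀ c₁ c₂ c₃ c₄ (N + 1)) {a y w : ℕ}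
    (hN : N = a + y + w) (x : ℕ) :
    stepCoeff₀₁ q c₂ c₀ c₄ c₃ N (y + 1) x = -c₄ * q ^ (N + 1) * raiseDown q c₀ c₁ c₂ c₃ c₄ y *
      ((q ^ (a + w))⁻¹ * (1 - c₄ * c₂ * q ^ (x + 1)) * (1 - q * c₂ * q ^ x) *
          (1 - c₄ * c₂ * c₁ * q ^ (a + w + 2) * q ^ x) / (1 - c₄ * c₂ * q ^ (2 * x + 1))) := by
  have hp : ∀ k, q ^ k ≠ 0 := fun k => pow_ne_zero k h.q_ne_zero
  have c12 : c₁ * c₂ ≠ 0 := mul_ne_zero h.ne₁ h.ne₂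
  have m1 := hp (a + w)
  have m2 := hp 2
  have m5 := h.ne₄
  have e : c₃ * c₀ * q ^ (y + 1 + 1) * q ^ (N + 1) - q ^ x =
      (c₁ * c₂ * c₄ * q ^ 2 * q ^ (a + w))⁻¹ * (1 - c₄ * c₂ * c₁ * q ^ (a + w + 2) * q ^ x) := by
    have : c₃ * c₀ * q ^ (y + 1 + 1) * q ^ (N + 1) = (c₁ * c₂ * c₄ * q ^ 2 * q ^ (a + w))⁻¹ := by
      refine eq_inv_of_mul_eq_one_left ?_
      rw [← h.constraint, hN]
      ring
    rw [this, show c₄ * c₂ * c₁ * q ^ (a + w + 2) * q ^ x =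
      (c₁ * c₂ * c₄ * q ^ 2 * q ^ (a + w)) * q ^ x by ring]
    have : c₁ * c₂ * c₄ * q ^ 2 * q ^ (a + w) ≠ 0 :=
      mul_ne_zero (mul_ne_zero (mul_ne_zero c12 m5) m2) m1
    generalize c₁ * c₂ * c₄ * q ^ 2 * q ^ (a + w) = t at *
    field_simp
  rw [stepCoeff₀₁, stepPre, raiseDown, e]
  generalize 1 - c₄ * c₂ * c₁ * q ^ (a + w + 2) * q ^ x = e₁
  generalize q ^ (a + w) = t₁ at *
  generalize c₁ * c₂ = v at *
  generalize q ^ 2 = q' at *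
  simp only [div_eq_mul_inv, mul_inv]
  generalize (1 - q * c₂)⁻¹ = d₁, (1 - c₄ * c₂ * q ^ (2 * x + 1))⁻¹ = d₂,
    (1 - c₃ * c₀ * q ^ (2 * (y + 1) + 1))⁻¹ = d₃
  generalize 1 - q * c₂ * q ^ x = e₂, 1 - c₄ * c₂ * q ^ (x + 1) = e₃,
    1 - q ^ (y + 1) = e₄, 1 - q * c₃ = e₅
  field_simp

theorem stepCoeff₁₁_swap (h : Generic q c₀ c₁ c₂ c₃ c₄ (N + 1)) {a y w : ℕ}
    (hN : N = a + y + w) (x : ℕ) :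
    stepCoeff₁₁ q c₂ c₀ c₄ c₃ N (y + 1) x = -c₄ * q ^ (N + 1) * raiseDown q c₀ c₁ c₂ c₃ c₄ y *
      ((q ^ (a + w))⁻¹ * (1 - q ^ x) * (c₄ * c₂ * q ^ (x + 1) - q * c₂) *
          (c₄ * c₂ * q ^ (x + 1) - c₄ * c₂ * c₁ * q ^ (a + w + 2)) /
          (c₄ * c₂ * q ^ (x + 1) * (1 - c₄ * c₂ * q ^ (2 * x + 1)))) := by
  have hp : ∀ k, q ^ k ≠ 0 := fun k => pow_ne_zero k h.q_ne_zero
  have hq := h.q_ne_zero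
  have c12 : c₁ * c₂ ≠ 0 := mul_ne_zero h.ne₁ h.ne₂
  have m1 := hp (a + w)
  have m2 := hp 2
  have m3 := hp x
  have m4 := h.ne₂
  have m5 := h.ne₄
  have m7 := h.ne₁
  have e : c₄ * c₂ * (c₃ * c₀) * q ^ (N + 3) * q ^ (y + 1) - (q ^ x)⁻¹ =
      (c₁ * q ^ x * q * q ^ (a + w))⁻¹ * (q ^ x - c₁ * q * q ^ (a + w)) := by
    have : c₄ * c₂ * (c₃ * c₀) * q ^ (N + 3) * q ^ (y + 1) = (c₁ * q * q ^ (a + w))⁻¹ := by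
      refine eq_inv_of_mul_eq_one_left ?_
      rw [← h.constraint, hN]
      ring
    rw [this]
    field_simp
  rw [stepCoeff₁₁, stepPre, raiseDown, e,
    show c₄ * c₂ * q ^ (x + 1) - q * c₂ = -(q * c₂) * (1 - c₄ * q ^ x) by ring,
    show c₄ * c₂ * q ^ (x + 1) - c₄ * c₂ * c₁ * q ^ (a + w + 2) =
      c₄ * (q * c₂) * (q ^ x - c₁ * q * q ^ (a + w)) by ring,
    show c₄ * c₂ * q ^ (x + 1) * (1 - c₄ * c₂ * q ^ (2 * x + 1)) =
      c₄ * (q * c₂) * q ^ x * (1 - c₄ * c₂ * q ^ (2 * x + 1)) by ring]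
  generalize q ^ x - c₁ * q * q ^ (a + w) = e₁
  generalize q ^ (a + w) = t₁ at *
  simp only [div_eq_mul_inv, mul_inv]
  generalize (1 - q * c₂)⁻¹ = d₁, (1 - c₄ * c₂ * q ^ (2 * x + 1))⁻¹ = d₂,
    (1 - c₃ * c₀ * q ^ (2 * (y + 1) + 1))⁻¹ = d₃
  generalize 1 - c₄ * q ^ x = e₂, 1 - q ^ x = e₃,
    1 - q ^ (y + 1) = e₄, 1 - q * c₃ = e₅
  generalize q ^ x = t₂ at *
  field_simp

end

section

variable {q c₀ c₁ c₂ c₃ c₄ : ℂ} {N : ℕ}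

theorem sideFactor_succ (c : ℂ) (N y : ℕ) :
    sideFactor q c (N + 1) y = q ^ y * sideFactor q c N y := by
  simp only [sideFactor]
  rw [add_mul, pow_add, one_mul]
  ring

/-- The combination of neighbouring terms, abstracted to a commutative ring. Index 0 belongs to a
and index 1 to a + 1. The hypotheses on w and u pass to the shifted weights W and X, `h₀` and `h₁`
exhibit the common multiplier κ, and `hG` is the four-term relation. -/
theorem two_term_rearrange {R : Type*} [CommRing R]
    {u₀ r₀ s₀ w₀ b₀ α u₁ r₁ s₁ w₁ b₁ β W X κ A B C D G₀ G₁ H₀ H₁ h₃ h₄ η P F K₀ K₁ : R}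
    (hw₀ : w₀ * b₀ = r₀ * W) (hu₀ : u₀ = s₀ * X) (hw₁ : w₁ * b₁ = r₁ * W) (hu₁ : u₁ = s₁ * X)
    (h₀ : r₀ * s₀ * α = κ * A) (h₁ : r₁ * s₁ * β = κ * B)
    (hG : A * G₀ + B * G₁ = C * H₀ + D * H₁) (hK₀ : K₀ = η * κ * C) (hK₁ : K₁ = η * κ * D) :
    h₃ * (η * h₄) * (w₀ * u₀ * (b₀ * P) * (α * F) * G₀ + w₁ * u₁ * (b₁ * P) * (β * F) * G₁) =
      K₀ * (h₃ * h₄ * (W * X * P * F * H₀)) + K₁ * (h₃ * h₄ * (W * X * P * F * H₁)) := by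
  subst hu₀ hu₁ hK₀ hK₁
  linear_combination (h₃ * η * h₄ * s₀ * X * P * α * F * G₀) * hw₀ +
    (h₃ * η * h₄ * s₁ * X * P * β * F * G₁) * hw₁ +
    (h₃ * η * h₄ * W * X * P * F * G₀) * h₀ + (h₃ * η * h₄ * W * X * P * F * G₁) * h₁ +
    (h₃ * η * h₄ * W * X * P * F * κ) * hG

/-- The version for the edge of the range, where there is no term at a + 1 and the relation does not
ask for one. -/
theorem two_term_rearrange_zero {R : Type*} [CommRing R]
    {u₀ r₀ s₀ w₀ b₀ α W X κ A B C D G₀ G₁ H₀ H₁ h₃ h₄ η P F K₀ K₁ : R}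
    (hw₀ : w₀ * b₀ = r₀ * W) (hu₀ : u₀ = s₀ * X)
    (h₀ : r₀ * s₀ * α = κ * A) (h₁ : B = 0)
    (hG : A * G₀ + B * G₁ = C * H₀ + D * H₁) (hK₀ : K₀ = η * κ * C) (hK₁ : K₁ = η * κ * D) :
    h₃ * (η * h₄) * (w₀ * u₀ * (b₀ * P) * (α * F) * G₀) =
      K₀ * (h₃ * h₄ * (W * X * P * F * H₀)) + K₁ * (h₃ * h₄ * (W * X * P * F * H₁)) := by
  have := two_term_rearrange (h₃ := h₃) (h₄ := h₄) (P := P) (F := F) hw₀ hu₀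
    (show (0 : R) * 0 = 0 * W by ring) (show (0 : R) = 0 * X by ring) h₀
    (show 0 * 0 * 0 = κ * B by rw [h₁]; ring) hG hK₀ hK₁
  rw [← this]
  ring

/-- Terms that keep `y` in the recurrence that lowers `i`. -/
theorem summand_lower_i_same (h : Generic q c₀ c₁ c₂ c₃ c₄ (N + 1)) {j a y w u : ℕ}
    (hN : N = a + y + w) (hu : N = j + a + u) (x : ℕ) (P F : ℂ) :
    sideFactor q c₃ (N + 1) j * sideFactor q c₄ (N + 1) y *
      (baseWeight q c₁ c₂ (N + 1) a * sideWeight q (c₁ * c₂) c₃ a (u + 1) *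
        sideWeight q (c₁ * c₂) c₄ a (w + 1) *
      ((1 - q * c₂ * q ^ a) * (1 - c₁ * c₂ * c₃ * q ^ (a + u + 3) * q ^ a) *
          (1 - (q ^ (a + u + 1))⁻¹ * q ^ a) * (1 - c₁ * c₂ * q ^ (a + 1)) /
          (q ^ a * (1 - c₁ * c₂ * q ^ (2 * a + 1)) * ((1 - q * c₂) *
            (1 - c₁ * c₂ * c₃ * q ^ (a + u + 3)) * (1 - (q ^ (a + u + 1))⁻¹))) * P) *
      ((1 - c₃ * c₀ * q ^ (y + 1)) * (1 - (q ^ (y + w + 1))⁻¹ * q ^ y) /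
          ((1 - (q ^ (y + w + 1))⁻¹) * (1 - c₃ * c₀ * q ^ (2 * y + 1))) * F) *
        racahPhi q c₄ c₂ c₁ (a + w + 1) a x +
      baseWeight q c₁ c₂ (N + 1) (a + 1) * sideWeight q (c₁ * c₂) c₃ (a + 1) u *
        sideWeight q (c₁ * c₂) c₄ (a + 1) w *
      ((1 - q ^ (a + 1)) * (c₁ * c₂ * q ^ (a + 1 + 1) - q * c₂) *
          (c₁ * c₂ * q ^ (a + 1 + 1) - c₁ * c₂ * c₃ * q ^ (a + u + 3)) *
          (c₁ * c₂ * q ^ (a + 1 + 1) - (q ^ (a + u + 1))⁻¹) /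
          (c₁ * c₂ * q ^ (a + 1 + 1) * (1 - c₁ * c₂ * q ^ (2 * (a + 1) + 1)) * ((1 - q * c₂) *
            (1 - c₁ * c₂ * c₃ * q ^ (a + u + 3)) * (1 - (q ^ (a + u + 1))⁻¹))) * P) *
      ((1 - c₃ * c₀ * q ^ (y + 1)) * (1 - c₃ * c₀ * c₄ * q ^ (y + w + 2) * q ^ y) /
          ((1 - c₃ * c₀ * c₄ * q ^ (y + w + 2)) * (1 - c₃ * c₀ * q ^ (2 * y + 1))) * F) *
        racahPhi q c₄ c₂ c₁ (a + w + 1) (a + 1) x) =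
    stepCoeff₀₀ q c₂ c₀ c₄ c₃ N y x * (sideFactor q (c₃ * q) N j * sideFactor q c₄ N y *
      (baseWeight q c₁ (c₂ * q) N a * sideWeight q (c₁ * c₂ * q) (c₃ * q) a u *
        sideWeight q (c₁ * c₂ * q) c₄ a w * P * F * racahPhi q c₄ (c₂ * q) c₁ (a + w) a x)) +
    stepCoeff₁₀ q c₂ c₀ c₄ c₃ N y x * (sideFactor q (c₃ * q) N j * sideFactor q c₄ N y *
      (baseWeight q c₁ (c₂ * q) N a * sideWeight q (c₁ * c₂ * q) (c₃ * q) a u *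
        sideWeight q (c₁ * c₂ * q) c₄ a w * P * F *
          racahPhi q c₄ (c₂ * q) c₁ (a + w) a (x - 1))) := by
  have hd : N = a + (y + w) := by omega
  rw [sideFactor_shift, sideFactor_succ]
  refine two_term_rearrange ?_ (sideWeight_succ_shift₁ a w) ?_ (sideWeight_raise_shift₁ a w)
    (raise_same₀ h hN) (raise_same₁ h hN) ?_ (stepCoeff₀₀_swap h hN x) (stepCoeff₁₀_swap h hN x)
  · have := weight_backward_same h (a := a) (d := y + w) (u := u) (by omega)
    rwa [← hd] at this
  · have := weight_backward_down h (a := a) (d := y + w) (u := u) (by omega)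
    rwa [← hd] at this
  · exact racahPhi_four_term_size h.q_ne_zero (fun k h1 h2 => h.q_pow k h1 (by omega))
      (mul_ne_zero h.ne₄ h.ne₂) (h.free₂₄.congr (mul_comm _ _)) (h.free₁₂.congr (mul_comm _ _))
      h.free₂ (h.free₁₂₄.congr (by ring)) (by omega)

/-- Terms that lower `y` in the recurrence that lowers `i`. -/
theorem summand_lower_i_down (h : Generic q c₀ c₁ c₂ c₃ c₄ (N + 1)) {j a y w u : ℕ}
    (hN : N = a + y + (w + 1)) (hu : N = j + a + u) {x : ℕ} (hx : x ≤ a + (w + 1)) (P F : ℂ) :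
    sideFactor q c₃ (N + 1) j * sideFactor q c₄ (N + 1) (y + 1) *
      (baseWeight q c₁ c₂ (N + 1) a * sideWeight q (c₁ * c₂) c₃ a (u + 1) *
        sideWeight q (c₁ * c₂) c₄ a (w + 1) *
      ((1 - q * c₂ * q ^ a) * (1 - c₁ * c₂ * c₃ * q ^ (a + u + 3) * q ^ a) *
          (1 - (q ^ (a + u + 1))⁻¹ * q ^ a) * (1 - c₁ * c₂ * q ^ (a + 1)) /
          (q ^ a * (1 - c₁ * c₂ * q ^ (2 * a + 1)) * ((1 - q * c₂) *
            (1 - c₁ * c₂ * c₃ * q ^ (a + u + 3)) * (1 - (q ^ (a + u + 1))⁻¹))) * P) *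
      ((1 - q ^ (y + 1)) * (c₃ * c₀ * q ^ (y + 1 + 1) - (q ^ (y + (w + 1) + 1))⁻¹) /
          ((1 - (q ^ (y + (w + 1) + 1))⁻¹) * (1 - c₃ * c₀ * q ^ (2 * (y + 1) + 1))) * F) *
        racahPhi q c₄ c₂ c₁ (a + (w + 1)) a x +
      baseWeight q c₁ c₂ (N + 1) (a + 1) * sideWeight q (c₁ * c₂) c₃ (a + 1) u *
        sideWeight q (c₁ * c₂) c₄ (a + 1) w *
      ((1 - q ^ (a + 1)) * (c₁ * c₂ * q ^ (a + 1 + 1) - q * c₂) *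
          (c₁ * c₂ * q ^ (a + 1 + 1) - c₁ * c₂ * c₃ * q ^ (a + u + 3)) *
          (c₁ * c₂ * q ^ (a + 1 + 1) - (q ^ (a + u + 1))⁻¹) /
          (c₁ * c₂ * q ^ (a + 1 + 1) * (1 - c₁ * c₂ * q ^ (2 * (a + 1) + 1)) * ((1 - q * c₂) *
            (1 - c₁ * c₂ * c₃ * q ^ (a + u + 3)) * (1 - (q ^ (a + u + 1))⁻¹))) * P) *
      ((1 - q ^ (y + 1)) * (c₃ * c₀ * q ^ (y + 1 + 1) - c₃ * c₀ * c₄ * q ^ (y + (w + 1) + 2)) /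
          ((1 - c₃ * c₀ * c₄ * q ^ (y + (w + 1) + 2)) * (1 - c₃ * c₀ * q ^ (2 * (y + 1) + 1))) *
            F) *
        racahPhi q c₄ c₂ c₁ (a + (w + 1)) (a + 1) x) =
    stepCoeff₀₁ q c₂ c₀ c₄ c₃ N (y + 1) x * (sideFactor q (c₃ * q) N j * sideFactor q c₄ N y *
      (baseWeight q c₁ (c₂ * q) N a * sideWeight q (c₁ * c₂ * q) (c₃ * q) a u *
        sideWeight q (c₁ * c₂ * q) c₄ a (w + 1) * P * F *
          racahPhi q c₄ (c₂ * q) c₁ (a + (w + 1)) a x)) +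
    stepCoeff₁₁ q c₂ c₀ c₄ c₃ N (y + 1) x * (sideFactor q (c₃ * q) N j * sideFactor q c₄ N y *
      (baseWeight q c₁ (c₂ * q) N a * sideWeight q (c₁ * c₂ * q) (c₃ * q) a u *
        sideWeight q (c₁ * c₂ * q) c₄ a (w + 1) * P * F *
          racahPhi q c₄ (c₂ * q) c₁ (a + (w + 1)) a (x - 1))) := by
  have hd : N = a + (y + (w + 1)) := by omega
  rw [sideFactor_shift, sideFactor_succ_succ h.q_ne_zero]
  refine two_term_rearrange ?_ (sideWeight_shift₁ h.free₁₂ h.free₁₂₄ a (w + 1)) ?_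
    (sideWeight_raise_shift_succ h.free₄ a w (h.q_pow _ (by omega) (by omega)))
    (raise_down₀ h hN) (raise_down₁ h hN) ?_ (stepCoeff₀₁_swap h hN x) (stepCoeff₁₁_swap h hN x)
  · have := weight_backward_same h (a := a) (d := y + (w + 1)) (u := u) (by omega)
    rwa [← hd] at this
  · have := weight_backward_down h (a := a) (d := y + (w + 1)) (u := u) (by omega)
    rwa [← hd] at this
  · exact racahPhi_four_term_weight h.q_ne_zero (fun k h1 h2 => h.q_pow k h1 (by omega))
      (fun k h1 h2 => h.q_pow k h1 (by omega))
      (mul_ne_zero h.ne₄ h.ne₂) (h.free₂₄.congr (mul_comm _ _)) (h.free₁₂.congr (mul_comm _ _))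
      h.free₂ (h.free₁₂₄.congr (by ring)) (by omega) hx

/-- The boundary term that lowers `y` in the recurrence that lowers `i`. -/
theorem summand_lower_i_down_zero (h : Generic q c₀ c₁ c₂ c₃ c₄ (N + 1)) {j a y u : ℕ}
    (hN : N = a + y) (hu : N = j + a + u) {x : ℕ} (hx : x ≤ a) (P F : ℂ) :
    sideFactor q c₃ (N + 1) j * sideFactor q c₄ (N + 1) (y + 1) *
      (baseWeight q c₁ c₂ (N + 1) a * sideWeight q (c₁ * c₂) c₃ a (u + 1) *
        sideWeight q (c₁ * c₂) c₄ a 0 *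
      ((1 - q * c₂ * q ^ a) * (1 - c₁ * c₂ * c₃ * q ^ (a + u + 3) * q ^ a) *
          (1 - (q ^ (a + u + 1))⁻¹ * q ^ a) * (1 - c₁ * c₂ * q ^ (a + 1)) /
          (q ^ a * (1 - c₁ * c₂ * q ^ (2 * a + 1)) * ((1 - q * c₂) *
            (1 - c₁ * c₂ * c₃ * q ^ (a + u + 3)) * (1 - (q ^ (a + u + 1))⁻¹))) * P) *
      ((1 - q ^ (y + 1)) * (c₃ * c₀ * q ^ (y + 1 + 1) - (q ^ (y + 0 + 1))⁻¹) /
          ((1 - (q ^ (y + 0 + 1))⁻¹) * (1 - c₃ * c₀ * q ^ (2 * (y + 1) + 1))) * F) *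
        racahPhi q c₄ c₂ c₁ (a + 0) a x) =
    stepCoeff₀₁ q c₂ c₀ c₄ c₃ N (y + 1) x * (sideFactor q (c₃ * q) N j * sideFactor q c₄ N y *
      (baseWeight q c₁ (c₂ * q) N a * sideWeight q (c₁ * c₂ * q) (c₃ * q) a u *
        sideWeight q (c₁ * c₂ * q) c₄ a 0 * P * F *
          racahPhi q c₄ (c₂ * q) c₁ (a + 0) a x)) +
    stepCoeff₁₁ q c₂ c₀ c₄ c₃ N (y + 1) x * (sideFactor q (c₃ * q) N j * sideFactor q c₄ N y *
      (baseWeight q c₁ (c₂ * q) N a * sideWeight q (c₁ * c₂ * q) (c₃ * q) a u *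
        sideWeight q (c₁ * c₂ * q) c₄ a 0 * P * F *
          racahPhi q c₄ (c₂ * q) c₁ (a + 0) a (x - 1))) := by
  have hd : N = a + (y + 0) := by omega
  have hN' : N = a + y + 0 := by omega
  rw [sideFactor_shift, sideFactor_succ_succ h.q_ne_zero]
  refine two_term_rearrange_zero ?_ (sideWeight_shift₁ h.free₁₂ h.free₁₂₄ a 0)
    (raise_down₀ (w := 0) h hN') ?_ (racahPhi_four_term_weight h.q_ne_zero
      (fun k h1 h2 => h.q_pow k h1 (by omega)) (fun k h1 h2 => h.q_pow k h1 (by omega))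
      (mul_ne_zero h.ne₄ h.ne₂) (h.free₂₄.congr (mul_comm _ _)) (h.free₁₂.congr (mul_comm _ _))
      h.free₂ (h.free₁₂₄.congr (by ring)) le_rfl hx)
    (stepCoeff₀₁_swap (w := 0) h hN' x) (stepCoeff₁₁_swap (w := 0) h hN' x)
  · have := weight_backward_same h (a := a) (d := y + 0) (u := u) (by omega)
    rwa [← hd] at this
  -- The series has size and degree both equal to a here, so the coefficient of degree a + 1
  -- contains 1 - q^{-a}q^a = 0.
  · rw [inv_mul_cancel₀ (pow_ne_zero a h.q_ne_zero)]
    ring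

end

section

variable {q c₀ c₁ c₂ c₃ c₄ : ℂ} {N : ℕ}

theorem sum_range_add_shift (f g : ℕ → ℂ) (K : ℕ) (h0 : g 0 = 0) (hK : g K = 0) :
    ∑ a ∈ Finset.range K, (f a + g a) = ∑ a ∈ Finset.range K, (f a + g (a + 1)) := by
  have := Finset.sum_range_succ g K
  rw [Finset.sum_range_succ', h0, hK, add_zero, add_zero] at this
  rw [Finset.sum_add_distrib, Finset.sum_add_distrib, this]

/-- The coefficient of the same variable in `racahPhi_backward`. -/
def backCoeff₀ (q c₁ c₂ c₃ : ℂ) (M a : ℕ) : ℂ :=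
  (1 - q * c₂ * q ^ a) * (1 - c₁ * c₂ * c₃ * q ^ (M + 3) * q ^ a) *
    (1 - (q ^ (M + 1))⁻¹ * q ^ a) * (1 - c₁ * c₂ * q ^ (a + 1)) /
    (q ^ a * (1 - c₁ * c₂ * q ^ (2 * a + 1)) * ((1 - q * c₂) *
      (1 - c₁ * c₂ * c₃ * q ^ (M + 3)) * (1 - (q ^ (M + 1))⁻¹)))

/-- The coefficient of the lowered variable in `racahPhi_backward`. -/
def backCoeff₁ (q c₁ c₂ c₃ : ℂ) (M a : ℕ) : ℂ :=
  (1 - q ^ a) * (c₁ * c₂ * q ^ (a + 1) - q * c₂) *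
    (c₁ * c₂ * q ^ (a + 1) - c₁ * c₂ * c₃ * q ^ (M + 3)) *
    (c₁ * c₂ * q ^ (a + 1) - (q ^ (M + 1))⁻¹) /
    (c₁ * c₂ * q ^ (a + 1) * (1 - c₁ * c₂ * q ^ (2 * a + 1)) * ((1 - q * c₂) *
      (1 - c₁ * c₂ * c₃ * q ^ (M + 3)) * (1 - (q ^ (M + 1))⁻¹)))

/-- The summand without its first `q`-Racah factor. -/
def summandRest (q c₀ c₁ c₂ c₃ c₄ : ℂ) (N j x y a : ℕ) : ℂ :=
  baseWeight q c₁ c₂ N a * sideWeight q (c₁ * c₂) c₃ a (N - j - a) *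
    sideWeight q (c₁ * c₂) c₄ a (N - y - a) * racahPhi q c₃ c₀ c₄ (N - a) j y *
    racahPhi q c₄ c₂ c₁ (N - y) a x

theorem split_rearrange {R : Type*} [CommRing R]
    (H W s t α F α' F' G b P W' s' t' β β' G' b' : R) :
    H * (W * s * t * (α * F + α' * F') * G * (b * P)) +
        H * (W' * s' * t' * (β * F + β' * F') * G' * (b' * P)) =
      H * (W * s * t * (b * P) * (α * F) * G + W' * s' * t' * (b' * P) * (β * F) * G') +
        H * (W * s * t * (b * P) * (α' * F') * G + W' * s' * t' * (b' * P) * (β' * F') * G') := by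
  ring

/-- The recurrence that lowers `i`. -/
theorem normGriffiths_lower_i (h : Generic q c₀ c₁ c₂ c₃ c₄ (N + 1)) {i j x y : ℕ}
    (hij : i + j ≤ N) (hxy : x + y ≤ N + 1) :
    normGriffiths q c₀ c₁ c₂ c₃ c₄ (N + 1) (i + 1) j x y =
      stepCoeff₀₀ q c₂ c₀ c₄ c₃ N y x *
          normGriffiths q c₀ c₁ (c₂ * q) (c₃ * q) c₄ N i j x y +
        stepCoeff₀₁ q c₂ c₀ c₄ c₃ N y x *
          normGriffiths q c₀ c₁ (c₂ * q) (c₃ * q) c₄ N i j x (y - 1) +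
        (stepCoeff₁₀ q c₂ c₀ c₄ c₃ N y x *
          normGriffiths q c₀ c₁ (c₂ * q) (c₃ * q) c₄ N i j (x - 1) y +
        stepCoeff₁₁ q c₂ c₀ c₄ c₃ N y x *
          normGriffiths q c₀ c₁ (c₂ * q) (c₃ * q) c₄ N i j (x - 1) (y - 1)) := by
  have hq := h.q_ne_zero
  have hp : ∀ k, q ^ k ≠ 0 := fun k => pow_ne_zero k hq
  simp only [normGriffiths_eq_sum (K := N + 2) _ _ _ _ _ _ (N + 1) _ _ _ _ le_rfl,
    normGriffiths_eq_sum (K := N + 2) _ _ _ _ _ _ N _ _ _ _ (Nat.le_succ _)]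
  simp only [Finset.mul_sum, ← Finset.sum_add_distrib]
  have hΦ : ∀ a, racahPhi q c₁ c₂ c₃ (N + 1 - j) (i + 1) a =
      backCoeff₀ q c₁ c₂ c₃ (N - j) a * racahPhi q c₁ (c₂ * q) (c₃ * q) (N - j) i a +
      backCoeff₁ q c₁ c₂ c₃ (N - j) a *
        racahPhi q c₁ (c₂ * q) (c₃ * q) (N - j) i (a - 1) := fun a => by
    rw [show N + 1 - j = N - j + 1 by omega]
    exact racahPhi_backward hq (fun k h1 h2 => h.q_pow k h1 (by omega))
      (mul_ne_zero h.ne₁ h.ne₂) h.free₁₂ h.free₂ h.free₁₂₃ (by omega)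
  let f : ℕ → ℂ := fun a => if a + j ≤ N + 1 ∧ a + y ≤ N + 1 then
    sideFactor q c₃ (N + 1) j * sideFactor q c₄ (N + 1) y *
      (summandRest q c₀ c₁ c₂ c₃ c₄ (N + 1) j x y a * (backCoeff₀ q c₁ c₂ c₃ (N - j) a *
        racahPhi q c₁ (c₂ * q) (c₃ * q) (N - j) i a)) else 0
  let g : ℕ → ℂ := fun a => if a + j ≤ N + 1 ∧ a + y ≤ N + 1 then
    sideFactor q c₃ (N + 1) j * sideFactor q c₄ (N + 1) y *
      (summandRest q c₀ c₁ c₂ c₃ c₄ (N + 1) j x y a * (backCoeff₁ q c₁ c₂ c₃ (N - j) a *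
        racahPhi q c₁ (c₂ * q) (c₃ * q) (N - j) i (a - 1))) else 0
  have hfg : ∀ a, (if a + j ≤ N + 1 ∧ a + y ≤ N + 1 then
      sideFactor q c₃ (N + 1) j * sideFactor q c₄ (N + 1) y *
        summand q c₀ c₁ c₂ c₃ c₄ (N + 1) (i + 1) j x y a else 0) = f a + g a := fun a => by
    simp only [f, g]
    split_ifs
    · rw [summand, hΦ, summandRest]; ring
    · rw [add_zero]
  simp only [hfg]
  -- The backward shift yields the first series at a and at a - 1. Moving the second family by one
  -- makes this series the same in both and leaves the last series with the neighbouring degrees a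
  -- and a + 1.
  rw [sum_range_add_shift f g _ (by simp [g, backCoeff₁]) (if_neg (by omega))]
  refine Finset.sum_congr rfl fun a _ => ?_
  by_cases haj : a + j ≤ N
  swap
  · have hf : f a = 0 := by
      simp only [f]
      split_ifs with hc
      -- Here a + j = N + 1, the size of the first series is N + 1 - j = a, and the factor 1 -
      -- q^{-a}q^a is zero.
      · rw [backCoeff₀, show N - j + 1 = a by omega, inv_mul_cancel₀ (hp a)]; ring
      · rfl
    have hg : g (a + 1) = 0 := if_neg (by omega)
    rw [hf, hg, if_neg (by omega), if_neg (by omega), if_neg (by omega), if_neg (by omega)]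
    ring
  by_cases hay : a + y ≤ N + 1
  swap
  · have hf : f a = 0 := if_neg (by omega)
    have hg : g (a + 1) = 0 := if_neg (by omega)
    rw [hf, hg, if_neg (by omega), if_neg (by omega), if_neg (by omega), if_neg (by omega)]
    ring
  have hf : f a = sideFactor q c₃ (N + 1) j * sideFactor q c₄ (N + 1) y *
      (summandRest q c₀ c₁ c₂ c₃ c₄ (N + 1) j x y a * (backCoeff₀ q c₁ c₂ c₃ (N - j) a *
        racahPhi q c₁ (c₂ * q) (c₃ * q) (N - j) i a)) := if_pos ⟨by omega, hay⟩
  obtain ⟨u, hu⟩ := Nat.exists_eq_add_of_le (show j + a ≤ N by omega)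
  have i1 : N - j = a + u := by omega
  have i2 : N + 1 - j - a = u + 1 := by omega
  have i3 : N + 1 - j - (a + 1) = u := by omega
  have i4 : N - j - a = u := by omega
  have i5 : c₁ * (c₂ * q) = c₁ * c₂ * q := by ring
  -- The middle series has size N + 1 - a at a but N - a at a + 1. The first is lowered by the size
  -- shift, the second only has c₃ raised, and both end in the series with c₃q and size N - a, at y
  -- and y - 1.
  have hΨ := racahPhi_shift_size (b₁ := c₃) (b₂ := c₀) (b₃ := c₄) (M := N - a) (n := j) (x := y)
    hq (fun k h1 h2 => h.q_pow k h1 (by omega)) (h.free₀₃.congr (mul_comm _ _)) (by omega)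
  have hΨ' := racahPhi_shift_weight (b₁ := c₃) (b₂ := c₀) (b₃ := c₄) (M := N - a) (n := j)
    (x := y) hq (h.free₀₃.congr (mul_comm _ _)) h.free₀₃₄
  rw [show N - a + 1 = N + 1 - a by omega] at hΨ
  rcases hay.lt_or_eq with hay' | hay'
  · obtain ⟨w, hw⟩ := Nat.exists_eq_add_of_le (Nat.lt_succ_iff.mp hay')
    have hg : g (a + 1) = sideFactor q c₃ (N + 1) j * sideFactor q c₄ (N + 1) y *
        (summandRest q c₀ c₁ c₂ c₃ c₄ (N + 1) j x y (a + 1) *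
          (backCoeff₁ q c₁ c₂ c₃ (N - j) (a + 1) *
            racahPhi q c₁ (c₂ * q) (c₃ * q) (N - j) i (a + 1 - 1))) :=
      if_pos ⟨by omega, by omega⟩
    have hS := summand_lower_i_same h hw hu x (racahPhi q c₁ (c₂ * q) (c₃ * q) (N - j) i a)
      (racahPhi q (c₃ * q) c₀ c₄ (N - a) j y)
    rw [i1] at hS
    have k1 : N + 1 - y - a = w + 1 := by omega
    have k2 : N + 1 - y = a + w + 1 := by omega
    have k3 : N + 1 - y - (a + 1) = w := by omega
    have k4 : N - y = a + w := by omega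
    rw [show N + 1 - a = y + w + 1 by omega] at hΨ
    rw [show q ^ (N - a + 2) = q ^ (y + w + 2) by congr 1; omega] at hΨ'
    rw [hf, hg, summandRest, summandRest, i2, i3, k1, k3, k2, Nat.add_sub_cancel,
      show N + 1 - (a + 1) = N - a by omega, show N + 1 - a = y + w + 1 by omega, hΨ, hΨ',
      backCoeff₀, backCoeff₁, i1, split_rearrange, hS, add_add_add_comm]
    congr 1
    · rw [if_pos ⟨haj, by omega⟩, if_pos ⟨haj, by omega⟩]
      simp only [summand, i1, i5, k4, Nat.add_sub_cancel_left]
    rcases y with _ | y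
    · simp [stepCoeff₀₁, stepCoeff₁₁]
    · have hD := summand_lower_i_down h (y := y) (w := w) (by omega) hu (x := x) (by omega)
        (racahPhi q c₁ (c₂ * q) (c₃ * q) (N - j) i a) (racahPhi q (c₃ * q) c₀ c₄ (N - a) j y)
      rw [i1, show y + (w + 1) = y + 1 + w by ring, ← add_assoc a w 1] at hD
      rw [Nat.add_sub_cancel, hD, if_pos ⟨haj, by omega⟩, if_pos ⟨haj, by omega⟩]
      simp only [summand, i1, i5, show N - y = a + (w + 1) by omega, Nat.add_sub_cancel_left]
      rfl
  -- On the edge a + y = N + 1 only the term at a exists, and its part that keeps y has coefficient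
  -- zero; y is positive because a ≤ N.
  · have hg : g (a + 1) = 0 := if_neg (by omega)
    obtain ⟨y, rfl⟩ : ∃ z, y = z + 1 := ⟨y - 1, by omega⟩
    have hD := summand_lower_i_down_zero h (a := a) (y := y) (by omega) hu (x := x) (by omega)
      (racahPhi q c₁ (c₂ * q) (c₃ * q) (N - j) i a) (racahPhi q (c₃ * q) c₀ c₄ (N - a) j y)
    rw [hf, hg, if_neg (by omega), if_pos ⟨haj, by omega⟩, if_neg (by omega),
      if_pos ⟨haj, by omega⟩, Nat.add_sub_cancel]
    rw [summand, summand, i4, i5, show N - y - a = 0 by omega, show N - y = a + 0 by omega,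
      mul_zero, mul_zero, zero_add, zero_add, add_zero, ← hD, summandRest, i2,
      show N + 1 - (y + 1) - a = 0 by omega, show N + 1 - (y + 1) = a + 0 by omega, hΨ, backCoeff₀,
      show N + 1 - a = y + 0 + 1 by omega, i1]
    rw [inv_mul_cancel₀ (hp (y + 0 + 1)), Nat.add_sub_cancel]
    ring

end

/-! ### Vanishing degrees and variables: creative telescoping. -/

section

/-- The summand of the normalized Griffiths polynomial with vanishing degrees and variables. -/
def baseTerm (q c₁ c₂ c₃ c₄ : ℂ) (N a : ℕ) : ℂ :=
  baseWeight q c₁ c₂ N a * sideWeight q (c₁ * c₂) c₃ a (N - a) *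
    sideWeight q (c₁ * c₂) c₄ a (N - a)

/-- The coefficient in the recurrence for vanishing degrees and variables. -/
def baseCoeff (q c₀ c₁ c₂ c₃ c₄ : ℂ) (N : ℕ) : ℂ :=
  (1 - q ^ (N + 1)) * (1 - q * c₃) * (1 - c₂ * c₄ * q ^ (N + 2)) * (1 - c₀ * c₄ * q ^ (N + 2)) /
    (c₀ * c₂ * q ^ (N + 3) * (c₃ - c₄) * (1 - q * c₁))

theorem baseTerm_comm (q c₁ c₂ c₃ c₄ : ℂ) (N a : ℕ) :
    baseTerm q c₁ c₂ c₃ c₄ N a = baseTerm q c₁ c₂ c₄ c₃ N a := by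
  simp only [baseTerm]
  ring

/-- The symmetry in c₀ and c₂ is what transports the recurrence to the other side. It is visible
only because c₀ has been kept in the formula although the constraint determines it. -/
theorem baseCoeff_swap (q c₀ c₁ c₂ c₃ c₄ : ℂ) (N : ℕ) :
    baseCoeff q c₀ c₁ c₂ c₃ c₄ N = baseCoeff q c₂ c₁ c₀ c₃ c₄ N := by
  simp only [baseCoeff]
  congr 1 <;> ring

/-- The telescoping relation with denominators cleared, for z = q^a and w = q^{N+1-a}, so that zw =
q^{N+1}. The products with c₄ and c₃ in front come from the two shifted terms, the right side from
the certificate at a + 1 and at a. -/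
theorem telescoping_identity (q c₁ c₂ c₃ c₄ z w : ℂ) :
    -(q * c₂ * (c₃ - c₄) * (1 - z * w)) *
        ((1 - c₁ * c₂ * q * z ^ 2) * (1 - c₁ * q * z) * (1 - c₃ * w) * (1 - c₄ * w)) -
      c₄ * (1 - c₂ * c₄ * q * (z * w)) * ((1 - c₁ * c₂ * q * z) * (1 - c₁ * c₂ * q ^ 2 * z ^ 2) *
        (1 - w) * (1 - c₁ * c₂ * c₃ * q ^ 2 * z ^ 2 * w) * (1 - c₃ * w)) +
      c₃ * (1 - c₂ * c₃ * q * (z * w)) * ((1 - c₁ * c₂ * q * z) * (1 - c₁ * c₂ * q ^ 2 * z ^ 2) *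
        (1 - w) * (1 - c₁ * c₂ * c₄ * q ^ 2 * z ^ 2 * w) * (1 - c₄ * w)) =
    (c₃ - c₄) * ((1 - c₁ * c₂ * q * z) * (1 - c₂ * q * z) * (1 - w) *
        (1 - c₁ * c₂ * c₃ * q ^ 2 * z ^ 2 * w) * (1 - c₁ * c₂ * c₄ * q ^ 2 * z ^ 2 * w)) -
      q * c₂ * (c₃ - c₄) * ((1 - z) * (1 - c₁ * c₂ * q * z ^ 2 * w) * (1 - c₁ * q * z) *
        (1 - c₃ * w) * (1 - c₄ * w)) := by
  ring

variable {q c₀ c₁ c₂ c₃ c₄ : ℂ} {N : ℕ}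

theorem baseWeight_shift₁ (hv : Free q (c₁ * c₂)) (h1 : Free q c₁) (a d : ℕ) :
    baseWeight q c₁ c₂ (a + d + 1) a =
      (1 - q ^ (d + 1)) * (1 - c₁ * c₂ * q) * ((1 - c₁ * c₂ * q) / (1 - c₁ * c₂ * q ^ (a + 1))) *
        ((1 - c₁ * c₂ * q ^ (2 * a + 1)) / (1 - c₁ * c₂ * q ^ (2 * a + 2))) *
        ((1 - c₁ * q ^ (a + 1)) / (1 - q * c₁)) *
        baseWeight q (c₁ * q) c₂ (a + d) a := by
  have e1 : c₁ * c₂ * q * q ^ a = c₁ * c₂ * q ^ (a + 1) := by ring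
  have e2 : q * c₁ * q ^ a = c₁ * q ^ (a + 1) := by ring
  have n1 : 1 - c₁ * c₂ * q * q ^ a ≠ 0 := e1 ▸ hv.ne (a + 1)
  have n2 : 1 - q * c₁ * q ^ a ≠ 0 := e2 ▸ h1.ne (a + 1)
  have n3 := hv.ne (2 * a + 2)
  simp only [baseWeight]
  rw [show a + d + 1 - a = d + 1 by omega, show a + d - a = d by omega,
    show a + d + 1 + a + 1 = (a + d + a + 1) + 1 by ring, qPoch_succ q q,
    qPoch_succ' (c₁ * c₂ * q) q (a + d + a + 1), qPoch_eq_shift n1, qPoch_eq_shift n2, e1, e2,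
    show c₁ * q * c₂ * q = c₁ * c₂ * q * q by ring, show q * (c₁ * q) = q * c₁ * q by ring,
    show c₁ * q * c₂ * q ^ (2 * a + 1) = c₁ * c₂ * q ^ (2 * a + 2) by ring,
    show q * q ^ d = q ^ (d + 1) by ring]
  generalize 1 - c₁ * c₂ * q ^ (2 * a + 2) = d₁ at *
  generalize (q * c₂) ^ a = P₃
  simp only [div_eq_mul_inv, mul_inv, inv_inv]
  have key : ∀ X : ℂ, X = X * (d₁ * d₁⁻¹) := fun X => by rw [mul_inv_cancel₀ n3, mul_one]
  refine (key _).trans ?_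
  generalize d₁⁻¹ = d₁', P₃⁻¹ = P₃', (qPoch q q a)⁻¹ = P₄, (qPoch (q * c₁ * q) q a)⁻¹ = P₅,
    (1 - c₁ * c₂ * q ^ (a + 1))⁻¹ = d₂, (1 - q * c₁)⁻¹ = d₃
  generalize 1 - c₁ * q ^ (a + 1) = d₄, 1 - c₁ * c₂ * q ^ (2 * a + 1) = d₅, 1 - q ^ (d + 1) = d₆,
    1 - c₁ * c₂ * q = d₇
  ring

theorem baseWeight_succ_succ (hv : Free q (c₁ * c₂)) (a d : ℕ) (hd : 1 - q ^ (d + 1) ≠ 0) :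
    baseWeight q c₁ c₂ (a + d + 1) (a + 1) =
      (1 - c₁ * c₂ * q ^ (2 * a + d + 3)) * (1 - c₁ * c₂ * q ^ (a + 1)) *
        (1 - c₁ * c₂ * q ^ (2 * a + 3)) * (1 - c₂ * q ^ (a + 1)) /
      ((1 - q ^ (d + 1)) * (1 - c₁ * c₂ * q ^ (2 * a + 1)) * (1 - q ^ (a + 1)) *
        (1 - c₁ * q ^ (a + 1)) * (q * c₂)) * baseWeight q c₁ c₂ (a + d + 1) a := by
  have n3 := hv.ne (2 * a + 1)
  simp only [baseWeight]
  rw [show a + d + 1 - (a + 1) = d by omega, show a + d + 1 - a = d + 1 by omega,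
    show a + d + 1 + (a + 1) + 1 = (2 * a + d + 2) + 1 by ring,
    show a + d + 1 + a + 1 = 2 * a + d + 2 by ring,
    qPoch_succ (c₁ * c₂ * q) q (2 * a + d + 2), qPoch_succ (c₁ * c₂ * q) q a,
    qPoch_succ (q * c₂) q a, qPoch_succ q q, qPoch_succ q q, qPoch_succ (q * c₁),
    show c₁ * c₂ * q * q ^ (2 * a + d + 2) = c₁ * c₂ * q ^ (2 * a + d + 3) by ring,
    show c₁ * c₂ * q * q ^ a = c₁ * c₂ * q ^ (a + 1) by ring,
    show c₁ * c₂ * q ^ (2 * (a + 1) + 1) = c₁ * c₂ * q ^ (2 * a + 3) by ring,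
    show q * c₁ * q ^ a = c₁ * q ^ (a + 1) by ring, pow_succ (q * c₂),
    show q * c₂ * q ^ a = c₂ * q ^ (a + 1) by ring,
    show q * q ^ a = q ^ (a + 1) by ring, show q * q ^ d = q ^ (d + 1) by ring]
  generalize 1 - c₁ * c₂ * q ^ (2 * a + 1) = d₁ at *
  generalize 1 - q ^ (d + 1) = d₂ at *
  generalize (q * c₂) ^ a = P₃
  generalize q * c₂ = P₆
  simp only [div_eq_mul_inv, mul_inv]
  have key : ∀ X : ℂ, X = X * (d₁ * d₁⁻¹) * (d₂ * d₂⁻¹) := fun X => by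
    rw [mul_inv_cancel₀ n3, mul_inv_cancel₀ hd, mul_one, mul_one]
  refine (key _).trans ?_
  generalize d₁⁻¹ = d₁', d₂⁻¹ = d₂', P₃⁻¹ = P₃', (qPoch q q a)⁻¹ = P₄,
    (qPoch (q * c₁) q a)⁻¹ = P₅, P₆⁻¹ = P₆',
    (1 - c₁ * q ^ (a + 1))⁻¹ = d₃, (1 - q ^ (a + 1))⁻¹ = d₄
  generalize 1 - c₁ * c₂ * q ^ (2 * a + d + 3) = d₅, 1 - c₁ * c₂ * q ^ (a + 1) = d₆,
    1 - c₁ * c₂ * q ^ (2 * a + 3) = d₇, 1 - c₂ * q ^ (a + 1) = d₈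
  ring

theorem sideWeight_raise {v c : ℂ} (hc : Free q c) (a d : ℕ) (hd : 1 - q ^ (d + 1) ≠ 0) :
    sideWeight q v c (a + 1) d = (1 - q ^ (d + 1)) * (1 - v * c * q ^ (2 * a + d + 3)) /
      ((1 - c * q ^ (d + 1)) * (1 - v * q ^ (2 * a + d + 3))) * sideWeight q v c a (d + 1) := by
  have n := hc.ne (d + 1)
  simp only [sideWeight]
  rw [show a + 1 + d = a + d + 1 by ring, ← add_assoc a d 1,
    show 2 * (a + 1) + d + 1 = (2 * a + d + 2) + 1 by ring,
    show 2 * a + (d + 1) + 1 = 2 * a + d + 2 by ring, qPoch_succ (v * q),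
    show v * c * q ^ (a + d + 1 + 2) = v * c * q ^ (a + d + 3) by ring, qPoch_succ _ q a,
    qPoch_succ q q d, qPoch_succ (q * c),
    show v * c * q ^ (a + d + 3) * q ^ a = v * c * q ^ (2 * a + d + 3) by ring,
    show q * c * q ^ d = c * q ^ (d + 1) by ring, show q * q ^ d = q ^ (d + 1) by ring,
    show v * q * q ^ (2 * a + d + 2) = v * q ^ (2 * a + d + 3) by ring]
  generalize 1 - c * q ^ (d + 1) = d₁ at *
  generalize 1 - q ^ (d + 1) = d₂ at *
  simp only [div_eq_mul_inv, mul_inv]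
  have key : ∀ X : ℂ, X = X * (d₁ * d₁⁻¹) * (d₂ * d₂⁻¹) := fun X => by
    rw [mul_inv_cancel₀ n, mul_inv_cancel₀ hd, mul_one, mul_one]
  refine (key _).trans ?_
  generalize d₁⁻¹ = d₁', d₂⁻¹ = d₂', (qPoch q q d)⁻¹ = P₄,
    (qPoch (v * q) q (2 * a + d + 2))⁻¹ = P₅, (1 - v * q ^ (2 * a + d + 3))⁻¹ = P₆
  ring

end

section

theorem telescoping_quotient {q c₁ c₂ c₃ c₄ z w : ℂ} (h0 : q * c₂ ≠ 0) (h34 : c₃ - c₄ ≠ 0)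
    (hzw : 1 - z * w ≠ 0) (h1 : 1 - c₁ * c₂ * q * z ^ 2 ≠ 0) (h2 : 1 - c₁ * q * z ≠ 0)
    (h3 : 1 - c₃ * w ≠ 0) (h4 : 1 - c₄ * w ≠ 0) :
    1 = -(c₄ * (1 - c₂ * c₄ * q * (z * w)) * ((1 - c₁ * c₂ * q * z) *
          (1 - c₁ * c₂ * q ^ 2 * z ^ 2) * (1 - w) * (1 - c₁ * c₂ * c₃ * q ^ 2 * z ^ 2 * w)) /
        (q * c₂ * (c₃ - c₄) * (1 - z * w) * ((1 - c₁ * c₂ * q * z ^ 2) * (1 - c₁ * q * z) *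
          (1 - c₄ * w)))) +
      -(c₃ * (1 - c₂ * c₃ * q * (z * w)) * ((1 - c₁ * c₂ * q * z) *
          (1 - c₁ * c₂ * q ^ 2 * z ^ 2) * (1 - w) * (1 - c₁ * c₂ * c₄ * q ^ 2 * z ^ 2 * w)) /
        (q * c₂ * (c₄ - c₃) * (1 - z * w) * ((1 - c₁ * c₂ * q * z ^ 2) * (1 - c₁ * q * z) *
          (1 - c₃ * w)))) +
      (-((1 - c₁ * c₂ * q * z) * (1 - c₂ * q * z) * (1 - w) *
        (1 - c₁ * c₂ * c₃ * q ^ 2 * z ^ 2 * w) * (1 - c₁ * c₂ * c₄ * q ^ 2 * z ^ 2 * w) /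
        (q * c₂ * (1 - z * w) * ((1 - c₁ * c₂ * q * z ^ 2) * (1 - c₁ * q * z) *
          (1 - c₃ * w) * (1 - c₄ * w)))) -
      -((1 - z) * (1 - c₁ * c₂ * q * z ^ 2 * w) /
        ((1 - z * w) * (1 - c₁ * c₂ * q * z ^ 2)))) := by
  have key := telescoping_identity q c₁ c₂ c₃ c₄ z w
  rw [show c₄ - c₃ = -(c₃ - c₄) by ring]
  generalize 1 - c₁ * c₂ * q * z ^ 2 = d₁ at *
  generalize 1 - c₁ * q * z = d₂ at *
  generalize 1 - c₃ * w = d₃ at *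
  generalize 1 - c₄ * w = d₄ at *
  generalize 1 - z * w = d₅ at *
  generalize c₃ - c₄ = d₆ at *
  generalize q * c₂ = t at *
  generalize 1 - c₁ * c₂ * q * z = e₁ at *
  generalize 1 - c₁ * c₂ * q ^ 2 * z ^ 2 = e₂ at *
  generalize 1 - w = e₃ at *
  generalize 1 - c₁ * c₂ * c₃ * q ^ 2 * z ^ 2 * w = e₄ at *
  generalize 1 - c₁ * c₂ * c₄ * q ^ 2 * z ^ 2 * w = e₅ at *
  generalize c₄ * (1 - c₂ * c₄ * q * (z * w)) = e₆ at *
  generalize c₃ * (1 - c₂ * c₃ * q * (z * w)) = e₇ at *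
  generalize 1 - c₂ * q * z = e₈ at *
  generalize 1 - z = e₉ at *
  generalize 1 - c₁ * c₂ * q * z ^ 2 * w = f₁ at *
  field_simp
  linear_combination (-1) * key

variable {q c₀ c₁ c₂ c₃ c₄ : ℂ} {N : ℕ}

/-- The coefficient `baseCoeff` has c₃ - c₄ in its denominator. The stronger requirement that c₃/c₄
be no power of q survives the shifts in the induction. -/
theorem Generic.sub₃₄ (h : Generic q c₀ c₁ c₂ c₃ c₄ N) : c₃ - c₄ ≠ 0 := by
  intro h0
  refine h.free₃₄ 0 ?_
  rw [sub_eq_zero.mp h0, div_self h.ne₄]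
  simp

/-- The shifted term is a rational multiple of the unshifted one. The parameter c₀ drops out, since
1 - c₀c₄q^{N+2} is by the constraint proportional to 1 - c₁c₂c₃q^{N+3}. -/
theorem baseCoeff_mul_baseTerm (h : Generic q c₀ c₁ c₂ c₃ c₄ (N + 1)) {a d : ℕ}
    (hN : N = a + d) :
    baseCoeff q c₀ c₁ c₂ c₃ c₄ N * baseTerm q (c₁ * q) c₂ (c₃ * q) c₄ N a =
      -(c₄ * (1 - c₂ * c₄ * q ^ (N + 2)) * ((1 - c₁ * c₂ * q ^ (a + 1)) *
          (1 - c₁ * c₂ * q ^ (2 * a + 2)) * (1 - q ^ (d + 1)) *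
          (1 - c₁ * c₂ * c₃ * q ^ (a + d + 3) * q ^ a)) /
        (q * c₂ * (c₃ - c₄) * (1 - q ^ (N + 1)) * ((1 - c₁ * c₂ * q ^ (2 * a + 1)) *
          (1 - c₁ * q ^ (a + 1)) * (1 - c₄ * q ^ (d + 1))))) *
        baseTerm q c₁ c₂ c₃ c₄ (N + 1) a := by
  subst hN
  have hq := h.q_ne_zero
  have hp : ∀ k, q ^ k ≠ 0 := fun k => pow_ne_zero k hq
  have hT0 : c₀ * c₄ * q ^ (a + d + 2) ≠ 0 := mul_ne_zero (mul_ne_zero h.ne₀ h.ne₄) (hp _)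
  have hT : c₁ * c₂ * c₃ * q ^ (a + d + 3) = (c₀ * c₄ * q ^ (a + d + 2))⁻¹ := by
    refine eq_inv_of_mul_eq_one_left ?_
    rw [← h.constraint]
    ring
  have hs : 1 - c₁ * c₂ * c₃ * q ^ (a + d + 3) =
      -(c₀ * c₄ * q ^ (a + d + 2))⁻¹ * (1 - c₀ * c₄ * q ^ (a + d + 2)) := by
    rw [hT]; exact one_sub_inv hT0
  have n1 := h.free₁₂.ne (a + 1)
  have n2 := h.free₁₂.ne (2 * a + 2)
  have n3 := h.free₁₂.ne (2 * a + 1)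
  have n4 := h.free₁.ne (a + 1)
  have n5 := h.free₄.ne (d + 1)
  have n6 : 1 - q * c₁ ≠ 0 := by simpa [mul_comm] using h.free₁.ne 1
  have n7 : 1 - q * c₃ ≠ 0 := by simpa [mul_comm] using h.free₃.ne 1
  have n8 : 1 - q ^ (d + 1) ≠ 0 := h.q_pow _ (by omega) (by omega)
  have n9 : 1 - q ^ (a + d + 1) ≠ 0 := h.q_pow _ (by omega) (by omega)
  have n10 : 1 - c₁ * c₂ * q ≠ 0 := by simpa using h.free₁₂.ne 1
  have n11 := (h.free₁₂₃.mul_pow hq (a + d + 3)).ne a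
  have n12 := h.free₀₄.ne (a + d + 2)
  have n13 := h.sub₃₄
  have m0 := h.ne₀
  have m2 := h.ne₂
  have m4 := h.ne₄
  have m5 := hp (a + d + 2)
  have hb : baseCoeff q c₀ c₁ c₂ c₃ c₄ (a + d) = (1 - q ^ (a + d + 1)) * (1 - q * c₃) *
      (1 - c₂ * c₄ * q ^ (a + d + 2)) * (1 - c₀ * c₄ * q ^ (a + d + 2)) /
      (c₀ * c₂ * (q * q ^ (a + d + 2)) * (c₃ - c₄) * (1 - q * c₁)) := by
    rw [baseCoeff, ← pow_succ']
  rw [hb, baseTerm, baseTerm, show a + d - a = d by omega,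
    show a + d + 1 - a = d + 1 by omega, baseWeight_shift₁ h.free₁₂ h.free₁,
    sideWeight_succ_shift₂ hq h.free₁₂₃, sideWeight_succ_shift₁,
    show c₁ * q * c₂ = c₁ * c₂ * q by ring, hs]
  generalize baseWeight q (c₁ * q) c₂ (a + d) a = B
  generalize sideWeight q (c₁ * c₂ * q) (c₃ * q) a d = S
  generalize sideWeight q (c₁ * c₂ * q) c₄ a d = S'
  generalize 1 - c₁ * c₂ * c₃ * q ^ (a + d + 3) * q ^ a = d₁ at *
  generalize 1 - c₁ * c₂ * q ^ (a + 1) = d₂ at *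
  generalize 1 - c₁ * c₂ * q ^ (2 * a + 2) = d₃ at *
  generalize 1 - c₁ * c₂ * q ^ (2 * a + 1) = d₄ at *
  generalize 1 - c₁ * q ^ (a + 1) = d₅ at *
  generalize 1 - c₄ * q ^ (d + 1) = d₆ at *
  generalize 1 - q * c₁ = d₇ at *
  generalize 1 - q * c₃ = d₈ at *
  generalize 1 - q ^ (d + 1) = d₉ at *
  generalize 1 - q ^ (a + d + 1) = f₁ at *
  generalize 1 - c₁ * c₂ * q = f₂ at *
  generalize 1 - c₀ * c₄ * q ^ (a + d + 2) = f₃ at *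
  generalize 1 - c₂ * c₄ * q ^ (a + d + 2) = f₄ at *
  generalize c₃ - c₄ = f₅ at *
  generalize q ^ (a + d + 2) = t at *
  field_simp

/-- The certificate for `normGriffiths_base_step`. -/
def baseCert (q c₁ c₂ c₃ c₄ : ℂ) (N a : ℕ) : ℂ :=
  -((1 - q ^ a) * (1 - c₁ * c₂ * q ^ (N + a + 2)) /
    ((1 - q ^ (N + 1)) * (1 - c₁ * c₂ * q ^ (2 * a + 1)))) * baseTerm q c₁ c₂ c₃ c₄ (N + 1) a

theorem baseCert_succ (h : Generic q c₀ c₁ c₂ c₃ c₄ (N + 1)) {a d : ℕ}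
    (hN : N = a + d) :
    baseCert q c₁ c₂ c₃ c₄ N (a + 1) =
      -((1 - c₁ * c₂ * q ^ (a + 1)) * (1 - c₂ * q ^ (a + 1)) * (1 - q ^ (d + 1)) *
        (1 - c₁ * c₂ * c₃ * q ^ (2 * a + d + 3)) * (1 - c₁ * c₂ * c₄ * q ^ (2 * a + d + 3)) /
        (q * c₂ * (1 - q ^ (N + 1)) * ((1 - c₁ * c₂ * q ^ (2 * a + 1)) * (1 - c₁ * q ^ (a + 1)) *
          (1 - c₃ * q ^ (d + 1)) * (1 - c₄ * q ^ (d + 1))))) *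
        baseTerm q c₁ c₂ c₃ c₄ (N + 1) a := by
  subst hN
  have hd : 1 - q ^ (d + 1) ≠ 0 := h.q_pow _ (by omega) (by omega)
  have n1 := h.free₁₂.ne (2 * a + d + 3)
  have n2 := h.free₁₂.ne (2 * a + 3)
  have n3 : 1 - q ^ (a + 1) ≠ 0 := h.q_pow _ (by omega) (by omega)
  rw [baseCert, baseTerm, baseTerm, show a + d + 1 - a = d + 1 by omega,
    show a + d + 1 - (a + 1) = d by omega, baseWeight_succ_succ h.free₁₂ a d hd,
    sideWeight_raise h.free₃ a d hd, sideWeight_raise h.free₄ a d hd,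
    show a + d + (a + 1) + 2 = 2 * a + d + 3 by ring, show 2 * (a + 1) + 1 = 2 * a + 3 by ring]
  generalize baseWeight q c₁ c₂ (a + d + 1) a = B
  generalize sideWeight q (c₁ * c₂) c₃ a (d + 1) = S
  generalize sideWeight q (c₁ * c₂) c₄ a (d + 1) = S'
  generalize 1 - c₁ * c₂ * q ^ (2 * a + d + 3) = d₁ at *
  generalize 1 - c₁ * c₂ * q ^ (2 * a + 3) = d₂ at *
  generalize 1 - q ^ (a + 1) = d₃ at *
  generalize 1 - q ^ (d + 1) = d₄ at *
  generalize q * c₂ = t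
  simp only [div_eq_mul_inv, mul_inv]
  generalize (1 - c₁ * c₂ * q ^ (2 * a + 1))⁻¹ = e₁, (1 - c₁ * q ^ (a + 1))⁻¹ = e₂,
    (1 - c₃ * q ^ (d + 1))⁻¹ = e₃, (1 - c₄ * q ^ (d + 1))⁻¹ = e₄, (1 - q ^ (a + d + 1))⁻¹ = e₅,
    t⁻¹ = t'
  generalize 1 - c₁ * c₂ * q ^ (a + 1) = f₁, 1 - c₂ * q ^ (a + 1) = f₂,
    1 - c₁ * c₂ * c₃ * q ^ (2 * a + d + 3) = f₃, 1 - c₁ * c₂ * c₄ * q ^ (2 * a + d + 3) = f₄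
  have key : ∀ X : ℂ, X = X * (d₁ * d₁⁻¹) * (d₁ * d₁⁻¹) * (d₂ * d₂⁻¹) * (d₃ * d₃⁻¹) * (d₄ * d₄⁻¹) :=
    fun X => by
      rw [mul_inv_cancel₀ n1, mul_inv_cancel₀ n2, mul_inv_cancel₀ n3, mul_inv_cancel₀ hd]
      simp only [mul_one]
  refine Eq.trans ?_ (key _).symm
  generalize d₁⁻¹ = d₁', d₂⁻¹ = d₂', d₃⁻¹ = d₃', d₄⁻¹ = d₄'
  ring

/-- Both shifted terms and both certificates are rational multiples of the same `baseTerm`, and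
`telescoping_quotient` says that the multipliers add up to 1. The second shifted term comes from the
first by c₃ ↔ c₄. -/
theorem baseTerm_step (h : Generic q c₀ c₁ c₂ c₃ c₄ (N + 1)) {a d : ℕ} (hN : N = a + d) :
    baseTerm q c₁ c₂ c₃ c₄ (N + 1) a =
      baseCoeff q c₀ c₁ c₂ c₃ c₄ N * baseTerm q (c₁ * q) c₂ (c₃ * q) c₄ N a +
      baseCoeff q c₀ c₁ c₂ c₄ c₃ N * baseTerm q (c₁ * q) c₂ c₃ (c₄ * q) N a +
      (baseCert q c₁ c₂ c₃ c₄ N (a + 1) - baseCert q c₁ c₂ c₃ c₄ N a) := by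
  have hq := h.q_ne_zero
  have h2 := baseCoeff_mul_baseTerm h.dual hN
  rw [baseTerm_comm q (c₁ * q), baseTerm_comm q c₁] at h2
  rw [baseCoeff_mul_baseTerm h hN, h2, baseCert_succ h hN, baseCert]
  have e1 : q ^ (N + 1) = q ^ a * q ^ (d + 1) := by rw [hN]; ring
  have key := telescoping_quotient (q := q) (c₁ := c₁) (c₂ := c₂) (c₃ := c₃) (c₄ := c₄)
    (z := q ^ a) (w := q ^ (d + 1)) (mul_ne_zero hq h.ne₂) h.sub₃₄
    (by rw [← e1]; exact h.q_pow _ (by omega) le_rfl)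
    (by rw [show c₁ * c₂ * q * (q ^ a) ^ 2 = c₁ * c₂ * q ^ (2 * a + 1) by ring]
        exact h.free₁₂.ne _)
    (by rw [show c₁ * q * q ^ a = c₁ * q ^ (a + 1) by ring]; exact h.free₁.ne _)
    (h.free₃.ne _) (h.free₄.ne _)
  rw [show c₁ * c₂ * q * (q ^ a) ^ 2 * q ^ (d + 1) = c₁ * c₂ * q ^ (N + a + 2) by rw [hN]; ring,
    show c₁ * c₂ * q * (q ^ a) ^ 2 = c₁ * c₂ * q ^ (2 * a + 1) by ring,
    show c₁ * c₂ * q ^ 2 * (q ^ a) ^ 2 = c₁ * c₂ * q ^ (2 * a + 2) by ring,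
    show c₁ * c₂ * c₃ * q ^ 2 * (q ^ a) ^ 2 * q ^ (d + 1) = c₁ * c₂ * c₃ * q ^ (2 * a + d + 3) by
      ring,
    show c₁ * c₂ * c₄ * q ^ 2 * (q ^ a) ^ 2 * q ^ (d + 1) = c₁ * c₂ * c₄ * q ^ (2 * a + d + 3) by
      ring,
    show c₁ * c₂ * q * q ^ a = c₁ * c₂ * q ^ (a + 1) by ring,
    show c₁ * q * q ^ a = c₁ * q ^ (a + 1) by ring,
    show c₂ * q * q ^ a = c₂ * q ^ (a + 1) by ring, ← e1,
    show c₂ * c₄ * q * q ^ (N + 1) = c₂ * c₄ * q ^ (N + 2) by ring,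
    show c₂ * c₃ * q * q ^ (N + 1) = c₂ * c₃ * q ^ (N + 2) by ring] at key
  rw [show c₁ * c₂ * c₃ * q ^ (a + d + 3) * q ^ a = c₁ * c₂ * c₃ * q ^ (2 * a + d + 3) by ring,
    show c₁ * c₂ * c₄ * q ^ (a + d + 3) * q ^ a = c₁ * c₂ * c₄ * q ^ (2 * a + d + 3) by ring,
    ← sub_mul, ← add_mul, ← add_mul, ← key, one_mul]

/-- The term a = N + 1 has no counterpart at size N; it is cancelled by the upper end of the
telescoping sum. -/
theorem baseTerm_step_last (h : Generic q c₀ c₁ c₂ c₃ c₄ (N + 1)) :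
    baseTerm q c₁ c₂ c₃ c₄ (N + 1) (N + 1) = -baseCert q c₁ c₂ c₃ c₄ N (N + 1) := by
  have n1 : 1 - q ^ (N + 1) ≠ 0 := h.q_pow _ (by omega) le_rfl
  have n2 := h.free₁₂.ne (2 * (N + 1) + 1)
  rw [baseCert, show N + (N + 1) + 2 = 2 * (N + 1) + 1 by ring]
  field_simp

/-- The recurrence for vanishing degrees and variables. -/
theorem normGriffiths_base (hq : q ≠ 0) (c₀ c₁ c₂ c₃ c₄ : ℂ) (N : ℕ) :
    normGriffiths q c₀ c₁ c₂ c₃ c₄ N 0 0 0 0 =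
      ∑ a ∈ Finset.range (N + 1), baseTerm q c₁ c₂ c₃ c₄ N a := by
  rw [normGriffiths_eq_sum _ _ _ _ _ _ _ _ _ _ _ le_rfl]
  refine Finset.sum_congr rfl fun a ha => ?_
  rw [if_pos (by simp only [Finset.mem_range] at ha; omega), summand, baseTerm, racahPhi_zero,
    racahPhi_zero, racahPhi_dual hq, racahPhi_zero]
  simp [sideFactor]

theorem normGriffiths_base_step (h : Generic q c₀ c₁ c₂ c₃ c₄ (N + 1)) :
    normGriffiths q c₀ c₁ c₂ c₃ c₄ (N + 1) 0 0 0 0 =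
      baseCoeff q c₀ c₁ c₂ c₃ c₄ N * normGriffiths q c₀ (c₁ * q) c₂ (c₃ * q) c₄ N 0 0 0 0 +
      baseCoeff q c₀ c₁ c₂ c₄ c₃ N * normGriffiths q c₀ (c₁ * q) c₂ c₃ (c₄ * q) N 0 0 0 0 := by
  simp only [normGriffiths_base h.q_ne_zero]
  rw [Finset.sum_range_succ, baseTerm_step_last h, Finset.sum_congr rfl fun a ha =>
    baseTerm_step h (d := N - a) (by simp only [Finset.mem_range] at ha; omega)]
  rw [Finset.sum_add_distrib, Finset.sum_add_distrib, Finset.sum_range_sub, Finset.mul_sum,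
    Finset.mul_sum, show baseCert q c₁ c₂ c₃ c₄ N 0 = 0 by simp [baseCert]]
  ring

/-- The symmetry for vanishing degrees and variables. -/
theorem normGriffiths_base_symm :
    ∀ {N : ℕ} {c₀ c₁ c₂ c₃ c₄ : ℂ}, Generic q c₀ c₁ c₂ c₃ c₄ N →
      normGriffiths q c₀ c₁ c₂ c₃ c₄ N 0 0 0 0 = normGriffiths q c₂ c₁ c₀ c₄ c₃ N 0 0 0 0 := by
  intro N
  induction N with
  | zero =>
    intro c₀ c₁ c₂ c₃ c₄ h
    have n1 : 1 - c₁ * c₂ * q ≠ 0 := by simpa using h.free₁₂.ne 1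
    have n2 : 1 - c₁ * q * c₀ ≠ 0 := by
      rw [show c₁ * q * c₀ = c₀ * c₁ * q ^ 1 by ring]; exact h.free₀₁.ne 1
    simp only [normGriffiths_base h.q_ne_zero, zero_add, Finset.sum_range_one, baseTerm,
      baseWeight, sideWeight, Nat.sub_zero, mul_zero, qPoch_zero, qPoch_succ _ _ 0, pow_zero,
      mul_one, one_mul, pow_one, div_one]
    field_simp
  | succ N ih =>
    intro c₀ c₁ c₂ c₃ c₄ h
    rw [normGriffiths_base_step h, normGriffiths_base_step h.swap, ih h.shift₁₃, ih h.shift₁₄,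
      baseCoeff_swap q c₂, baseCoeff_swap q c₂]
    ring

end

/-! ### The induction on N for generic parameters. -/

section

variable {q c₀ c₁ c₂ c₃ c₄ : ℂ} {N : ℕ}

/-- Lowering i on the left and the corresponding second degree on the right gives the same four
coefficients and the same shift of c₂ and c₃, so the induction hypothesis applies term by term. -/
theorem normGriffiths_symm_of_pos
    (ih : ∀ {c₀ c₁ c₂ c₃ c₄ : ℂ}, Generic q c₀ c₁ c₂ c₃ c₄ N → ∀ {i j x y : ℕ}, i + j ≤ N →
      x + y ≤ N → normGriffiths q c₀ c₁ c₂ c₃ c₄ N i j x y =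
        normGriffiths q c₂ c₁ c₀ c₄ c₃ N j i y x)
    (h : Generic q c₀ c₁ c₂ c₃ c₄ (N + 1)) {i j x y : ℕ} (hij : i + 1 + j ≤ N + 1)
    (hxy : x + y ≤ N + 1) :
    normGriffiths q c₀ c₁ c₂ c₃ c₄ (N + 1) (i + 1) j x y =
      normGriffiths q c₂ c₁ c₀ c₄ c₃ (N + 1) j (i + 1) y x := by
  rw [normGriffiths_lower_i h (by omega) hxy, normGriffiths_lower_j h.swap (by omega)]
  have h' := h.shift₂₃
  congr 1
  · congr 1
    · rcases hxy.lt_or_eq with hlt | heq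
      · rw [ih h' (by omega) (by omega)]
      -- For x + y = N + 1 the pair (x, y) lies outside the induction hypothesis, but its
      -- coefficient vanishes.
      · rw [stepCoeff₀₀, show q ^ (N + 1) - q ^ (y + x) = 0 by rw [← heq, add_comm, sub_self]]
        ring
    · rcases y with _ | y
      · simp [stepCoeff₀₁]
      · rw [Nat.add_sub_cancel, ih h' (by omega) (by omega)]
  · congr 1
    · rcases x with _ | x
      · simp [stepCoeff₁₀]
      · rw [Nat.add_sub_cancel, ih h' (by omega) (by omega)]
    · rcases x with _ | x
      · simp [stepCoeff₁₁]
      · rw [Nat.add_sub_cancel, ih h' (by omega) (by omega)]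

/-- The symmetry of the normalized Griffiths polynomials for generic parameters. -/
theorem normGriffiths_symm : ∀ {N : ℕ} {c₀ c₁ c₂ c₃ c₄ : ℂ}, Generic q c₀ c₁ c₂ c₃ c₄ N →
    ∀ {i j x y : ℕ}, i + j ≤ N → x + y ≤ N →
      normGriffiths q c₀ c₁ c₂ c₃ c₄ N i j x y = normGriffiths q c₂ c₁ c₀ c₄ c₃ N j i y x := by
  intro N
  induction N with
  | zero =>
    intro c₀ c₁ c₂ c₃ c₄ h i j x y hij hxy
    obtain ⟨rfl, rfl⟩ : i = 0 ∧ j = 0 := by omega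
    obtain ⟨rfl, rfl⟩ : x = 0 ∧ y = 0 := by omega
    exact normGriffiths_base_symm h
  | succ N ih =>
    -- A positive i is lowered directly. If i = 0 and j > 0, the statement is read from right to
    -- left for the exchanged parameters.
    have main : ∀ {c₀ c₁ c₂ c₃ c₄ : ℂ}, Generic q c₀ c₁ c₂ c₃ c₄ (N + 1) → ∀ {i j x y : ℕ},
        i + j ≤ N + 1 → x + y ≤ N + 1 → i + j ≠ 0 →
        normGriffiths q c₀ c₁ c₂ c₃ c₄ (N + 1) i j x y =
          normGriffiths q c₂ c₁ c₀ c₄ c₃ (N + 1) j i y x := by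
      intro c₀ c₁ c₂ c₃ c₄ h i j x y hij hxy hne
      rcases i with _ | i
      · rcases j with _ | j
        · exact absurd rfl hne
        · exact (normGriffiths_symm_of_pos ih h.swap (by omega) (by omega)).symm
      · exact normGriffiths_symm_of_pos ih h hij hxy
    intro c₀ c₁ c₂ c₃ c₄ h i j x y hij hxy
    by_cases hne : i + j = 0
    · by_cases hne' : x + y = 0
      · obtain ⟨rfl, rfl⟩ : i = 0 ∧ j = 0 := by omega
        obtain ⟨rfl, rfl⟩ : x = 0 ∧ y = 0 := by omega
        exact normGriffiths_base_symm h
      -- Both degrees vanish but some variable does not: duality makes the variables into degrees,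
      -- and a second use of it returns to the original roles.
      · rw [normGriffiths_dual h.q_ne_zero, main h.dual hxy hij hne',
          normGriffiths_dual h.q_ne_zero]
    · exact main h hij hxy hne

end

/-! ### From the normalized to the original Griffiths polynomials. -/

theorem qPoch_add (a q : ℂ) (k l : ℕ) :
    qPoch a q (k + l) = qPoch a q k * qPoch (a * q ^ k) q l := by
  simp only [qPoch, Finset.prod_range_add]
  congr 1
  exact Finset.prod_congr rfl fun m _ => by ring

/-- Reversal of a `q`-Pochhammer symbol. -/
theorem qPoch_reverse {q : ℂ} (hq : q ≠ 0) :
    ∀ (k : ℕ) {a b : ℂ}, a * b * q ^ k = q →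
      qPoch a q k = (-1) ^ k * (a ^ k * q ^ (k.choose 2)) * qPoch b q k := by
  intro k
  induction k with
  | zero => intro a b _; simp [qPoch_zero]
  | succ k ih =>
    intro a b h
    have h1 : a * b * q ^ k = 1 := by
      refine mul_right_cancel₀ hq ?_
      rw [one_mul, mul_assoc, ← pow_succ, h]
    rw [qPoch_succ', qPoch_succ b, ih (a := a * q) (b := b) (by linear_combination h),
      Nat.choose_succ_succ' k 1, Nat.choose_one_right, mul_pow]
    linear_combination -(-1) ^ k * (a ^ k * q ^ k * q ^ (k.choose 2)) * qPoch b q k * h1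

theorem reducedPoch_add {u q : ℂ} (M a j : ℕ) (hj : j ≤ M) (hu : 1 - u * q ^ (2 * j + 1) ≠ 0) :
    reducedPoch u q (M + a) j = reducedPoch u q M j * qPoch (u * q ^ (j + M + 2)) q a := by
  refine mul_left_cancel₀ hu ?_
  rw [← mul_assoc, reducedPoch_mul _ _ hj, reducedPoch_mul _ _ (by omega),
    show M + a + 1 = M + 1 + a by ring, qPoch_add]
  congr 2
  ring

theorem Omega_split {r s₁ s₂ s₃ : ℂ} (h : r * s₂ ≠ 0) (n m : ℕ) :
    Omega r s₁ s₂ s₃ (n + m) n =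
      qPoch (r ^ 2) (r ^ 2) (n + m) * qPoch (r ^ 2 * s₂ ^ 2) (r ^ 2) n *
        qPoch (s₁ ^ 2 * s₂ ^ 2 * s₃ ^ 2 * (r ^ 2) ^ (n + m + 2)) (r ^ 2) n *
        qPoch (r ^ 2 * s₁ ^ 2) (r ^ 2) m /
      (qPoch (r ^ 2) (r ^ 2) n * qPoch (r ^ 2) (r ^ 2) m *
        reducedPoch (s₂ ^ 2 * s₃ ^ 2) (r ^ 2) (n + m) n * qPoch (r ^ 2 * s₃ ^ 2) (r ^ 2) n) *
      ((r * s₂) ^ m / (r * s₂) ^ n) := by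
  simp only [Omega, qBinom]
  rw [Nat.add_sub_cancel_left, show 2 * (n : ℤ) - ((n + m : ℕ) : ℤ) = n - m by push_cast; ring,
    zpow_sub₀ h, zpow_natCast, zpow_natCast]
  simp only [div_eq_mul_inv, mul_inv, inv_inv]
  ring

/-- The part of the constant relating the two normalizations that comes from the term sum. -/
def termConst (q c₀ c₄ : ℂ) (N j : ℕ) : ℂ :=
  qPoch (q * c₀) q j / (qPoch q q j * qPoch (q * c₄) q j * reducedPoch (c₀ * c₄) q N j)

/-- The constraint lets `qPoch_reverse` replace Pochhammer symbols in c₀, c₃, c₄ by symbols in c₁c₂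
and c₁c₂c₃. The dependence on a then has the shape of `baseWeight` and `sideWeight`, apart from
signs and monomials; `termConst` holds the Pochhammer symbols free of a. -/
theorem Omega_middle {r s₀ s₁ s₂ s₃ s₄ : ℂ} {N a j p : ℕ}
    (h : Generic (r ^ 2) (s₀ ^ 2) (s₁ ^ 2) (s₂ ^ 2) (s₃ ^ 2) (s₄ ^ 2) N)
    (hrs : r * s₀ ≠ 0) (hN : N = a + j + p) :
    Omega r s₃ s₀ s₄ (N - a) j =
      qPoch (r ^ 2) (r ^ 2) (N - a) * qPoch (s₁ ^ 2 * s₂ ^ 2 * r ^ 2) (r ^ 2) (N + a + 1) *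
        qPoch (r ^ 2 * s₃ ^ 2) (r ^ 2) p *
        qPoch (s₁ ^ 2 * s₂ ^ 2 * s₃ ^ 2 * (r ^ 2) ^ (a + p + 2)) (r ^ 2) a /
      (qPoch (r ^ 2) (r ^ 2) p * qPoch (s₁ ^ 2 * s₂ ^ 2 * r ^ 2) (r ^ 2) (2 * a + p + 1)) *
      termConst (r ^ 2) (s₀ ^ 2) (s₄ ^ 2) N j *
      ((-1) ^ j * (((s₃ ^ 2 * s₀ ^ 2 * s₄ ^ 2 * (r ^ 2) ^ (j + p + 2)) ^ j *
        (r ^ 2) ^ (j.choose 2))) * ((-1) ^ a * ((s₀ ^ 2 * s₄ ^ 2 * (r ^ 2) ^ (2 * j + p + 2)) ^ a *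
        (r ^ 2) ^ (a.choose 2))) * ((r * s₀) ^ p / (r * s₀) ^ j)) := by
  have hq := h.q_ne_zero
  have hc := h.constraint
  rw [hN] at hc
  have hM : N - a = j + p := by omega
  have hP1 := qPoch_reverse hq j (a := s₃ ^ 2 * s₀ ^ 2 * s₄ ^ 2 * (r ^ 2) ^ (j + p + 2))
    (b := s₁ ^ 2 * s₂ ^ 2 * r ^ 2 * (r ^ 2) ^ (2 * a + p + 1)) (by
      linear_combination (r ^ 2) * hc)
  have hP2 := qPoch_reverse hq a (a := s₀ ^ 2 * s₄ ^ 2 * (r ^ 2) ^ (j + (j + p) + 2))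
    (b := s₁ ^ 2 * s₂ ^ 2 * s₃ ^ 2 * (r ^ 2) ^ (a + p + 2)) (by
      linear_combination (r ^ 2) * hc)
  have hR := reducedPoch_add (j + p) a j (by omega) (h.free₀₄.ne (2 * j + 1))
  rw [show j + p + a = N by omega] at hR
  have hA := qPoch_add (s₁ ^ 2 * s₂ ^ 2 * r ^ 2) (r ^ 2) (2 * a + p + 1) j
  rw [show 2 * a + p + 1 + j = N + a + 1 by omega] at hA
  have n1 : qPoch (s₁ ^ 2 * s₂ ^ 2 * r ^ 2) (r ^ 2) (2 * a + p + 1) ≠ 0 :=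
    qPoch_ne_zero fun l _ => by
      rw [mul_assoc (s₁ ^ 2 * s₂ ^ 2), ← pow_succ']; exact h.free₁₂.ne _
  have n2 : qPoch (s₀ ^ 2 * s₄ ^ 2 * (r ^ 2) ^ (j + (j + p) + 2)) (r ^ 2) a ≠ 0 :=
    qPoch_ne_zero fun l _ => (h.free₀₄.mul_pow hq _).ne l
  rw [hM, Omega_split hrs, termConst, hR, hA, hP1, hP2, show 2 * j + p = j + (j + p) by ring]
  rw [hP2] at n2
  generalize qPoch (s₁ ^ 2 * s₂ ^ 2 * s₃ ^ 2 * (r ^ 2) ^ (a + p + 2)) (r ^ 2) a = P₁ at *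
  generalize (-1 : ℂ) ^ a * ((s₀ ^ 2 * s₄ ^ 2 * (r ^ 2) ^ (j + (j + p) + 2)) ^ a *
        (r ^ 2) ^ (a.choose 2)) = P₂ at *
  generalize qPoch (s₁ ^ 2 * s₂ ^ 2 * r ^ 2) (r ^ 2) (2 * a + p + 1) = P₃ at *
  generalize (-1 : ℂ) ^ j * (((s₃ ^ 2 * s₀ ^ 2 * s₄ ^ 2 * (r ^ 2) ^ (j + p + 2)) ^ j *
        (r ^ 2) ^ (j.choose 2))) = P₄
  have key : ∀ X : ℂ, X = X * (P₃ * P₃⁻¹) * ((P₂ * P₁) * (P₂ * P₁)⁻¹) := fun X => by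
    rw [mul_inv_cancel₀ n1, mul_inv_cancel₀ n2]; simp only [mul_one]
  refine (key _).trans ?_
  simp only [div_eq_mul_inv, mul_inv]
  ring

theorem Omega_last {r s₀ s₁ s₂ s₃ s₄ : ℂ} {N a y u : ℕ}
    (h : Generic (r ^ 2) (s₀ ^ 2) (s₁ ^ 2) (s₂ ^ 2) (s₃ ^ 2) (s₄ ^ 2) N)
    (hrs : r * s₂ ≠ 0) (hN : N = a + y + u) :
    Omega r s₄ s₂ s₁ (N - y) a =
      qPoch (r ^ 2) (r ^ 2) (a + u) * qPoch (r ^ 2 * s₂ ^ 2) (r ^ 2) a *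
        qPoch (s₁ ^ 2 * s₂ ^ 2 * s₄ ^ 2 * (r ^ 2) ^ (a + u + 2)) (r ^ 2) a *
        qPoch (r ^ 2 * s₄ ^ 2) (r ^ 2) u * qPoch (s₁ ^ 2 * s₂ ^ 2 * r ^ 2) (r ^ 2) a *
        (1 - s₁ ^ 2 * s₂ ^ 2 * (r ^ 2) ^ (2 * a + 1)) /
      (qPoch (r ^ 2) (r ^ 2) a * qPoch (r ^ 2) (r ^ 2) u *
        qPoch (s₁ ^ 2 * s₂ ^ 2 * r ^ 2) (r ^ 2) (2 * a + u + 1) *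
        qPoch (r ^ 2 * s₁ ^ 2) (r ^ 2) a) * ((r * s₂) ^ u / (r * s₂) ^ a) := by
  have hM : N - y = a + u := by omega
  have n0 := h.free₁₂.ne (2 * a + 1)
  have hv := reducedPoch_mul (s₁ ^ 2 * s₂ ^ 2) (r ^ 2) (N := a + u) (n := a) (by omega)
  have hA := qPoch_add (s₁ ^ 2 * s₂ ^ 2 * r ^ 2) (r ^ 2) a (a + u + 1)
  rw [show a + (a + u + 1) = 2 * a + u + 1 by ring,
    show s₁ ^ 2 * s₂ ^ 2 * r ^ 2 * (r ^ 2) ^ a = s₁ ^ 2 * s₂ ^ 2 * (r ^ 2) ^ (a + 1) by ring,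
    ← hv] at hA
  have n1 : qPoch (s₁ ^ 2 * s₂ ^ 2 * r ^ 2) (r ^ 2) a ≠ 0 :=
    qPoch_ne_zero fun l _ => by
      rw [mul_assoc (s₁ ^ 2 * s₂ ^ 2), ← pow_succ']; exact h.free₁₂.ne _
  rw [hM, Omega_split hrs, hA, mul_comm (s₂ ^ 2) (s₁ ^ 2),
    show s₄ ^ 2 * s₂ ^ 2 * s₁ ^ 2 = s₁ ^ 2 * s₂ ^ 2 * s₄ ^ 2 by ring]
  generalize 1 - s₁ ^ 2 * s₂ ^ 2 * (r ^ 2) ^ (2 * a + 1) = P₁ at *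
  generalize qPoch (s₁ ^ 2 * s₂ ^ 2 * r ^ 2) (r ^ 2) a = P₂ at *
  generalize qPoch (s₁ ^ 2 * s₂ ^ 2 * s₄ ^ 2 * (r ^ 2) ^ (a + u + 2)) (r ^ 2) a = P₃ at *
  have key : ∀ X : ℂ, X = X * (P₁ * P₁⁻¹) * (P₂ * P₂⁻¹) := fun X => by
    rw [mul_inv_cancel₀ n0, mul_inv_cancel₀ n1]; simp only [mul_one]
  refine (key _).trans ?_
  simp only [div_eq_mul_inv, mul_inv]
  ring

section

theorem ne_zero_of_roots {N : ℕ} {r s₀ s₁ s₂ s₃ s₄ : ℂ}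
    (h : r ^ (2 * N + 3) * s₀ * s₁ * s₂ * s₃ * s₄ = 1) :
    r ≠ 0 ∧ s₀ ≠ 0 ∧ s₁ ≠ 0 ∧ s₂ ≠ 0 ∧ s₃ ≠ 0 ∧ s₄ ≠ 0 := by
  refine ⟨?_, ?_, ?_, ?_, ?_, ?_⟩ <;> rintro rfl <;> simp at h

/-- With logarithms of the remaining square roots as variables and s₁ eliminated by the constraint,
an identity of monomials reduces to a polynomial identity between exponents, binomial exponents
included. -/
theorem exists_exp_of_roots {N : ℕ} {r s₀ s₁ s₂ s₃ s₄ : ℂ}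
    (h : r ^ (2 * N + 3) * s₀ * s₁ * s₂ * s₃ * s₄ = 1) :
    ∃ ρ σ₀ σ₂ σ₃ σ₄ : ℂ, r = Complex.exp ρ ∧ s₀ = Complex.exp σ₀ ∧ s₂ = Complex.exp σ₂ ∧
      s₃ = Complex.exp σ₃ ∧ s₄ = Complex.exp σ₄ ∧
      s₁ = Complex.exp (-((2 * N + 3) * ρ + σ₀ + σ₂ + σ₃ + σ₄)) := by
  obtain ⟨hr, h0, h1, h2, h3, h4⟩ := ne_zero_of_roots h
  refine ⟨Complex.log r, Complex.log s₀, Complex.log s₂, Complex.log s₃, Complex.log s₄,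
    (Complex.exp_log hr).symm, (Complex.exp_log h0).symm, (Complex.exp_log h2).symm,
    (Complex.exp_log h3).symm, (Complex.exp_log h4).symm, ?_⟩
  have e : ((2 * N + 3 : ℕ) : ℂ) = 2 * N + 3 := by push_cast; ring
  rw [Complex.exp_neg, Complex.exp_add, Complex.exp_add, Complex.exp_add, Complex.exp_add, ← e,
    Complex.exp_nat_mul, Complex.exp_log hr, Complex.exp_log h0, Complex.exp_log h2,
    Complex.exp_log h3, Complex.exp_log h4]
  refine eq_inv_of_mul_eq_one_left ?_
  rw [← h]
  ring

/-- The monomial relating the two normalizations of the terms. -/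
def termMono (r s₀ s₂ s₃ s₄ : ℂ) (N j k l : ℕ) : ℂ :=
  (s₃ ^ 2 * s₀ ^ 2 * s₄ ^ 2 * (r ^ 2) ^ (N + 2)) ^ j * (r ^ 2) ^ (j.choose 2) *
    ((r * s₀) ^ k / (r * s₀) ^ j) * (r * s₂) ^ l

/-- Since a + p = N - j and a + u is N - y in the application, the right side depends on a only
through the power of q c₂ that sits in `baseWeight`. -/
theorem term_monomial {N a j p u : ℕ} {r s₀ s₁ s₂ s₃ s₄ : ℂ}
    (h : r ^ (2 * N + 3) * s₀ * s₁ * s₂ * s₃ * s₄ = 1) (hp : N = a + j + p) :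
    (s₁ * s₂ * s₃ / s₄) ^ a * (r ^ 2) ^ ((a + 1).choose 2) *
      ((s₃ ^ 2 * s₀ ^ 2 * s₄ ^ 2 * (r ^ 2) ^ (j + p + 2)) ^ j * (r ^ 2) ^ (j.choose 2)) *
      ((s₀ ^ 2 * s₄ ^ 2 * (r ^ 2) ^ (2 * j + p + 2)) ^ a * (r ^ 2) ^ (a.choose 2)) *
      ((r * s₀) ^ p / (r * s₀) ^ j) * ((r * s₂) ^ u / (r * s₂) ^ a) =
    termMono r s₀ s₂ s₃ s₄ N j (a + p) (a + u) / (r ^ 2 * s₂ ^ 2) ^ a := by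
  obtain ⟨ρ, σ₀, σ₂, σ₃, σ₄, rfl, rfl, rfl, rfl, rfl, rfl⟩ := exists_exp_of_roots h
  simp only [termMono, ← Complex.exp_nat_mul, ← Complex.exp_add, ← Complex.exp_sub]
  congr 1
  have hp' : (N : ℂ) = a + j + p := by rw [hp]; push_cast; ring
  push_cast [Nat.cast_choose_two]
  rw [hp']
  ring

/-- The monomial relating the two normalizations of the Griffiths polynomials. -/
def bridgeMono (r s₀ s₁ s₂ s₃ s₄ : ℂ) (N i j x y m l : ℕ) : ℂ :=
  (s₂ * s₃ * s₄ / s₁) ^ i * (r ^ 2) ^ ((i + 1).choose 2) *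
    ((s₄ * s₂ * s₁ / s₃) ^ x * (r ^ 2) ^ ((x + 1).choose 2)) * s₀ ^ N *
    termMono r s₀ s₂ s₃ s₄ N j (i + m) (x + l) * ((r * s₂) ^ m / (r * s₂) ^ i) /
    ((s₀ ^ 2 * s₄ ^ 2 * (r ^ 2) ^ (2 * j + m + 2)) ^ i * (r ^ 2) ^ (i.choose 2)) /
    (((s₃ ^ 2) ^ j * (r ^ 2) ^ (N * j) / (r ^ 2) ^ (j.choose 2)) *
      ((s₄ ^ 2) ^ y * (r ^ 2) ^ (N * y) / (r ^ 2) ^ (y.choose 2)))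

/-- This accounts for the half-integer powers in the theorem: once the factors ω and the powers of
c₀ and c₂ are included, the exponents of the two sides agree. -/
theorem bridgeMono_symm {N i j x y m l : ℕ} {r s₀ s₁ s₂ s₃ s₄ : ℂ}
    (h : r ^ (2 * N + 3) * s₀ * s₁ * s₂ * s₃ * s₄ = 1) (hm : N = i + j + m)
    (hl : N = x + y + l) :
    bridgeMono r s₀ s₁ s₂ s₃ s₄ N i j x y m l = bridgeMono r s₂ s₁ s₀ s₄ s₃ N j i y x m l := by
  obtain ⟨ρ, σ₀, σ₂, σ₃, σ₄, rfl, rfl, rfl, rfl, rfl, rfl⟩ := exists_exp_of_roots h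
  simp only [bridgeMono, termMono, ← Complex.exp_nat_mul, ← Complex.exp_add, ← Complex.exp_sub]
  congr 1
  have hm' : (m : ℂ) = N - i - j := by rw [hm]; push_cast; ring
  have hl' : (l : ℂ) = N - x - y := by rw [hl]; push_cast; ring
  push_cast [Nat.cast_choose_two]
  rw [hm', hl']
  ring

/-- The factor relating the two normalizations of the Griffiths polynomials. -/
def bridgeConst (q c₀ c₁ c₂ c₃ c₄ : ℂ) (i j m : ℕ) : ℂ :=
  qPoch (q * c₀) q j * qPoch (q * c₂) q i * qPoch (q * c₁) q m /
    (qPoch q q j * qPoch q q i * qPoch q q m * qPoch (q * c₄) q j * qPoch (q * c₃) q i *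
      reducedPoch (c₀ * c₄) q (j + m) j * reducedPoch (c₂ * c₃) q (i + m) i)

theorem bridgeConst_symm (q c₀ c₁ c₂ c₃ c₄ : ℂ) (i j m : ℕ) :
    bridgeConst q c₀ c₁ c₂ c₃ c₄ i j m = bridgeConst q c₂ c₁ c₀ c₄ c₃ j i m := by
  simp only [bridgeConst]
  congr 1 <;> ring

variable {r s₀ s₁ s₂ s₃ s₄ : ℂ} {N : ℕ}

/-- In each summand ω and the normalizations of the middle and last factors together equal the
product of weights times a quantity free of a. The normalization of the first factor does not
involve a at all, so the constant can be taken out of the sum. -/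
theorem term_bridge (hs : r ^ (2 * N + 3) * s₀ * s₁ * s₂ * s₃ * s₄ = 1)
    (h : Generic (r ^ 2) (s₀ ^ 2) (s₁ ^ 2) (s₂ ^ 2) (s₃ ^ 2) (s₄ ^ 2) N) {a j p y u : ℕ}
    (hp : N = a + j + p) (hu : N = a + y + u) :
    omega r (s₁ * s₂ * s₃ / s₄) a * Omega r s₃ s₀ s₄ (N - a) j * Omega r s₄ s₂ s₁ (N - y) a =
      (-1) ^ j * termMono r s₀ s₂ s₃ s₄ N j (a + p) (a + u) *
        termConst (r ^ 2) (s₀ ^ 2) (s₄ ^ 2) N j / qPoch (r ^ 2) (r ^ 2) (a + p) *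
      (baseWeight (r ^ 2) (s₁ ^ 2) (s₂ ^ 2) N a *
        sideWeight (r ^ 2) (s₁ ^ 2 * s₂ ^ 2) (s₃ ^ 2) a p *
        sideWeight (r ^ 2) (s₁ ^ 2 * s₂ ^ 2) (s₄ ^ 2) a u) := by
  obtain ⟨hr, h0, h1, h2, h3, h4⟩ := ne_zero_of_roots hs
  have hmono := term_monomial (u := u) hs hp
  have n1 : qPoch (r ^ 2) (r ^ 2) (a + p) ≠ 0 := qPoch_ne_zero fun l hl => by
    rw [← pow_succ']; exact h.q_pow _ (by omega) (by omega)
  have sgn : (-1 : ℂ) ^ a * (-1) ^ a = 1 := by rw [← mul_pow]; simp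
  rw [Omega_middle h (mul_ne_zero hr h0) hp, Omega_last h (mul_ne_zero hr h2) hu, omega,
    baseWeight, sideWeight, sideWeight]
  generalize termMono r s₀ s₂ s₃ s₄ N j (a + p) (a + u) = M at *
  generalize (s₁ * s₂ * s₃ / s₄) ^ a = m₁ at *
  generalize (r ^ 2) ^ ((a + 1).choose 2) = m₂ at *
  generalize (s₃ ^ 2 * s₀ ^ 2 * s₄ ^ 2 * (r ^ 2) ^ (j + p + 2)) ^ j * (r ^ 2) ^ (j.choose 2) = m₃
    at *
  generalize (s₀ ^ 2 * s₄ ^ 2 * (r ^ 2) ^ (2 * j + p + 2)) ^ a * (r ^ 2) ^ (a.choose 2) = m₄ at *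
  generalize (r * s₀) ^ p / (r * s₀) ^ j = m₅ at *
  generalize (r * s₂) ^ u / (r * s₂) ^ a = m₆ at *
  generalize (r ^ 2 * s₂ ^ 2) ^ a = m₇ at *
  generalize termConst (r ^ 2) (s₀ ^ 2) (s₄ ^ 2) N j = T
  generalize (-1 : ℂ) ^ a = ε at *
  generalize (-1 : ℂ) ^ j = ε'
  generalize 1 - s₁ ^ 2 * s₂ ^ 2 * (r ^ 2) ^ (2 * a + 1) = f₁
  generalize s₁ ^ 2 * s₂ ^ 2 * s₃ ^ 2 * (r ^ 2) ^ (a + p + 2) = x₁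
  generalize s₁ ^ 2 * s₂ ^ 2 * s₄ ^ 2 * (r ^ 2) ^ (a + u + 2) = x₂
  generalize s₁ ^ 2 * s₂ ^ 2 * r ^ 2 = x₃
  generalize r ^ 2 * s₁ ^ 2 = x₄, r ^ 2 * s₂ ^ 2 = x₅, r ^ 2 * s₃ ^ 2 = x₆, r ^ 2 * s₄ ^ 2 = x₇
  generalize qPoch (r ^ 2) (r ^ 2) (a + p) = P₁ at *
  generalize r ^ 2 = q at *
  simp only [div_eq_mul_inv, mul_inv] at hmono ⊢
  trans ε' * (ε * ε) * (m₁ * m₂ * m₃ * m₄ * m₅ * m₆) * T *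
      (qPoch q q (N - a) * qPoch x₃ q (N + a + 1) * qPoch x₆ q p * qPoch x₁ q a *
        ((qPoch q q p)⁻¹ * (qPoch x₃ q (2 * a + p + 1))⁻¹) *
      (qPoch q q (a + u) * qPoch x₅ q a * qPoch x₂ q a * qPoch x₇ q u * qPoch x₃ q a * f₁ *
        ((qPoch q q a)⁻¹ * (qPoch q q u)⁻¹ * (qPoch x₃ q (2 * a + u + 1))⁻¹ *
          (qPoch x₄ q a)⁻¹)))
  · ring
  · trans ε' * T * (M * m₇⁻¹) * (P₁ * P₁⁻¹) *
      (qPoch q q (N - a) * qPoch x₃ q (N + a + 1) * qPoch x₆ q p * qPoch x₁ q a *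
        ((qPoch q q p)⁻¹ * (qPoch x₃ q (2 * a + p + 1))⁻¹) *
      (qPoch q q (a + u) * qPoch x₅ q a * qPoch x₂ q a * qPoch x₇ q u * qPoch x₃ q a * f₁ *
        ((qPoch q q a)⁻¹ * (qPoch q q u)⁻¹ * (qPoch x₃ q (2 * a + u + 1))⁻¹ *
          (qPoch x₄ q a)⁻¹)))
    · rw [sgn, hmono, mul_inv_cancel₀ n1]
      ring
    · ring

theorem sideFactor_eq (q c : ℂ) (N j : ℕ) :
    sideFactor q c N j = (-1) ^ j * (c ^ j * q ^ (N * j) / q ^ (j.choose 2)) := by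
  rw [sideFactor, neg_pow]
  ring

/-- The total constant is written as a sign, a monomial and a Pochhammer quotient, each invariant
under the exchange of parameters and indices, times the `sideFactor`s already present in
`normGriffiths`. -/
theorem const_bridge (hs : r ^ (2 * N + 3) * s₀ * s₁ * s₂ * s₃ * s₄ = 1)
    (h : Generic (r ^ 2) (s₀ ^ 2) (s₁ ^ 2) (s₂ ^ 2) (s₃ ^ 2) (s₄ ^ 2) N) {i j x y m l : ℕ}
    (hm : N = i + j + m) :
    (-1) ^ j * termMono r s₀ s₂ s₃ s₄ N j (i + m) (x + l) *
        termConst (r ^ 2) (s₀ ^ 2) (s₄ ^ 2) N j / qPoch (r ^ 2) (r ^ 2) (i + m) *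
      Omega r s₁ s₂ s₃ (i + m) i * omega r (s₂ * s₃ * s₄ / s₁) i *
      omega r (s₄ * s₂ * s₁ / s₃) x * s₀ ^ N =
    (-1) ^ (x + y) * bridgeMono r s₀ s₁ s₂ s₃ s₄ N i j x y m l *
      bridgeConst (r ^ 2) (s₀ ^ 2) (s₁ ^ 2) (s₂ ^ 2) (s₃ ^ 2) (s₄ ^ 2) i j m *
      (sideFactor (r ^ 2) (s₃ ^ 2) N j * sideFactor (r ^ 2) (s₄ ^ 2) N y) := by
  obtain ⟨hr, h0, h1, h2, h3, h4⟩ := ne_zero_of_roots hs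
  have hq := h.q_ne_zero
  have hc := h.constraint
  rw [hm] at hc
  have hP := qPoch_reverse hq i (a := s₀ ^ 2 * s₄ ^ 2 * (r ^ 2) ^ (2 * j + m + 2))
    (b := s₁ ^ 2 * s₂ ^ 2 * s₃ ^ 2 * (r ^ 2) ^ (i + m + 2)) (by
      linear_combination (r ^ 2) * hc)
  have hR := reducedPoch_add (j + m) i j (by omega) (h.free₀₄.ne (2 * j + 1))
  rw [show j + m + i = N by omega, show j + (j + m) + 2 = 2 * j + m + 2 by ring, hP] at hR
  have n1 : qPoch (r ^ 2) (r ^ 2) (i + m) ≠ 0 := qPoch_ne_zero fun l hl => by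
    rw [← pow_succ']; exact h.q_pow _ (by omega) (by omega)
  have n2 : qPoch (s₁ ^ 2 * s₂ ^ 2 * s₃ ^ 2 * (r ^ 2) ^ (i + m + 2)) (r ^ 2) i ≠ 0 :=
    qPoch_ne_zero fun l _ => (h.free₁₂₃.mul_pow hq _).ne l
  have n3 : (s₃ ^ 2) ^ j * (r ^ 2) ^ (N * j) / (r ^ 2) ^ (j.choose 2) ≠ 0 := by positivity
  have n4 : (s₄ ^ 2) ^ y * (r ^ 2) ^ (N * y) / (r ^ 2) ^ (y.choose 2) ≠ 0 := by positivity
  have sgn : ∀ k, (-1 : ℂ) ^ k * (-1) ^ k = 1 := fun k => by rw [← mul_pow]; simp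
  have s2 := sgn y
  have s3 := inv_eq_of_mul_eq_one_right (sgn i)
  have s4 := sgn i
  rw [Omega_split (mul_ne_zero hr h2), termConst, hR, bridgeMono, bridgeConst, sideFactor_eq,
    sideFactor_eq, omega, omega, pow_add (-1 : ℂ) x y]
  generalize qPoch (s₁ ^ 2 * s₂ ^ 2 * s₃ ^ 2 * (r ^ 2) ^ (i + m + 2)) (r ^ 2) i = P₁ at *
  generalize qPoch (r ^ 2) (r ^ 2) (i + m) = P₂ at *
  generalize (s₃ ^ 2) ^ j * (r ^ 2) ^ (N * j) / (r ^ 2) ^ (j.choose 2) = H₃ at *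
  generalize (s₄ ^ 2) ^ y * (r ^ 2) ^ (N * y) / (r ^ 2) ^ (y.choose 2) = H₄ at *
  generalize (-1 : ℂ) ^ i = εi at *
  generalize (-1 : ℂ) ^ j = εj at *
  generalize (-1 : ℂ) ^ x = εx at *
  generalize (-1 : ℂ) ^ y = εy at *
  generalize (s₀ ^ 2 * s₄ ^ 2 * (r ^ 2) ^ (2 * j + m + 2)) ^ i * (r ^ 2) ^ (i.choose 2) = G
  generalize termMono r s₀ s₂ s₃ s₄ N j (i + m) (x + l) = M
  generalize (r * s₂) ^ m / (r * s₂) ^ i = m₁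
  generalize (s₂ * s₃ * s₄ / s₁) ^ i = m₂, (r ^ 2) ^ ((i + 1).choose 2) = m₃,
    (s₄ * s₂ * s₁ / s₃) ^ x = m₄, (r ^ 2) ^ ((x + 1).choose 2) = m₅, s₀ ^ N = m₆
  have key : ∀ X : ℂ, X * (εi * εi) * (P₂ * P₂⁻¹) * (P₁ * P₁⁻¹) =
      X * (εy * εy) * (H₃ * H₃⁻¹) * (H₄ * H₄⁻¹) := fun X => by
    rw [s2, s4, mul_inv_cancel₀ n1, mul_inv_cancel₀ n2, mul_inv_cancel₀ n3, mul_inv_cancel₀ n4]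
  simp only [div_eq_mul_inv, mul_inv, s3]
  generalize P₁⁻¹ = P₁', P₂⁻¹ = P₂', H₃⁻¹ = H₃', H₄⁻¹ = H₄' at *
  generalize r ^ 2 * s₀ ^ 2 = x₀, r ^ 2 * s₁ ^ 2 = x₁, r ^ 2 * s₂ ^ 2 = x₂, r ^ 2 * s₃ ^ 2 = x₃,
    r ^ 2 * s₄ ^ 2 = x₄, s₀ ^ 2 * s₄ ^ 2 = x₅, s₂ ^ 2 * s₃ ^ 2 = x₆
  generalize r ^ 2 = q at *
  refine Eq.trans ?_ ((key (εj * εx * M * m₁ * m₂ * m₃ * m₄ * m₅ * m₆ * G⁻¹ *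
    (qPoch x₀ q j * qPoch x₂ q i * qPoch x₁ q m * ((qPoch q q j)⁻¹ * (qPoch q q i)⁻¹ *
      (qPoch q q m)⁻¹ * (qPoch x₄ q j)⁻¹ * (qPoch x₃ q i)⁻¹ * (reducedPoch x₅ q (j + m) j)⁻¹ *
      (reducedPoch x₆ q (i + m) i)⁻¹)))).trans ?_)
  · ring
  · ring

/-- The Griffiths polynomials in terms of the normalized ones. -/
theorem griffiths_eq (hs : r ^ (2 * N + 3) * s₀ * s₁ * s₂ * s₃ * s₄ = 1)
    (h : Generic (r ^ 2) (s₀ ^ 2) (s₁ ^ 2) (s₂ ^ 2) (s₃ ^ 2) (s₄ ^ 2) N) {i j x y m l : ℕ}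
    (hm : N = i + j + m) (hl : N = x + y + l) :
    griffiths r s₁ s₂ s₃ s₄ N i j x y * omega r (s₂ * s₃ * s₄ / s₁) i *
      omega r (s₄ * s₂ * s₁ / s₃) x * s₀ ^ N =
    (-1) ^ (x + y) * bridgeMono r s₀ s₁ s₂ s₃ s₄ N i j x y m l *
      bridgeConst (r ^ 2) (s₀ ^ 2) (s₁ ^ 2) (s₂ ^ 2) (s₃ ^ 2) (s₄ ^ 2) i j m *
      normGriffiths (r ^ 2) (s₀ ^ 2) (s₁ ^ 2) (s₂ ^ 2) (s₃ ^ 2) (s₄ ^ 2) N i j x y := by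
  have hs₀ : (r ^ (2 * N + 3) * s₁ * s₂ * s₃ * s₄)⁻¹ = s₀ := by
    symm
    refine eq_inv_of_mul_eq_one_left ?_
    rw [← hs]; ring
  have hG : griffiths r s₁ s₂ s₃ s₄ N i j x y =
      (-1) ^ j * termMono r s₀ s₂ s₃ s₄ N j (i + m) (x + l) *
        termConst (r ^ 2) (s₀ ^ 2) (s₄ ^ 2) N j / qPoch (r ^ 2) (r ^ 2) (i + m) *
      Omega r s₁ s₂ s₃ (i + m) i * ∑ a ∈ Finset.range (N + 1), if a + j ≤ N ∧ a + y ≤ N then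
        summand (r ^ 2) (s₀ ^ 2) (s₁ ^ 2) (s₂ ^ 2) (s₃ ^ 2) (s₄ ^ 2) N i j x y a else 0 := by
    simp only [griffiths]
    rw [hs₀, Finset.sum_filter, Finset.mul_sum]
    refine Finset.sum_congr rfl fun a _ => ?_
    split_ifs with hc
    swap
    · rw [mul_zero]
    obtain ⟨haj, hay⟩ := hc
    have hb := term_bridge hs h (a := a) (j := j) (p := N - j - a) (y := y) (u := N - y - a)
      (by omega) (by omega)
    rw [show a + (N - j - a) = i + m by omega, show a + (N - y - a) = x + l by omega] at hb
    simp only [qRacah]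
    rw [if_pos (by omega), if_pos (by omega), if_pos (by omega), summand, racahPhi, racahPhi,
      racahPhi, show N - j = i + m by omega]
    rw [show N - j = i + m by omega] at hb
    linear_combination (Omega r s₁ s₂ s₃ (i + m) i *
      phi43 (r ^ 2) i (s₂ ^ 2 * s₃ ^ 2 * (r ^ 2) ^ (i + 1)) ((r ^ 2) ^ a)⁻¹
        (s₁ ^ 2 * s₂ ^ 2 * (r ^ 2) ^ (a + 1)) (r ^ 2 * s₂ ^ 2)
        (s₁ ^ 2 * s₂ ^ 2 * s₃ ^ 2 * (r ^ 2) ^ (i + m + 2)) ((r ^ 2) ^ (i + m))⁻¹ (r ^ 2) *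
      phi43 (r ^ 2) j (s₀ ^ 2 * s₄ ^ 2 * (r ^ 2) ^ (j + 1)) ((r ^ 2) ^ y)⁻¹
        (s₃ ^ 2 * s₀ ^ 2 * (r ^ 2) ^ (y + 1)) (r ^ 2 * s₀ ^ 2)
        (s₃ ^ 2 * s₀ ^ 2 * s₄ ^ 2 * (r ^ 2) ^ (N - a + 2)) ((r ^ 2) ^ (N - a))⁻¹ (r ^ 2) *
      phi43 (r ^ 2) a (s₂ ^ 2 * s₁ ^ 2 * (r ^ 2) ^ (a + 1)) ((r ^ 2) ^ x)⁻¹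
        (s₄ ^ 2 * s₂ ^ 2 * (r ^ 2) ^ (x + 1)) (r ^ 2 * s₂ ^ 2)
        (s₄ ^ 2 * s₂ ^ 2 * s₁ ^ 2 * (r ^ 2) ^ (N - y + 2)) ((r ^ 2) ^ (N - y))⁻¹ (r ^ 2)) * hb
  have hC := const_bridge hs h (x := x) (y := y) (l := l) hm
  rw [hG, normGriffiths]
  linear_combination (∑ a ∈ Finset.range (N + 1), if a + j ≤ N ∧ a + y ≤ N then
    summand (r ^ 2) (s₀ ^ 2) (s₁ ^ 2) (s₂ ^ 2) (s₃ ^ 2) (s₄ ^ 2) N i j x y a else 0) * hC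

/-- The symmetry for generic parameters. -/
theorem griffiths_symm_of_generic (hs : r ^ (2 * N + 3) * s₀ * s₁ * s₂ * s₃ * s₄ = 1)
    (h : Generic (r ^ 2) (s₀ ^ 2) (s₁ ^ 2) (s₂ ^ 2) (s₃ ^ 2) (s₄ ^ 2) N) {i j x y : ℕ}
    (hij : i + j ≤ N) (hxy : x + y ≤ N) :
    griffiths r s₁ s₂ s₃ s₄ N i j x y * omega r (s₂ * s₃ * s₄ / s₁) i *
        omega r (s₄ * s₂ * s₁ / s₃) x * s₀ ^ N =
      griffiths r s₁ s₀ s₄ s₃ N j i y x * omega r (s₃ * s₀ * s₄ / s₁) j *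
        omega r (s₁ * s₀ * s₃ / s₄) y * s₂ ^ N := by
  obtain ⟨m, hm⟩ := Nat.exists_eq_add_of_le hij
  obtain ⟨l, hl⟩ := Nat.exists_eq_add_of_le hxy
  have hs' : r ^ (2 * N + 3) * s₂ * s₁ * s₀ * s₄ * s₃ = 1 := by rw [← hs]; ring
  rw [griffiths_eq hs h hm hl, show s₃ * s₀ * s₄ / s₁ = s₀ * s₄ * s₃ / s₁ by ring,
    show s₁ * s₀ * s₃ / s₄ = s₃ * s₀ * s₁ / s₄ by ring,
    griffiths_eq hs' h.swap (m := m) (l := l) (by omega) (by omega), normGriffiths_symm h hij hxy,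
    bridgeMono_symm hs hm hl, bridgeConst_symm, add_comm x y]

end

/-! ### From generic to admissible parameters by continuity. -/

theorem continuousAt_qPoch {f : ℂ → ℂ} {t₀ : ℂ} (hf : ContinuousAt f t₀) (q : ℂ) (k : ℕ) :
    ContinuousAt (fun t => qPoch (f t) q k) t₀ := by
  simp only [qPoch]
  fun_prop

theorem continuousAt_reducedPoch {f : ℂ → ℂ} {t₀ : ℂ} (hf : ContinuousAt f t₀) (q : ℂ) (M n : ℕ) :
    ContinuousAt (fun t => reducedPoch (f t) q M n) t₀ := by
  simp only [reducedPoch]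
  fun_prop

theorem qPoch_self_ne_zero {q : ℂ} {k M : ℕ} (h : ∀ m : ℕ, 1 ≤ m → m ≤ M → q ^ m ≠ 1)
    (hk : k ≤ M) : qPoch q q k ≠ 0 :=
  qPoch_ne_zero fun l hl => by
    rw [← pow_succ']
    exact sub_ne_zero.mpr (h _ (by omega) (by omega)).symm

theorem qPoch_inv_pow_ne_zero {q : ℂ} {k M : ℕ} (hq : q ≠ 0)
    (h : ∀ m : ℕ, 1 ≤ m → m ≤ M → q ^ m ≠ 1) (hk : k ≤ M) : qPoch (q ^ M)⁻¹ q k ≠ 0 :=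
  qPoch_ne_zero fun l hl h0 => by
    refine h (M - l) (by omega) (by omega) ?_
    have hl' := pow_ne_zero l hq
    have e : q ^ M = q ^ (M - l) * q ^ l := by rw [← pow_add]; congr 1; omega
    rw [e, mul_inv, inv_mul_cancel_right₀ hl', sub_eq_zero, eq_comm, inv_eq_one] at h0
    exact h0

/-- The conditions on the parameters under which the `q`-Racah polynomials are continuous. -/
structure RacahRegular (q b₂ b₃ u v : ℂ) (M : ℕ) : Prop where
  q_ne_zero : q ≠ 0
  q_pow_ne_one : ∀ k : ℕ, 1 ≤ k → k ≤ M → q ^ k ≠ 1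
  middle : ∀ k : ℕ, 1 ≤ k → k ≤ M → b₂ * q ^ k ≠ 1
  last : ∀ k : ℕ, 1 ≤ k → k ≤ M → b₃ * q ^ k ≠ 1
  pair : ∀ k : ℕ, 2 ≤ k → k ≤ 2 * M → u * q ^ k ≠ 1
  triple : ∀ k : ℕ, M + 1 ≤ k → k ≤ 2 * M → 2 ≤ k → v * q ^ k ≠ 1

theorem qPoch_mul_ne_zero {q b : ℂ} {k M : ℕ} (h : ∀ k : ℕ, 1 ≤ k → k ≤ M → b * q ^ k ≠ 1)
    (hk : k ≤ M) : qPoch (q * b) q k ≠ 0 :=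
  qPoch_ne_zero fun l hl => by
    rw [show q * b * q ^ l = b * q ^ (l + 1) by ring]
    exact sub_ne_zero.mpr (h _ (by omega) (by omega)).symm

/-- The exponents n + 1 + l with l ≠ n and l, n ≤ M never equal 1 or 2M + 1, as these would force l
= n = 0 or l = n = M. So the bounds 2 and 2M suffice. -/
theorem reducedPoch_ne_zero {q u : ℂ} {n M : ℕ} (h : ∀ k : ℕ, 2 ≤ k → k ≤ 2 * M → u * q ^ k ≠ 1)
    (hn : n ≤ M) : reducedPoch u q M n ≠ 0 :=
  Finset.prod_ne_zero_iff.mpr fun l hl => by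
    simp only [Finset.mem_erase, Finset.mem_range] at hl
    exact sub_ne_zero.mpr (h _ (by omega) (by omega)).symm

theorem continuousAt_qRacah {f₁ f₂ f₃ : ℂ → ℂ} {r t₀ : ℂ} {M : ℕ}
    (h₁ : ContinuousAt f₁ t₀) (h₂ : ContinuousAt f₂ t₀) (h₃ : ContinuousAt f₃ t₀)
    (hf₂ : f₂ t₀ ≠ 0)
    (h : RacahRegular (r ^ 2) (f₂ t₀ ^ 2) (f₃ t₀ ^ 2) (f₂ t₀ ^ 2 * f₃ t₀ ^ 2)
      (r ^ 2 * f₁ t₀ ^ 2 * f₂ t₀ ^ 2 * f₃ t₀ ^ 2) M) (n x : ℕ) :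
    ContinuousAt (fun t => qRacah r (f₁ t) (f₂ t) (f₃ t) M n x) t₀ := by
  simp only [qRacah]
  split_ifs with hnx
  swap
  · exact continuousAt_const
  obtain ⟨hn, -⟩ := hnx
  have hr : r ≠ 0 := by
    rintro rfl
    exact h.q_ne_zero (by simp)
  have triple : ∀ k ≤ n, qPoch (f₁ t₀ ^ 2 * f₂ t₀ ^ 2 * f₃ t₀ ^ 2 * (r ^ 2) ^ (M + 2)) (r ^ 2) k
      ≠ 0 := fun k hk => qPoch_ne_zero fun l hl => by
    rw [show f₁ t₀ ^ 2 * f₂ t₀ ^ 2 * f₃ t₀ ^ 2 * (r ^ 2) ^ (M + 2) * (r ^ 2) ^ l =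
      r ^ 2 * f₁ t₀ ^ 2 * f₂ t₀ ^ 2 * f₃ t₀ ^ 2 * (r ^ 2) ^ (M + 1 + l) by ring]
    exact sub_ne_zero.mpr (h.triple _ (by omega) (by omega) (by omega)).symm
  refine ContinuousAt.mul ?_ ?_
  · simp only [Omega]
    refine ContinuousAt.div ?_ ?_ ?_
    · exact continuousAt_const.mul (((continuousAt_qPoch (by fun_prop) _ _).mul
        (continuousAt_qPoch (by fun_prop) _ _)).mul (continuousAt_qPoch (by fun_prop) _ _))
    · exact (((continuousAt_const.mul h₂).zpow₀ _ (Or.inl (mul_ne_zero hr hf₂))).mul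
        (continuousAt_reducedPoch (by fun_prop) _ _ _)).mul (continuousAt_qPoch (by fun_prop) _ _)
    · exact mul_ne_zero (mul_ne_zero (zpow_ne_zero _ (mul_ne_zero hr hf₂))
        (reducedPoch_ne_zero h.pair hn)) (qPoch_mul_ne_zero h.last hn)
  · simp only [phi43]
    refine tendsto_finsetSum _ fun k hk => ?_
    have hk : k ≤ n := Nat.lt_succ_iff.mp (Finset.mem_range.mp hk)
    refine ContinuousAt.mul (ContinuousAt.div ?_ ?_ ?_) continuousAt_const
    · exact ((continuousAt_const.mul (continuousAt_qPoch (by fun_prop) _ _)).mul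
        continuousAt_const).mul (continuousAt_qPoch (by fun_prop) _ _)
    · exact (((continuousAt_qPoch (by fun_prop) _ _).mul
        (continuousAt_qPoch (by fun_prop) _ _)).mul continuousAt_const).mul continuousAt_const
    · exact mul_ne_zero (mul_ne_zero (mul_ne_zero (qPoch_mul_ne_zero h.middle (hk.trans hn))
        (triple k hk)) (qPoch_inv_pow_ne_zero h.q_ne_zero h.q_pow_ne_one (hk.trans hn)))
        (qPoch_self_ne_zero h.q_pow_ne_one (hk.trans hn))

theorem mul_pow_ne_one {q u : ℂ} {k : ℕ} (h : u ≠ (q ^ k)⁻¹) :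
    u * q ^ k ≠ 1 := fun e => h (eq_inv_of_mul_eq_one_left e)

theorem omega_continuousAt {f : ℂ → ℂ} {t₀ : ℂ} (hf : ContinuousAt f t₀) (r : ℂ) (n : ℕ) :
    ContinuousAt (fun t => omega r (f t) n) t₀ := by
  simp only [omega]
  fun_prop

/-- The sum is finite, and admissibility at t₀ keeps the denominators of all three q-Racah factors
away from zero there. -/
theorem continuousAt_griffiths {f₀ f₁ f₂ f₃ f₄ : ℂ → ℂ} {r t₀ : ℂ} {N : ℕ}
    (h₀ : ContinuousAt f₀ t₀) (h₁ : ContinuousAt f₁ t₀) (h₂ : ContinuousAt f₂ t₀)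
    (h₃ : ContinuousAt f₃ t₀) (h₄ : ContinuousAt f₄ t₀)
    (hs : ∀ t, (r ^ (2 * N + 3) * f₁ t * f₂ t * f₃ t * f₄ t)⁻¹ = f₀ t)
    (h : Admissible (r ^ 2) (f₀ t₀ ^ 2) (f₁ t₀ ^ 2) (f₂ t₀ ^ 2) (f₃ t₀ ^ 2) (f₄ t₀ ^ 2) N)
    {i j : ℕ} (hij : i + j ≤ N) (x y : ℕ) :
    ContinuousAt (fun t => griffiths r (f₁ t) (f₂ t) (f₃ t) (f₄ t) N i j x y) t₀ := by
  simp only [griffiths, hs]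
  have hq := h.q_ne_zero
  have ne : ∀ {z : ℂ}, z ^ 2 ∈ ({f₀ t₀ ^ 2, f₁ t₀ ^ 2, f₂ t₀ ^ 2, f₃ t₀ ^ 2, f₄ t₀ ^ 2} : Set ℂ) →
      z ≠ 0 := fun hz h0 => h.c_ne_zero _ hz (by rw [h0]; simp)
  have c : ∀ z ∈ ({f₀ t₀ ^ 2, f₁ t₀ ^ 2, f₂ t₀ ^ 2, f₃ t₀ ^ 2, f₄ t₀ ^ 2} : Set ℂ),
      ∀ k : ℕ, 1 ≤ k → k ≤ N → z * (r ^ 2) ^ k ≠ 1 := fun z hz k h1 h2 =>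
    mul_pow_ne_one (h.c_ne z hz k h1 h2)
  have p := fun u hu k h1 h2 => mul_pow_ne_one (h.product_ne u hu k h1 h2)
  refine tendsto_finsetSum _ fun a ha => ?_
  obtain ⟨haj, hay⟩ := (Finset.mem_filter.mp ha).2
  refine ((ContinuousAt.mul ?_ ?_).mul ?_).mul ?_
  · exact omega_continuousAt (((h₁.mul h₂).mul h₃).div h₄ (ne (by simp))) _ _
  · refine continuousAt_qRacah h₁ h₂ h₃ (ne (by simp)) ⟨hq, ?_, ?_, ?_, ?_, ?_⟩ _ _
    · exact fun k h1 h2 => h.q_pow_ne_one k h1 (by omega)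
    · exact fun k h1 h2 => c _ (by simp) k h1 (by omega)
    · exact fun k h1 h2 => c _ (by simp) k h1 (by omega)
    · exact fun k h1 h2 => p _ (by simp) k h1 (by omega)
    · exact fun k h1 h2 h3 => p _ (by simp) k h3 (by omega)
  · refine continuousAt_qRacah h₃ h₀ h₄ (ne (by simp)) ⟨hq, ?_, ?_, ?_, ?_, ?_⟩ _ _
    · exact fun k h1 h2 => h.q_pow_ne_one k h1 (by omega)
    · exact fun k h1 h2 => c _ (by simp) k h1 (by omega)
    · exact fun k h1 h2 => c _ (by simp) k h1 (by omega)
    · exact fun k h1 h2 => p _ (by simp) k h1 (by omega)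
    · refine fun k h1 h2 h3 => ?_
      rw [show r ^ 2 * f₃ t₀ ^ 2 * f₀ t₀ ^ 2 * f₄ t₀ ^ 2 =
        r ^ 2 * f₀ t₀ ^ 2 * f₃ t₀ ^ 2 * f₄ t₀ ^ 2 by ring]
      exact p _ (by simp) k h3 (by omega)
  · refine continuousAt_qRacah h₄ h₂ h₁ (ne (by simp)) ⟨hq, ?_, ?_, ?_, ?_, ?_⟩ _ _
    · exact fun k h1 h2 => h.q_pow_ne_one k h1 (by omega)
    · exact fun k h1 h2 => c _ (by simp) k h1 (by omega)
    · exact fun k h1 h2 => c _ (by simp) k h1 (by omega)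
    · refine fun k h1 h2 => ?_
      rw [mul_comm (f₂ t₀ ^ 2)]
      exact p _ (by simp) k h1 (by omega)
    · refine fun k h1 h2 h3 => ?_
      rw [show r ^ 2 * f₄ t₀ ^ 2 * f₂ t₀ ^ 2 * f₁ t₀ ^ 2 =
        r ^ 2 * f₁ t₀ ^ 2 * f₂ t₀ ^ 2 * f₄ t₀ ^ 2 by ring]
      exact p _ (by simp) k h3 (by omega)

theorem countable_pow_eq {n : ℕ} (hn : 0 < n) (a : ℂ) : {t : ℂ | t ^ n = a}.Countable := by
  refine Set.Finite.countable ((Polynomial.nthRoots n a).toFinset.finite_toSet.subset fun t ht => ?_)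
  simpa [Polynomial.mem_nthRoots hn] using ht

theorem countable_not_free {q : ℂ} (c : ℂ) {n : ℕ} (hn : 0 < n) :
    {t : ℂ | ¬ Free q (c * t ^ n)}.Countable := by
  refine (Set.countable_iUnion fun k : ℤ => countable_pow_eq hn (c * q ^ k)⁻¹).mono fun t ht => ?_
  simp only [Free, Set.mem_ofPred_eq, not_forall, not_not] at ht
  obtain ⟨k, hk⟩ := ht
  refine Set.mem_iUnion.mpr ⟨k, eq_inv_of_mul_eq_one_left ?_⟩
  rw [← hk]
  ring

theorem countable_not_free_inv {q : ℂ} (c : ℂ) {n : ℕ} (hn : 0 < n) :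
    {t : ℂ | ¬ Free q (c * (t ^ n)⁻¹)}.Countable := by
  refine (countable_not_free (q := q) c⁻¹ hn).mono fun t ht => ?_
  simp only [Set.mem_ofPred_eq] at ht ⊢
  exact fun hf => ht (by simpa [mul_inv, mul_comm] using hf.inv)

/-- Generic parameters are dense. -/
theorem dense_generic {q c₀ c₁ c₂ c₃ c₄ : ℂ} {N : ℕ} (hq : q ≠ 0)
    (hpow : ∀ k : ℕ, 1 ≤ k → k ≤ N → q ^ k ≠ 1)
    (hc : q ^ (2 * N + 3) * c₀ * c₁ * c₂ * c₃ * c₄ = 1) :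
    Dense {t : ℂ | t ≠ 0 ∧ Generic q (c₀ * (t ^ 30)⁻¹) (c₁ * t ^ 2) (c₂ * t ^ 4) (c₃ * t ^ 8)
      (c₄ * t ^ 16) N} := by
  have h0 : c₀ ≠ 0 := by rintro rfl; simp at hc
  have h1 : c₁ ≠ 0 := by rintro rfl; simp at hc
  have h2 : c₂ ≠ 0 := by rintro rfl; simp at hc
  have h3 : c₃ ≠ 0 := by rintro rfl; simp at hc
  have h4 : c₄ ≠ 0 := by rintro rfl; simp at hc
  -- The exponents -30, 2, 4, 8, 16 add up to 0, so the curve stays in the constraint. All products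
  -- whose genericity is required carry a nonzero power of t, so each condition excludes only
  -- countably many t. The exponents are even, so the square roots move along s₀t⁻¹⁵, s₁t, s₂t²,
  -- s₃t⁴, s₄t⁸.
  have hcount := (((((((((((((Set.countable_singleton (0 : ℂ)).union
    (countable_not_free_inv (q := q) c₀ (n := 30) (by norm_num))).union
    (countable_not_free (q := q) c₁ (n := 2) (by norm_num))).union
    (countable_not_free (q := q) c₂ (n := 4) (by norm_num))).union
    (countable_not_free (q := q) c₃ (n := 8) (by norm_num))).union
    (countable_not_free (q := q) c₄ (n := 16) (by norm_num))).union
    (countable_not_free (q := q) (c₁ * c₂) (n := 6) (by norm_num))).union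
    (countable_not_free (q := q) (c₂ * c₃) (n := 12) (by norm_num))).union
    (countable_not_free_inv (q := q) (c₀ * c₃) (n := 22) (by norm_num))).union
    (countable_not_free_inv (q := q) (c₀ * c₄) (n := 14) (by norm_num))).union
    (countable_not_free (q := q) (c₂ * c₄) (n := 20) (by norm_num))).union
    (countable_not_free_inv (q := q) (c₀ * c₁) (n := 28) (by norm_num))).union
    (countable_not_free_inv (q := q) (c₃ / c₄) (n := 8) (by norm_num)))
  refine (hcount.dense_compl ℂ).mono fun t ht => ?_
  simp only [Set.mem_compl_iff, Set.mem_union, not_or, Set.mem_ofPred_eq, not_not,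
    Set.mem_singleton_iff] at ht
  obtain ⟨⟨⟨⟨⟨⟨⟨⟨⟨⟨⟨⟨t0, f0⟩, f1⟩, f2⟩, f3⟩, f4⟩, f12⟩, f23⟩, f03⟩, f04⟩, f24⟩, f01⟩, f34⟩ := ht
  have e22 : (t ^ 30)⁻¹ * t ^ 8 = (t ^ 22)⁻¹ := by field_simp
  have e14 : (t ^ 30)⁻¹ * t ^ 16 = (t ^ 14)⁻¹ := by field_simp
  have e28 : (t ^ 30)⁻¹ * t ^ 2 = (t ^ 28)⁻¹ := by field_simp
  refine ⟨t0, hq, fun k h1 h2 => sub_ne_zero.mpr (hpow k h1 h2).symm, by positivity, by positivity,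
    by positivity, by positivity, by positivity, ?_, f0, f1, f2, f3, f4, ?_, ?_, ?_, ?_, ?_, ?_, ?_⟩
  · rw [← hc]; field_simp
  · convert f12 using 1; ring
  · convert f23 using 1; ring
  · convert f03 using 1; rw [← e22]; ring
  · convert f04 using 1; rw [← e14]; ring
  · convert f24 using 1; ring
  · convert f01 using 1; rw [← e28]; ring
  · convert f34 using 1; field_simp

theorem griffiths_eq_zero {r s₁ s₂ s₃ s₄ : ℂ} {N x y : ℕ} (h : N < x + y) (i j : ℕ) :
    griffiths r s₁ s₂ s₃ s₄ N i j x y = 0 := by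
  refine Finset.sum_eq_zero fun a ha => ?_
  obtain ⟨-, hay⟩ := (Finset.mem_filter.mp ha).2
  rw [show qRacah r s₄ s₂ s₁ (N - y) a x = 0 from if_neg (by omega), mul_zero]

/-- The symmetry of the Griffiths polynomials of `q`-Racah type. -/
theorem griffiths_symm {N : ℕ} {r s₀ s₁ s₂ s₃ s₄ : ℂ}
    (hs : r ^ (2 * N + 3) * s₀ * s₁ * s₂ * s₃ * s₄ = 1)
    (hl : Admissible (r ^ 2) (s₀ ^ 2) (s₁ ^ 2) (s₂ ^ 2) (s₃ ^ 2) (s₄ ^ 2) N)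
    (hr : Admissible (r ^ 2) (s₂ ^ 2) (s₁ ^ 2) (s₀ ^ 2) (s₄ ^ 2) (s₃ ^ 2) N)
    {i j : ℕ} (x y : ℕ) (hij : i + j ≤ N) :
    griffiths r s₁ s₂ s₃ s₄ N i j x y * omega r (s₂ * s₃ * s₄ / s₁) i *
        omega r (s₄ * s₂ * s₁ / s₃) x * s₀ ^ N =
      griffiths r s₁ s₀ s₄ s₃ N j i y x * omega r (s₃ * s₀ * s₄ / s₁) j *
        omega r (s₁ * s₀ * s₃ / s₄) y * s₂ ^ N := by
  -- Outside the triangle x + y ≤ N both sides vanish, because the last q-Racah factor does.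
  rcases lt_or_ge N (x + y) with hxy | hxy
  · rw [griffiths_eq_zero hxy, griffiths_eq_zero (by omega)]
    simp
  obtain ⟨r0, n0, n1, n2, n3, n4⟩ := ne_zero_of_roots hs
  have hc : (r ^ 2) ^ (2 * N + 3) * s₀ ^ 2 * s₁ ^ 2 * s₂ ^ 2 * s₃ ^ 2 * s₄ ^ 2 = 1 := by
    trans (r ^ (2 * N + 3) * s₀ * s₁ * s₂ * s₃ * s₄) ^ 2
    · ring
    · rw [hs, one_pow]
  have hd := dense_generic hl.q_ne_zero hl.q_pow_ne_one hc
  set S := {t : ℂ | t ≠ 0 ∧ Generic (r ^ 2) (s₀ ^ 2 * (t ^ 30)⁻¹) (s₁ ^ 2 * t ^ 2)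
    (s₂ ^ 2 * t ^ 4) (s₃ ^ 2 * t ^ 8) (s₄ ^ 2 * t ^ 16) N} with hS
  -- The given parameters sit at t = 1, which need not be generic but is a limit of generic t. Both
  -- sides agree on S and are continuous at 1, so their values at 1 agree.
  have : (nhdsWithin (1 : ℂ) S).NeBot := mem_closure_iff_nhdsWithin_neBot.mp (hd 1)
  have k₀ : ContinuousAt (fun t : ℂ => s₀ * (t ^ 15)⁻¹) 1 :=
    continuousAt_const.mul ((continuousAt_id.pow 15).inv₀ (by simp))
  have k₁ : ContinuousAt (fun t : ℂ => s₁ * t) 1 := by fun_prop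
  have k₂ : ContinuousAt (fun t : ℂ => s₂ * t ^ 2) 1 := by fun_prop
  have k₃ : ContinuousAt (fun t : ℂ => s₃ * t ^ 4) 1 := by fun_prop
  have k₄ : ContinuousAt (fun t : ℂ => s₄ * t ^ 8) 1 := by fun_prop
  have e₀ : s₀ = (r ^ (2 * N + 3) * s₁ * s₂ * s₃ * s₄)⁻¹ :=
    eq_inv_of_mul_eq_one_left (by rw [← hs]; ring)
  have cl := continuousAt_griffiths k₀ k₁ k₂ k₃ k₄ (r := r) (N := N)
    (fun t => by rw [e₀, ← mul_inv]; congr 1; ring) (by simpa using hl) hij x y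
  have cr := continuousAt_griffiths k₂ k₁ k₀ k₄ k₃ (r := r) (N := N)
    (fun t => by
      -- The formula for the determined square root is required for every t. At t = 0 both sides are
      -- 0, by the convention 0⁻¹ = 0.
      rcases eq_or_ne t 0 with rfl | ht
      · simp
      · refine inv_eq_of_mul_eq_one_left ?_
        rw [← hs]
        field_simp) (by simpa using hr) (by omega : j + i ≤ N) y x
  have hL := ((cl.mul (omega_continuousAt (((k₂.mul k₃).mul k₄).div k₁ (by simpa using n1)) r i)).mul
    (omega_continuousAt (((k₄.mul k₂).mul k₁).div k₃ (by simpa using n3)) r x)).mul (k₀.pow N)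
  have hR := ((cr.mul (omega_continuousAt (((k₃.mul k₀).mul k₄).div k₁ (by simpa using n1)) r j)).mul
    (omega_continuousAt (((k₁.mul k₀).mul k₃).div k₄ (by simpa using n4)) r y)).mul (k₂.pow N)
  have key := tendsto_nhds_unique_of_eventuallyEq (hL.mono_left (nhdsWithin_le_nhds (s := S)))
    (hR.mono_left (nhdsWithin_le_nhds (s := S)))
    (by
      filter_upwards [self_mem_nhdsWithin] with t ht
      obtain ⟨ht, hg⟩ := ht
      refine griffiths_symm_of_generic ?_ ?_ hij hxy
      · rw [← hs]
        field_simp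
      · convert hg using 1 <;> ring)
  simpa using key

end QGriffiths

end

theorem mainTheorem1 (N : ℕ) (r s₀ s₁ s₂ s₃ s₄ : ℂ)
    (hroots : r ^ (2 * N + 3) * s₀ * s₁ * s₂ * s₃ * s₄ = 1)
    (hleft : QGriffiths.Admissible (r ^ 2)
      (s₀ ^ 2) (s₁ ^ 2) (s₂ ^ 2) (s₃ ^ 2) (s₄ ^ 2) N)
    (hright : QGriffiths.Admissible (r ^ 2)
      (s₂ ^ 2) (s₁ ^ 2) (s₀ ^ 2) (s₄ ^ 2) (s₃ ^ 2) N)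
    (i j x y : ℕ) (hij : i + j ≤ N) :
    QGriffiths.griffiths r s₁ s₂ s₃ s₄ N i j x y *
        QGriffiths.omega r (s₂ * s₃ * s₄ / s₁) i *
        QGriffiths.omega r (s₄ * s₂ * s₁ / s₃) x * s₀ ^ N =
      QGriffiths.griffiths r s₁ s₀ s₄ s₃ N j i y x *
        QGriffiths.omega r (s₃ * s₀ * s₄ / s₁) j *
        QGriffiths.omega r (s₁ * s₀ * s₃ / s₄) y * s₂ ^ N :=
  QGriffiths.griffiths_symm hroots hleft hright x y hij
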